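/- **Definitions.** Let $\mathcal M$ be a second countable Hausdorff space. *Conic coordinates* $(\tilde U,\Gamma,\pi)$ on $\mathcal M$ consist of $\tilde U=\tilde W\times B(0,R_0)\subset\mathbb R^k\times\mathbb R^{n-k}$ with $\tilde W$ open, $R_0>0$ and $n-k\ge 2$; a finite group $\Gamma\subset SO(n-k)$ acting by $(y,z)\mapsto(y,\gamma z)$; and a map $\pi:\tilde U\to\mathcal M$ inducing a homeomorphism of $\Gamma\backslash\tilde U$ onto an open subset of $\mathcal M$. A *conic manifold with group action* (CMGA) of dimension $n$ is such a space $\mathcal M=\mathcal M^{reg}\cup\mathcal M^{sing}$ in which $\mathcal M^{reg}$ is open and dense and is a $C^\infty$ Riemannian manifold with metric $g$, while $\mathcal M^{sing}=\mathcal M\setminus\mathcal M^{reg}$ is covered by countably many conic coordinate systems that are smoothly compatible (lifted coordinate changes are local diffeomorphisms) and satisfy the following. One has $\pi(y,z)\in\mathcal M^{sing}$ iff $z=0$; $\pi$ is a smooth local diffeomorphism from $\{z\ne0\}$ to $\mathcal M^{reg}$; and, writing $z=r\omega$ with $r=|z|$, the lifted metric has the form $$\pi^*g=dr^2+\sum a_{ij}\,dy^idy^j+r^2\sum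 b_{\alpha\beta}\,d\omega^\alpha d\omega^\beta+r\sum h_{j\alpha}\,dy^jd\omega^\alpha ,$$ where, as $r\to0$, uniformly for $(y,\omega)$ in compact subsets of $\tilde W\times S^{n-k-1}$, $a\to\hat a(y)$ with $\hat a(y)$ positive definite, $b\to\hat b(y,\omega)$ and $h\to0$, with $c_0\,g_{S^{n-k-1}}\le\hat b(y,\omega)\le T(y)^2g_{S^{n-k-1}}$, $0<T(y)\le c_1$, for some constants $c_0,c_1>0$. The distance $d_{\mathcal M}(x,y)\in[0,\infty]$ is the infimum of $\mathrm{Length}_g(\mu([0,1])\cap\mathcal M^{reg})$ over paths $\mu:[0,1]\to\mathcal M$ from $x$ to $y$ that are piecewise $C^1$ in the lifted local coordinates and meet $\mathcal M^{sing}$ in a finite set; $d_{\mathcal M}(x,W)=\inf_{w\in W}d_{\mathcal M}(x,w)$. The space $L^2(\mathcal M)$ is taken with respect to the Riemannian volume of $\mathcal M^{reg}$ ($\mathcal M^{sing}$ is a null set), $H^1(\mathcal M)$ is the space of $u\in L^2(\mathcal M)$ whose weak differential on $\mathcal M^{reg}$ is square integrable, and $A=-\Delta_g$ is the self-adjoint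 operator in $L^2(\mathcal M)$ associated with the form $Q(u,v)=\int_{\mathcal M^{reg}}g^{ij}\,\partial_iu\,\overline{\partial_jv}\,\det(g)^{1/2}dx$ with domain $H^1(\mathcal M)$. For $v_0,v_1\in L^2(\mathcal M)$ the solution of $\partial_t^2u-\Delta_gu=0$, $u|_{t=0}=v_0$, $\partial_tu|_{t=0}=v_1$ is $$u(t)=\cos(tA^{1/2})v_0+\sin(tA^{1/2})A^{-1/2}v_1 ,$$ with $\sin(t\lambda^{1/2})\lambda^{-1/2}=t$ at $\lambda=0$. **Proposition (finite speed of propagation).** Let $\mathcal M$ be a CMGA, let $W\subset\mathcal M$ be open and relatively compact, and let $v_0,v_1\in L^2(\mathcal M)$ satisfy $\operatorname{supp}(v_0)\cup\operatorname{supp}(v_1)\subset W$. Let $u$ be the solution of the wave equation with initial data $(v_0,v_1)$. Then for every $T>0$ $$\operatorname{supp}(u(\cdot,T))\subset\{x\in\mathcal M:\ d_{\mathcal M}(x,W)<T\}.$$ -/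

import Mathlib

open Set Filter Topology MeasureTheory TopologicalSpace
open scoped Manifold ContDiff ENNReal

noncomputable section

/-- Euclidean space `ℝⁿ`. -/
abbrev Euc (n : ℕ) : Type := EuclideanSpace ℝ (Fin n)

/-- A `C^∞` Riemannian metric on a `C^∞` manifold `X` of dimension `n`. -/
abbrev SmoothMetric (n : ℕ) (X : Type*) [TopologicalSpace X] [ChartedSpace (Euc n) X]
    [IsManifold 𝓘(ℝ, Euc n) ∞ X] : Type _ :=
  Bundle.ContMDiffRiemannianMetric 𝓘(ℝ, Euc n) ∞ (Euc n)
    (fun x : X => TangentSpace 𝓘(ℝ, Euc n) x)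

/-! ### Functions of an unbounded operator -/

/-- `B = f(A)`, for a nonnegative self-adjoint operator `A` in the Hilbert space `H`, given by its
graph (`A u w` means `u ∈ D(A)` and `A u = w`), and a bounded continuous `f : [0, ∞) → ℝ`.
Put `R = (A + 1)⁻¹`, so that `A = R⁻¹ - 1` and the spectrum of `R` lies in `[0, 1]`.  The bounded
operator `f(A)` is determined by `f(A) R = φ(R)` with the continuous function `φ(s) = f(1/s - 1) s`
on `[0, 1]`, `φ(0) = 0`, since the range of `R`, that is `D(A)`, is dense. -/
def IsFunctionOf {H : Type*} [NormedAddCommGroup H] [InnerProductSpace ℂ H] [CompleteSpace H]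
    (A : H → H → Prop) (f : ℝ → ℝ) (B : H →L[ℂ] H) : Prop :=
  ∃ R : H →L[ℂ] H, (∀ h, A (R h) (h - R h)) ∧ B ∘L R = cfc (fun s : ℝ => f (s⁻¹ - 1) * s) R

/-! ### Conic manifolds with group action -/

/-- Conic coordinates `(Ũ, Γ, π)` on a space `M` whose regular part `reg` carries the smooth
Riemannian metric `g`.  Here `Ũ = W × B(0, R₀) ⊆ ℝᵏ × ℝᵐ`, with coordinates `(y, z)`, `z = r θ`,
`r = |z|`, and `m ≥ 2` is the codimension of the singular stratum `z = 0`. -/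
structure ConicChart (n : ℕ) {M : Type*} [TopologicalSpace M] (reg : Opens M)
    [ChartedSpace (Euc n) reg] [IsManifold 𝓘(ℝ, Euc n) ∞ reg] (g : SmoothMetric n reg) where
  /-- dimension of the singular stratum -/
  k : ℕ
  /-- codimension of the singular stratum -/
  m : ℕ
  two_le_m : 2 ≤ m
  dim_eq : k + m = n
  /-- the range of the `y` coordinate -/
  W : Set (Euc k)
  isOpen_W : IsOpen W
  /-- the radius of the range of the `z` coordinate -/
  R₀ : ℝ
  R₀_pos : 0 < R₀
  /-- the group, acting by `(y, z) ↦ (y, γ z)` -/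
  Γ : Subgroup (Euc m ≃ₗᵢ[ℝ] Euc m)
  finite_Γ : Finite Γ
  det_Γ : ∀ γ ∈ Γ, LinearMap.det (γ.toLinearEquiv : Euc m →ₗ[ℝ] Euc m) = 1
  /-- the projection `π : Ũ → M` (only its values on `Ũ` matter) -/
  proj : Euc k × Euc m → M
  /-- the projection `π`, restricted to the regular part of `Ũ` -/
  regProj : Euc k × Euc m → reg
  -- `π` induces a homeomorphism of `Γ \ Ũ` onto an open subset of `M`
  continuousOn_proj : ContinuousOn proj (W ×ˢ Metric.ball 0 R₀)
  isOpen_image : ∀ V ⊆ W ×ˢ Metric.ball (0 : Euc m) R₀, IsOpen V → IsOpen (proj '' V)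
  proj_eq_iff : ∀ x ∈ W ×ˢ Metric.ball (0 : Euc m) R₀, ∀ x' ∈ W ×ˢ Metric.ball (0 : Euc m) R₀,
    (proj x = proj x' ↔ ∃ γ ∈ Γ, x' = (x.1, γ x.2))
  -- the regular part of `Ũ` is the complement of `z = 0`, and `π` is a smooth covering there
  proj_mem_reg_iff : ∀ x ∈ W ×ˢ Metric.ball (0 : Euc m) R₀, (proj x ∈ reg ↔ x.2 ≠ 0)
  coe_regProj : ∀ x ∈ W ×ˢ Metric.ball (0 : Euc m) R₀, x.2 ≠ 0 → (regProj x : M) = proj x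
  isLocalDiffeomorphOn_regProj :
    IsLocalDiffeomorphOn 𝓘(ℝ, Euc k × Euc m) 𝓘(ℝ, Euc n) ∞ regProj
      (W ×ˢ (Metric.ball 0 R₀ \ {0}))
  /-- the lifted metric `g̃ = π^* g` on the regular part of `Ũ` -/
  lift : Euc k × Euc m → Euc k × Euc m → Euc k × Euc m → ℝ
  lift_eq : ∀ x v w, lift x v w =
    g.inner (regProj x) (mfderiv 𝓘(ℝ, Euc k × Euc m) 𝓘(ℝ, Euc n) regProj x v)
      (mfderiv 𝓘(ℝ, Euc k × Euc m) 𝓘(ℝ, Euc n) regProj x w)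
  /-- `g̃ = dr² + a dy² + r² b dθ² + r h dy dθ`: the radial field `∂_r` has `g̃`-length one and is
  `g̃`-orthogonal to the `y` and `θ` directions (both sides are multiplied by `r`). -/
  lift_radial : ∀ y ∈ W, ∀ z ∈ Metric.ball (0 : Euc m) R₀, z ≠ 0 → ∀ (η : Euc k) (ζ : Euc m),
    lift (y, z) (0, z) (η, ζ) = inner ℝ z ζ
  /-- the limit of the coefficients `a` as `r → 0` -/
  aHat : Euc k → Euc k →ₗ[ℝ] Euc k →ₗ[ℝ] ℝ
  /-- the limit of the coefficients `b` as `r → 0`; `bHat y θ` is used on `T_θ S = θ^⊥` -/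
  bHat : Euc k → Euc m → Euc m →ₗ[ℝ] Euc m →ₗ[ℝ] ℝ
  /-- `a → aHat`, `b → bHat`, `h → 0` as `r → 0`, uniformly in `(y, θ)` in compact sets.  The tangent
  vector `ζ ∈ T_θ S` of the sphere corresponds to the vector `(0, r ζ)` at the point `(y, r θ)`. -/
  lift_limit : ∀ K ⊆ W, IsCompact K → ∀ ε > 0, ∃ δ > 0, ∀ y ∈ K, ∀ θ : Euc m, ‖θ‖ = 1 →
    ∀ r : ℝ, 0 < r → r < R₀ → r < δ → ∀ (η η' : Euc k) (ζ ζ' : Euc m),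
      inner ℝ θ ζ = 0 → inner ℝ θ ζ' = 0 →
      |lift (y, r • θ) (η, 0) (η', 0) - aHat y η η'| ≤ ε * ‖η‖ * ‖η'‖ ∧
      |lift (y, r • θ) (0, ζ) (0, ζ') - bHat y θ ζ ζ'| ≤ ε * ‖ζ‖ * ‖ζ'‖ ∧
      |lift (y, r • θ) (η, 0) (0, ζ)| ≤ ε * ‖η‖ * ‖ζ‖
  aHat_pos : ∀ y ∈ W, ∀ η : Euc k, η ≠ 0 → 0 < aHat y η η
  /-- `c₀ g_S ≤ bHat ≤ T(y)² g_S` with `0 < T(y) ≤ c₁` -/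
  bHat_bounds : ∃ c₀ > 0, ∃ c₁ > 0, ∃ T : Euc k → ℝ, ∀ y ∈ W, 0 < T y ∧ T y ≤ c₁ ∧
    ∀ θ : Euc m, ‖θ‖ = 1 → ∀ ζ : Euc m, inner ℝ θ ζ = 0 →
      c₀ * ‖ζ‖ ^ 2 ≤ bHat y θ ζ ζ ∧ bHat y θ ζ ζ ≤ T y ^ 2 * ‖ζ‖ ^ 2

namespace ConicChart

variable {n : ℕ} {M : Type*} [TopologicalSpace M] {reg : Opens M} [ChartedSpace (Euc n) reg]
  [IsManifold 𝓘(ℝ, Euc n) ∞ reg] {g : SmoothMetric n reg}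

/-- The domain `Ũ = W × B(0, R₀)` of conic coordinates. -/
def dom (C : ConicChart n reg g) : Set (Euc C.k × Euc C.m) :=
  C.W ×ˢ Metric.ball 0 C.R₀

end ConicChart

/-- A conic manifold with group action (CMGA) of dimension `n` on the space `M`: an open dense
regular part that is a smooth Riemannian manifold, and countably many conic coordinate systems
which cover the singular part and are compatible as smooth orbifold charts. -/
structure CMGA (n : ℕ) (M : Type*) [TopologicalSpace M] where
  /-- the regular part -/
  reg : Opens M
  dense_reg : Dense (reg : Set M)
  chartedSpace : ChartedSpace (Euc n) reg
  isManifold : IsManifold 𝓘(ℝ, Euc n) ∞ reg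
  /-- the metric on the regular part -/
  metric : SmoothMetric n reg
  /-- the index set of the conic coordinates -/
  ι : Type
  countable_ι : Countable ι
  /-- the conic coordinates -/
  chart : ι → ConicChart n reg metric
  cover : ∀ p ∉ reg, ∃ i, p ∈ (chart i).proj '' (chart i).dom
  /-- two conic coordinate systems are related by local diffeomorphisms of the lifted coordinates -/
  compatible : ∀ i j, ∀ x ∈ (chart i).dom, ∀ x' ∈ (chart j).dom,
    (chart i).proj x = (chart j).proj x' →
    ∃ Φ : OpenPartialHomeomorph (Euc (chart i).k × Euc (chart i).m)
        (Euc (chart j).k × Euc (chart j).m),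
      x ∈ Φ.source ∧ Φ x = x' ∧ Φ.source ⊆ (chart i).dom ∧ Φ.target ⊆ (chart j).dom ∧
      ContDiffOn ℝ ∞ Φ Φ.source ∧ ContDiffOn ℝ ∞ Φ.symm Φ.target ∧
      ∀ w ∈ Φ.source, (chart j).proj (Φ w) = (chart i).proj w

namespace CMGA

variable {n : ℕ} {M : Type*} [TopologicalSpace M]

attribute [instance] CMGA.chartedSpace CMGA.isManifold

/-! ### The distance -/

open Classical in
/-- The `g`-speed at time `s` of a path `μ` in `M`, where `μ s` is a regular point (zero elsewhere).
Near such `s` the path stays in the regular part. -/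
def speed (X : CMGA n M) (μ : ℝ → M) (s : ℝ) : ℝ≥0∞ :=
  if h : μ s ∈ X.reg then
    let ν : ℝ → X.reg := fun t => if h' : μ t ∈ X.reg then ⟨μ t, h'⟩ else ⟨μ s, h⟩
    let v : TangentSpace 𝓘(ℝ, Euc n) (ν s) := mfderiv 𝓘(ℝ, ℝ) 𝓘(ℝ, Euc n) ν s (1 : ℝ)
    ENNReal.ofReal (Real.sqrt (X.metric.inner (ν s) v v))
  else 0

/-- `Length_g (μ([0,1]) ∩ M^reg)`. -/
def length (X : CMGA n M) (μ : ℝ → M) : ℝ≥0∞ :=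
  ∫⁻ s in Icc (0 : ℝ) 1, X.speed μ s

/-- On `[a, b]` the path `μ` is a `C¹` path of the regular part, or lifts to a `C¹` path in the domain
of one of the conic coordinate systems. -/
def IsC1Piece (X : CMGA n M) (μ : ℝ → M) (a b : ℝ) : Prop :=
  (∃ ν : ℝ → X.reg, ContMDiffOn 𝓘(ℝ, ℝ) 𝓘(ℝ, Euc n) 1 ν (Icc a b) ∧
      ∀ s ∈ Icc a b, (ν s : M) = μ s) ∨
    ∃ (i : X.ι) (ν : ℝ → Euc (X.chart i).k × Euc (X.chart i).m), ContDiffOn ℝ 1 ν (Icc a b) ∧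
      ∀ s ∈ Icc a b, ν s ∈ (X.chart i).dom ∧ (X.chart i).proj (ν s) = μ s

/-- `μ : [0,1] → M` is a path from `x` to `y` which is piecewise `C¹` in the lifted local coordinates
and meets the singular part in a finite set. -/
structure IsAdmissiblePath (X : CMGA n M) (μ : ℝ → M) (x y : M) : Prop where
  source : μ 0 = x
  target : μ 1 = y
  piecewise : ∃ (N : ℕ) (t : ℕ → ℝ), t 0 = 0 ∧ t N = 1 ∧
    ∀ j < N, t j < t (j + 1) ∧ X.IsC1Piece μ (t j) (t (j + 1))
  finite_sing : (μ '' Icc 0 1 ∩ (X.reg : Set M)ᶜ).Finite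

/-- The distance `d_M` (infinite between points that no admissible path joins). -/
def dist (X : CMGA n M) (x y : M) : ℝ≥0∞ :=
  ⨅ (μ : ℝ → M) (_ : X.IsAdmissiblePath μ x y), X.length μ

/-- `M(W, T) = {x ∈ M : d_M(x, W) < T}`. -/
def domainOfInfluence (X : CMGA n M) (W : Set M) (T : ℝ) : Set M :=
  {x | (⨅ w ∈ W, X.dist x w) < ENNReal.ofReal T}

/-! ### The Riemannian volume -/

/-- The standard basis of `ℝⁿ`. -/
def stdVec (n : ℕ) (i : Fin n) : Euc n := EuclideanSpace.single i (1 : ℝ)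

/-- The coordinate vector field `∂_i` of the chart `e`, at the point with coordinates `a`. -/
def coordVec (X : CMGA n M) (e : OpenPartialHomeomorph X.reg (Euc n)) (a : Euc n) (i : Fin n) :
    TangentSpace 𝓘(ℝ, Euc n) (e.symm a) :=
  mfderiv 𝓘(ℝ, Euc n) 𝓘(ℝ, Euc n) e.symm a (stdVec n i)

/-- The matrix `(g_ij)` in the chart `e`, at the point with coordinates `a`. -/
def metricMatrix (X : CMGA n M) (e : OpenPartialHomeomorph X.reg (Euc n)) (a : Euc n) :
    Matrix (Fin n) (Fin n) ℝ :=
  Matrix.of fun i j => X.metric.inner (e.symm a) (X.coordVec e a i) (X.coordVec e a j)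

variable [MeasurableSpace M]

/-- The measure `det(g)^{1/2} dx` on the domain of the chart `e`. -/
def chartVolume (X : CMGA n M) (e : OpenPartialHomeomorph X.reg (Euc n)) : Measure X.reg :=
  (((volume : Measure (Euc n)).restrict e.target).withDensity
    (fun a => ENNReal.ofReal (Real.sqrt (X.metricMatrix e a).det))).map e.symm

/-- The Riemannian volume measure of the regular part.  The measures `det(g)^{1/2} dx` agree on the
overlaps of charts, so that their supremum is the measure that restricts to each of them. -/
def regVolume (X : CMGA n M) : Measure X.reg :=
  ⨆ e ∈ atlas (Euc n) X.reg, X.chartVolume e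

/-- The Riemannian volume measure of `M`, for which the singular part has measure zero. -/
def vol (X : CMGA n M) : Measure M :=
  X.regVolume.map Subtype.val

/-- `L²(M)`, with the inner product `(u, v) = ∫ u v̄ det(g)^{1/2} dx`. -/
abbrev L2 (X : CMGA n M) : Type _ := Lp ℂ 2 X.vol

/-! ### The Sobolev space `H¹(M)`, the quadratic form and its operator -/

/-- A complex covector field on the regular part. -/
abbrev CovectorField (X : CMGA n M) : Type _ :=
  (x : X.reg) → (TangentSpace 𝓘(ℝ, Euc n) x →L[ℝ] ℂ)

/-- `α` is the weak differential of `u` on the regular part: in every chart the components `α_i` and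
`u` are locally integrable and `∫ u ∂_i ψ = - ∫ α_i ψ` for all test functions `ψ`. -/
def IsWeakDifferential (X : CMGA n M) (u : M → ℂ) (α : X.CovectorField) : Prop :=
  ∀ e ∈ atlas (Euc n) X.reg,
    LocallyIntegrableOn (fun a => u (e.symm a)) e.target ∧
    ∀ i : Fin n,
      LocallyIntegrableOn (fun a => α (e.symm a) (X.coordVec e a i)) e.target ∧
      ∀ ψ : Euc n → ℝ, ContDiff ℝ ∞ ψ → HasCompactSupport ψ → tsupport ψ ⊆ e.target →
        ∫ a, (fderiv ℝ ψ a (stdVec n i)) • u (e.symm a) =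
          - ∫ a, ψ a • α (e.symm a) (X.coordVec e a i)

/-- The pairing `g^{ij} α_i \bar{β_j}` at a regular point. -/
def cometric (X : CMGA n M) (x : X.reg) (α β : TangentSpace 𝓘(ℝ, Euc n) x →L[ℝ] ℂ) : ℂ :=
  let b : Fin n → TangentSpace 𝓘(ℝ, Euc n) x := fun i => stdVec n i
  let G : Matrix (Fin n) (Fin n) ℝ := Matrix.of fun i j => X.metric.inner x (b i) (b j)
  ∑ i, ∑ j, (G⁻¹ i j : ℂ) * α (b i) * (starRingEnd ℂ) (β (b j))

/-- `u ∈ H¹(M)`, with weak differential `α`: both are square integrable. -/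
def IsH1 (X : CMGA n M) (u : X.L2) (α : X.CovectorField) : Prop :=
  X.IsWeakDifferential u α ∧
    ∫⁻ x, ENNReal.ofReal (X.cometric x (α x) (α x)).re ∂X.regVolume < ⊤

/-- `u ∈ D(A)` and `A u = f`, where `A = -Δ_g` is the self-adjoint operator in `L²(M)` associated to
the form `Q(u, v) = ∫ g^{ij} ∂_i u \bar{∂_j v} det(g)^{1/2} dx` with domain `H¹(M)`. -/
def IsNegLaplacian (X : CMGA n M) (u f : X.L2) : Prop :=
  ∃ α, X.IsH1 u α ∧ ∀ (v : X.L2) (β : X.CovectorField), X.IsH1 v β →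
    ∫ x, X.cometric x (α x) (β x) ∂X.regVolume = inner ℂ v f

/-! ### Solutions of the wave equation -/

/-- `u(t) = cos(t A^{1/2}) v₀ + sin(t A^{1/2}) A^{-1/2} v₁`: the solution of `∂_t² u - Δ_g u = 0` with
`u(0) = v₀`, `∂_t u(0) = v₁`.  The function `sin(t λ^{1/2}) λ^{-1/2}` is `t` at `λ = 0`. -/
def IsWaveSolution (X : CMGA n M) (v₀ v₁ : X.L2) (u : ℝ → X.L2) : Prop :=
  ∀ t : ℝ, ∃ C S : X.L2 →L[ℂ] X.L2,
    IsFunctionOf X.IsNegLaplacian (fun l => Real.cos (t * √l)) C ∧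
    IsFunctionOf X.IsNegLaplacian (fun l => if l = 0 then t else Real.sin (t * √l) / √l) S ∧
    u t = C v₀ + S v₁

/-- The (essential) support of `u ∈ L²(M)`: the complement of the largest open set on which `u`
vanishes almost everywhere. -/
def supp (X : CMGA n M) (u : X.L2) : Set M :=
  {x | ∀ U : Set M, IsOpen U → x ∈ U → ¬ ∀ᵐ y ∂X.vol, y ∈ U → u y = 0}

end CMGA

end

/-!
Finite speed of propagation on a conic manifold with group action is proved by exponentially
weighted resolvent estimates, rather than by energy estimates on light cones.

*The weight.* Let `ρ` be a bounded function, locally Lipschitz on the regular part, with `|dρ| ≤ 1`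
and `ρ = 0` on the supports of the data. If `(A + λ²) u = f` with `f` supported in `{ρ = 0}`,
testing the weak form of the equation with `e^{2κρ} u`, for `κ = λ - 1`, gives
`(λ² - κ²) ‖e^{κρ} u‖ ≤ ‖f‖` (`IsNegLaplacian.weighted_norm_le`). That `e^{2κρ} u` lies in `H¹(M)`
is the product rule for weak derivatives and Lipschitz functions (`HasWeakDerivOn.smul`), which
needs test functions on the regular part only: the singular part plays no role here, as `H¹(M)` is
defined on the regular part. Hence `λ ⟨h, (A + λ²)⁻¹ f⟩ = O(e^{-λr})` for `h` supported in
`{ρ ≥ r}`.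

*From the resolvent to the wave operators.* The families `cos(t√A)` and `sin(t√A)/√A` have the
Laplace transforms `λ (A + λ²)⁻¹` and `(A + λ²)⁻¹` (`laplace_waveFamily`). A continuous function of
`t` with Laplace transform `O(e^{-λr})` vanishes on `(0, r)` (`eq_zero_of_laplace_le`), and so do
the matrix elements of the wave operators between `f` and `h` (`inner_waveFamily_eq_zero`). The
functional calculus is that of the bounded operator `R = (A + 1)⁻¹`. It exists by hypothesis; that
it is unique, self-adjoint and of spectrum in `[0, 1]` follows from the form, and its range is
dense because test functions on the regular part are in `H¹(M)` (`IsResolvent.denseRange`).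
Together these give `IsWaveSolution.ae_eq_zero`: the solution at time `T` vanishes where
`ρ ≥ r > T`.

*The choice of `ρ`.* Take `ρ = χ + min(d_M(·, W), T + 1)`. The truncated distance has gradient at
most one, as `d_M` satisfies the triangle inequality and is bounded by the length of coordinate
segments (`abs_diff_truncDist_le`). The cutoff `χ` has gradient at most one, vanishes on the
supports of the data and is a constant `δ > 0` off a closed subset of `W` (`exists_cutoff`), so
that the two gradients are never present at the same point. The gain `δ` provides the room between
`T` and `r`, and gives vanishing on a whole neighbourhood of a point at distance `T` or more from
`W`. The conic structure enters in the construction of `χ` and in the lower semicontinuity of the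
distance at singular points (`eventually_le_truncDist`); both rest on the comparison of the lifted
metric with the euclidean metric of the conic coordinates (`ConicChart.exists_lift_bounds`).
-/

/-! ### Laplace transforms -/

theorem integrableOn_exp_neg_mul_smul {F : ℝ → ℂ} (hF : ContinuousOn F (Ici 0)) {C : ℝ}
    (hC : ∀ t, 0 ≤ t → ‖F t‖ ≤ C * Real.exp (t / 2)) {l : ℝ} (hl : 1 ≤ l) :
    IntegrableOn (fun t => Real.exp (-l * t) • F t) (Ioi 0) := by
  have h1 : IntegrableOn (fun t : ℝ => C * Real.exp ((-1 / 2) * t)) (Ioi 0) :=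
    (integrableOn_exp_mul_Ioi (by norm_num) 0).const_mul C
  refine Integrable.mono' h1 ?_ ?_
  · refine ContinuousOn.aestronglyMeasurable ?_ measurableSet_Ioi
    exact ContinuousOn.smul (f := fun t : ℝ => Real.exp (-l * t)) (by fun_prop)
      (hF.mono Ioi_subset_Ici_self)
  · refine (ae_restrict_iff' measurableSet_Ioi).2 (Eventually.of_forall fun t ht => ?_)
    have ht : 0 < t := ht
    rw [norm_smul, Real.norm_eq_abs, Real.abs_exp]
    have h2 := hC t ht.le
    have hC0 : 0 ≤ C := by
      have := hC 0 le_rfl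
      simp at this
      exact (norm_nonneg _).trans this
    calc Real.exp (-l * t) * ‖F t‖ ≤ Real.exp (-1 * t) * (C * Real.exp (t / 2)) := by
          gcongr
      _ = C * Real.exp ((-1 / 2) * t) := by
          rw [mul_left_comm, ← Real.exp_add]; ring_nf

theorem hasSum_one_sub_exp_neg (x : ℝ) :
    HasSum (fun k : ℕ => (-1) ^ k * x ^ (k + 1) / (k + 1).factorial) (1 - Real.exp (-x)) := by
  have h := (hasSum_nat_add_iff' (f := fun k : ℕ => (-x) ^ k / k.factorial) 1).2
    (by simpa [Real.exp_eq_exp_ℝ] using NormedSpace.expSeries_div_hasSum_exp (-x))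
  simp only [Finset.range_one, Finset.sum_singleton, pow_zero, Nat.factorial_zero, Nat.cast_one,
    div_one] at h
  have e : (fun k : ℕ => (-1) ^ k * x ^ (k + 1) / (k + 1).factorial) =
      fun k : ℕ => -((-x) ^ (k + 1) / (k + 1).factorial) := by
    ext k; rw [neg_pow]; ring
  rw [e, show 1 - Real.exp (-x) = -(NormedSpace.exp (-x) - 1) by rw [Real.exp_eq_exp_ℝ]; ring]
  exact h.neg

/-- A function whose Laplace transform is `O(e^{-λ r})` along the integers `λ → ∞` has vanishing
integral over `[0, a]` for `a < r`: the kernels `1 - exp (-e^{m (a - t)})` converge to the indicator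
function of `t < a`, and expand into exponentials `e^{(k + 1) m (a - t)}`. -/
theorem setIntegral_eq_zero_of_laplace_le {F : ℝ → ℂ} (hF : ContinuousOn F (Ici 0))
    {C C' r a : ℝ} (hC : ∀ t, 0 ≤ t → ‖F t‖ ≤ C * Real.exp (t / 2))
    (hL : ∀ l : ℝ, 1 < l → ‖∫ t in Ioi 0, Real.exp (-l * t) • F t‖ ≤ C' * Real.exp (-l * r))
    (har : a < r) : ∫ t in Ioc 0 a, F t = 0 := by
  have hC0 : 0 ≤ C := by
    have := hC 0 le_rfl
    simp only [zero_div, Real.exp_zero, mul_one] at this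
    exact (norm_nonneg _).trans this
  -- smooth approximations of the indicator function of `t < a`
  set K : ℕ → ℝ → ℝ := fun m t => 1 - Real.exp (-Real.exp (m * (a - t))) with hK
  have hKint : ∀ m : ℕ, 2 ≤ m → ‖∫ t in Ioi 0, K m t • F t‖ ≤
      C' * (Real.exp (Real.exp (-(m * (r - a)))) - 1) := by
    intro m hm
    have hm' : (2 : ℝ) ≤ m := by exact_mod_cast hm
    -- the terms of the expansion of `K m t • F t` into exponentials
    set G : ℕ → ℝ → ℂ := fun k t =>
      ((-1) ^ k * Real.exp ((k + 1) * (m * a)) / (k + 1).factorial : ℝ) •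
        (Real.exp (-((k + 1) * m) * t) • F t) with hG
    have hkm : ∀ k : ℕ, 1 < ((k : ℝ) + 1) * m := fun k => by
      have : (0 : ℝ) ≤ k := Nat.cast_nonneg k
      nlinarith
    have hGsum : ∀ t, HasSum (fun k => G k t) (K m t • F t) := fun t => by
      have h := (hasSum_one_sub_exp_neg (Real.exp (m * (a - t)))).smul_const (F t)
      refine (?_ : (fun k => G k t) = _) ▸ h
      ext1 k
      simp only [hG, smul_smul]
      congr 1
      rw [← Real.exp_nat_mul]
      push_cast
      rw [div_mul_eq_mul_div, mul_assoc, ← Real.exp_add]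
      ring_nf
    have hGint : ∀ k, Integrable (G k) (volume.restrict (Ioi 0)) := fun k =>
      (integrableOn_exp_neg_mul_smul hF hC (hkm k).le).smul
        ((-1) ^ k * Real.exp ((k + 1) * (m * a)) / (k + 1).factorial : ℝ)
    set D := ∫ t in Ioi (0 : ℝ), ‖Real.exp (-1 * t) • F t‖ with hD
    have hGn : ∀ k, ∫ t in Ioi 0, ‖G k t‖ ≤
        D * (Real.exp (m * a) ^ (k + 1) / (k + 1).factorial) := by
      intro k
      simp only [hG]
      simp_rw [norm_smul _ (Real.exp _ • F _)]
      rw [integral_const_mul]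
      have e1 : ‖((-1) ^ k * Real.exp ((k + 1) * (m * a)) / (k + 1).factorial : ℝ)‖ =
          Real.exp (m * a) ^ (k + 1) / (k + 1).factorial := by
        rw [norm_div, norm_mul, norm_pow, norm_neg, norm_one, one_pow, one_mul, Real.norm_eq_abs,
          Real.abs_exp, ← Real.exp_nat_mul]
        simp
      rw [e1, mul_comm]
      refine mul_le_mul_of_nonneg_right ?_ (by positivity)
      refine setIntegral_mono_on (integrableOn_exp_neg_mul_smul hF hC (hkm k).le).norm
        (integrableOn_exp_neg_mul_smul hF hC le_rfl).norm measurableSet_Ioi fun t ht => ?_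
      rw [norm_smul, norm_smul, Real.norm_eq_abs, Real.norm_eq_abs, Real.abs_exp, Real.abs_exp]
      have ht : 0 < t := ht
      gcongr
      exact (hkm k).le
    have hS : Summable fun k : ℕ => Real.exp (m * a) ^ (k + 1) / ((k + 1).factorial : ℝ) :=
      (summable_nat_add_iff 1).2 (Real.summable_pow_div_factorial _)
    have hsum := hasSum_integral_of_summable_integral_norm hGint
      (Summable.of_nonneg_of_le (fun k => by positivity) hGn (hS.mul_left D))
    simp_rw [fun t => (hGsum t).tsum_eq] at hsum
    have hS2 : HasSum (fun k : ℕ => C' * (Real.exp (-(m * (r - a))) ^ (k + 1) / (k + 1).factorial))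
        (C' * (Real.exp (Real.exp (-(m * (r - a)))) - 1)) := by
      refine HasSum.mul_left _ ?_
      have h := (hasSum_one_sub_exp_neg (-Real.exp (-(m * (r - a))))).neg
      rw [neg_neg] at h
      rw [neg_sub] at h
      refine (?_ : (fun k : ℕ => Real.exp (-(m * (r - a))) ^ (k + 1) / ((k + 1).factorial : ℝ)) = _)
        ▸ h
      ext1 k
      have h1 : ((-1 : ℝ) ^ k) * (-1) ^ k = 1 := by rw [← mul_pow]; simp
      rw [neg_pow (Real.exp _) (k + 1), pow_succ (-1 : ℝ)]
      linear_combination (-(Real.exp (-(m * (r - a))) ^ (k + 1) / (k + 1).factorial)) * h1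
    rw [← hsum.tsum_eq]
    refine tsum_of_norm_bounded hS2 fun k => ?_
    simp only [hG]
    rw [integral_smul, norm_smul]
    have e1 : ‖((-1) ^ k * Real.exp ((k + 1) * (m * a)) / (k + 1).factorial : ℝ)‖ =
          Real.exp ((k + 1) * (m * a)) / (k + 1).factorial := by
        rw [norm_div, norm_mul, norm_pow, norm_neg, norm_one, one_pow, one_mul, Real.norm_eq_abs,
          Real.abs_exp]
        simp
    rw [e1]
    calc _ ≤ Real.exp ((k + 1) * (m * a)) / (k + 1).factorial *
          (C' * Real.exp (-((k + 1) * m) * r)) := by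
          gcongr
          exact hL _ (hkm k)
      _ = _ := by
        rw [← Real.exp_nat_mul, div_mul_eq_mul_div, mul_left_comm, ← Real.exp_add, mul_div_assoc]
        push_cast
        ring_nf
  have hlim0 : Tendsto (fun m : ℕ => C' * (Real.exp (Real.exp (-(m * (r - a)))) - 1)) atTop
      (𝓝 0) := by
    have h1 : Tendsto (fun m : ℕ => -((m : ℝ) * (r - a))) atTop atBot :=
      tendsto_neg_atTop_atBot.comp
        (tendsto_natCast_atTop_atTop.atTop_mul_const (sub_pos.2 har))
    have h2 := (Real.continuous_exp.tendsto 0).comp (Real.tendsto_exp_atBot.comp h1)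
    have h3 := (h2.sub_const 1).const_mul C'
    simpa using h3
  have hlimK : Tendsto (fun m : ℕ => ∫ t in Ioi 0, K m t • F t) atTop (𝓝 0) := by
    refine squeeze_zero_norm' ?_ hlim0
    filter_upwards [eventually_ge_atTop 2] with m hm using hKint m hm
  -- the kernels are dominated by `e^{a - t}`, which beats the growth of `F`
  have hlim : Tendsto (fun m : ℕ => ∫ t in Ioi 0, K m t • F t) atTop
      (𝓝 (∫ t in Ioi 0, (Iic a).indicator F t)) := by
    refine tendsto_integral_filter_of_dominated_convergence
      (fun t => (C * Real.exp a) * Real.exp ((-1 / 2) * t)) ?_ ?_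
      ((integrableOn_exp_mul_Ioi (by norm_num) 0).const_mul _) ?_
    · refine Eventually.of_forall fun m => ContinuousOn.aestronglyMeasurable ?_ measurableSet_Ioi
      exact ContinuousOn.smul (f := K m) (by fun_prop) (hF.mono Ioi_subset_Ici_self)
    · filter_upwards [eventually_ge_atTop 1] with m hm
      have hm' : (1 : ℝ) ≤ m := by exact_mod_cast hm
      refine (ae_restrict_iff' measurableSet_Ioi).2 (Eventually.of_forall fun t ht => ?_)
      have ht : 0 < t := ht
      rw [norm_smul, Real.norm_eq_abs]
      have k0 : 0 ≤ K m t := by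
        simp only [hK, sub_nonneg, Real.exp_le_one_iff, neg_nonpos]
        positivity
      have k1 : K m t ≤ Real.exp (a - t) := by
        rcases le_total t a with h | h
        · have : K m t ≤ 1 := by simp only [hK]; linarith [Real.exp_pos (-Real.exp (m * (a - t)))]
          exact this.trans (Real.one_le_exp (by linarith))
        · have h1 := Real.add_one_le_exp (-Real.exp (m * (a - t)))
          have h2 : K m t ≤ Real.exp (m * (a - t)) := by simp only [hK]; linarith
          refine h2.trans (Real.exp_le_exp.2 ?_)
          nlinarith
      rw [abs_of_nonneg k0]
      calc K m t * ‖F t‖ ≤ Real.exp (a - t) * (C * Real.exp (t / 2)) :=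
            mul_le_mul k1 (hC t ht.le) (norm_nonneg _) (Real.exp_pos _).le
        _ = _ := by
          rw [mul_left_comm, ← Real.exp_add, mul_assoc, ← Real.exp_add]; ring_nf
    · have hne : ∀ᵐ t : ℝ ∂volume.restrict (Ioi 0), t ≠ a :=
        ae_restrict_of_ae (compl_mem_ae_iff.2 (measure_singleton a))
      filter_upwards [hne] with t ht
      have key : Tendsto (fun m => K m t) atTop (𝓝 ((Iic a).indicator 1 t)) := by
        rcases lt_or_gt_of_ne ht with h | h
        · rw [indicator_of_mem (show t ∈ Iic a from h.le), Pi.one_apply]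
          have h1 : Tendsto (fun m : ℕ => (m : ℝ) * (a - t)) atTop atTop :=
            tendsto_natCast_atTop_atTop.atTop_mul_const (sub_pos.2 h)
          have h2 := (Real.tendsto_exp_neg_atTop_nhds_zero.comp
            (Real.tendsto_exp_atTop.comp h1)).const_sub 1
          simpa [hK, Function.comp_def] using h2
        · rw [indicator_of_notMem (show t ∉ Iic a from not_le.2 h)]
          have h1 : Tendsto (fun m : ℕ => (m : ℝ) * (a - t)) atTop atBot :=
            tendsto_natCast_atTop_atTop.atTop_mul_const_of_neg (sub_neg.2 h)
          have h2 := ((Real.continuous_exp.tendsto _).comp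
            (Real.tendsto_exp_atBot.comp h1).neg).const_sub 1
          simpa [hK, Function.comp_def] using h2
      convert key.smul_const (F t) using 2
      by_cases h : t ∈ Iic a <;> simp [h]
  have h := tendsto_nhds_unique hlim hlimK
  rw [setIntegral_indicator measurableSet_Iic] at h
  rwa [Ioi_inter_Iic] at h

/-- Mikusiński's uniqueness theorem: a continuous function on `[0, ∞)` whose Laplace transform is
`O(e^{-λ r})` as `λ → ∞` vanishes on `(0, r)`. -/
theorem eq_zero_of_laplace_le {F : ℝ → ℂ} (hF : ContinuousOn F (Ici 0)) {C C' r t : ℝ}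
    (hC : ∀ t, 0 ≤ t → ‖F t‖ ≤ C * Real.exp (t / 2))
    (hL : ∀ l : ℝ, 1 < l → ‖∫ t in Ioi 0, Real.exp (-l * t) • F t‖ ≤ C' * Real.exp (-l * r))
    (ht : 0 < t) (htr : t < r) : F t = 0 := by
  -- a continuous extension to the line, whose primitive is constant on `(0, r)`
  set F' : ℝ → ℂ := fun s => F (max 0 s) with hF'
  have hc : Continuous F' := hF.comp_continuous (by fun_prop) fun s => mem_Ici.2 (le_max_left _ _)
  have h1 : HasDerivAt (fun a => ∫ s in (0 : ℝ)..a, F' s) (F' t) t :=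
    intervalIntegral.integral_hasDerivAt_right (hc.intervalIntegrable _ _)
      hc.stronglyMeasurable.stronglyMeasurableAtFilter hc.continuousAt
  have h2 : (fun a => ∫ s in (0 : ℝ)..a, F' s) =ᶠ[𝓝 t] fun _ => 0 := by
    filter_upwards [Ioo_mem_nhds ht htr] with a ha
    rw [intervalIntegral.integral_of_le ha.1.le,
      ← setIntegral_eq_zero_of_laplace_le hF hC hL ha.2]
    refine setIntegral_congr_fun measurableSet_Ioc fun s hs => ?_
    simp only [hF', max_eq_right hs.1.le]
  have h3 := h1.unique ((hasDerivAt_const t (0 : ℂ)).congr_of_eventuallyEq h2)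
  simpa [hF', max_eq_right ht.le] using h3

/-! ### Families of functions of an operator -/

/-- A family `q_t(√A)`, `t ∈ ℝ`, of functions of an operator `A ≥ 0`, of at most linear growth in
`t` and with Laplace transform `m(λ) (λ² + A)⁻¹`; the value of `q` at `(t, w)` is `q_t(w)`. -/
structure IsWaveSymbol (q : ℝ → ℝ → ℝ) (m : ℝ → ℝ) : Prop where
  continuous : Continuous (Function.uncurry q)
  abs_le : ∀ t w, |q t w| ≤ 1 + |t|
  laplace : ∀ l > 1, ∀ w, 0 ≤ w →
    ∫ t in Ioi (0 : ℝ), Real.exp (-l * t) * q t w = m l / (l ^ 2 + w ^ 2)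

section Laplace

theorem integral_exp_neg_mul_complex {l : ℝ} (hl : 0 < l) (w : ℝ) :
    IntegrableOn (fun t : ℝ => Complex.exp ((-l + w * Complex.I) * t)) (Ioi 0) ∧
    ∫ t in Ioi (0 : ℝ), Complex.exp ((-l + w * Complex.I) * t) =
      (l + w * Complex.I) / (l ^ 2 + w ^ 2) := by
  have hre : (-l + w * Complex.I : ℂ).re < 0 := by simpa using hl
  refine ⟨integrableOn_exp_mul_complex_Ioi hre 0, ?_⟩
  have h := integral_exp_mul_complex_Ioi hre 0
  rw [h]
  have h1 : (-l + w * Complex.I : ℂ) ≠ 0 := fun h0 => by simp [h0] at hre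
  have h2 : ((l : ℂ) ^ 2 + w ^ 2) ≠ 0 := by
    have : (0 : ℝ) < l ^ 2 + w ^ 2 := by positivity
    exact_mod_cast this.ne'
  simp only [Complex.ofReal_zero, mul_zero, Complex.exp_zero]
  rw [div_eq_div_iff h1 h2]
  linear_combination -(w : ℂ) ^ 2 * Complex.I_sq

theorem exp_neg_mul_complex_re (l w t : ℝ) :
    (Complex.exp ((-l + w * Complex.I) * t)).re = Real.exp (-l * t) * Real.cos (w * t) := by
  rw [Complex.exp_re]; simp

theorem exp_neg_mul_complex_im (l w t : ℝ) :
    (Complex.exp ((-l + w * Complex.I) * t)).im = Real.exp (-l * t) * Real.sin (w * t) := by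
  rw [Complex.exp_im]; simp

theorem isWaveSymbol_cos : IsWaveSymbol (fun t w => Real.cos (t * w)) (fun l => l) where
  continuous := by fun_prop
  abs_le t w := (Real.abs_cos_le_one _).trans (by linarith [abs_nonneg t])
  laplace l hl w _ := by
    obtain ⟨h1, h2⟩ := integral_exp_neg_mul_complex (by linarith : 0 < l) w
    have h3 := integral_re h1
    rw [h2] at h3
    simp only [RCLike.re_to_complex, exp_neg_mul_complex_re] at h3
    simp_rw [mul_comm _ w]
    rw [h3]
    have : ((l : ℂ) + w * Complex.I) / (l ^ 2 + w ^ 2) =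
      ((l / (l ^ 2 + w ^ 2) : ℝ) : ℂ) + ((w / (l ^ 2 + w ^ 2) : ℝ) : ℂ) * Complex.I := by
      push_cast; ring
    rw [this]
    simp only [Complex.add_re, Complex.ofReal_im, Complex.mul_re, Complex.ofReal_re, Complex.I_im,
      Complex.I_re]
    ring

/-- The family `sin(t √A) / √A`, written with `sinc` so that it is continuous at `w = 0`. -/
theorem isWaveSymbol_sinc : IsWaveSymbol (fun t w => t * Real.sinc (t * w)) (fun _ => 1) where
  continuous := by
    have := Real.continuous_sinc
    fun_prop
  abs_le t w := by
    rw [abs_mul]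
    nlinarith [Real.abs_sinc_le_one (t * w), abs_nonneg t]
  laplace l hl w hw := by
    have hl0 : 0 < l := by linarith
    rcases hw.eq_or_lt with rfl | hw
    · have h := Real.integral_rpow_mul_exp_neg_mul_Ioi (a := 2) (r := l) (by norm_num) hl0
      simp only [mul_zero, Real.sinc_zero, mul_one, ne_eq, OfNat.ofNat_ne_zero, not_false_eq_true,
        zero_pow, add_zero]
      norm_num at h
      simp only [neg_mul]
      simp_rw [mul_comm (Real.exp _)]
      rw [h, one_div]
    · obtain ⟨h1, h2⟩ := integral_exp_neg_mul_complex hl0 w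
      have h3 := integral_im h1
      rw [h2] at h3
      simp only [RCLike.im_to_complex, exp_neg_mul_complex_im] at h3
      have e : ∀ t ∈ Ioi (0 : ℝ), Real.exp (-l * t) * (t * Real.sinc (t * w)) =
          w⁻¹ * (Real.exp (-l * t) * Real.sin (w * t)) := fun t ht => by
        have ht : 0 < t := ht
        rw [Real.sinc_of_ne_zero (by positivity), mul_comm w t]
        field_simp
      rw [setIntegral_congr_fun measurableSet_Ioi e, integral_const_mul, h3]
      have : ((l : ℂ) + w * Complex.I) / (l ^ 2 + w ^ 2) =
        ((l / (l ^ 2 + w ^ 2) : ℝ) : ℂ) + ((w / (l ^ 2 + w ^ 2) : ℝ) : ℂ) * Complex.I := by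
        push_cast; ring
      rw [this]
      simp only [Complex.add_im, Complex.ofReal_im, Complex.mul_im, Complex.ofReal_re, Complex.I_im,
        Complex.I_re]
      field_simp
      ring

end Laplace

/-- The symbol of `q_t(√A) (A + 1)⁻¹` as a function of `s = (A + 1)⁻¹`. With the convention
`0⁻¹ = 0` it vanishes at `s = 0`, where it is continuous by the factor `s`. -/
noncomputable def resolventSymbol (q : ℝ → ℝ → ℝ) (t s : ℝ) : ℝ := q t (√(s⁻¹ - 1)) * s

section Symbol

variable {q : ℝ → ℝ → ℝ} {m : ℝ → ℝ}

theorem abs_resolventSymbol_le (hq : IsWaveSymbol q m) (t : ℝ) {s : ℝ} (hs : 0 ≤ s) :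
    |resolventSymbol q t s| ≤ (1 + |t|) * s := by
  rw [resolventSymbol, abs_mul, abs_of_nonneg hs]
  exact mul_le_mul_of_nonneg_right (hq.abs_le _ _) hs

theorem continuousOn_resolventSymbol (hq : IsWaveSymbol q m) :
    ContinuousOn (Function.uncurry (resolventSymbol q)) (univ ×ˢ Icc 0 1) := by
  rintro ⟨t, s⟩ ⟨-, hs⟩
  rcases hs.1.eq_or_lt with rfl | h0
  · have h0 : Function.uncurry (resolventSymbol q) (t, 0) = 0 := by simp [resolventSymbol]
    rw [ContinuousWithinAt, h0]
    have hlim : Tendsto (fun p : ℝ × ℝ => (1 + |p.1|) * p.2) (𝓝[univ ×ˢ Icc 0 1] (t, 0)) (𝓝 0) := by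
      have : ContinuousAt (fun p : ℝ × ℝ => (1 + |p.1|) * p.2) (t, 0) := by fun_prop
      simpa [ContinuousAt] using this.tendsto.mono_left (nhdsWithin_le_nhds (s := univ ×ˢ Icc 0 1))
    refine squeeze_zero_norm' ?_ hlim
    filter_upwards [self_mem_nhdsWithin] with p hp
    exact abs_resolventSymbol_le hq p.1 hp.2.1
  · refine ContinuousAt.continuousWithinAt ?_
    have h1 : ContinuousAt (fun p : ℝ × ℝ => (p.1, √(p.2⁻¹ - 1))) (t, s) := by
      refine continuousAt_fst.prodMk (Real.continuous_sqrt.continuousAt.comp ?_)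
      exact (continuousAt_snd.inv₀ h0.ne').sub continuousAt_const
    exact (ContinuousAt.comp (x := ((t, s) : ℝ × ℝ)) (g := Function.uncurry q)
      hq.continuous.continuousAt h1).mul continuousAt_snd

theorem continuousOn_resolventSymbol_right (hq : IsWaveSymbol q m) (t : ℝ) :
    ContinuousOn (resolventSymbol q t) (Icc 0 1) :=
  (continuousOn_resolventSymbol hq).comp (f := fun s => (t, s)) (by fun_prop)
    fun s hs => ⟨mem_univ _, hs⟩

/-- The Laplace transform in `t` of the symbol of `q_t(√A) (A + 1)⁻¹`: the quotient
`s / (1 + (λ² - 1) s)` is the symbol of `(A + λ²)⁻¹`. -/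
theorem laplace_resolventSymbol (hq : IsWaveSymbol q m) {l : ℝ} (hl : 1 < l) {s : ℝ}
    (hs : s ∈ Icc (0 : ℝ) 1) :
    ∫ t in Ioi (0 : ℝ), Real.exp (-l * t) * resolventSymbol q t s =
      m l * (s / (1 + (l ^ 2 - 1) * s) * s) := by
  simp only [resolventSymbol, ← mul_assoc]
  rw [integral_mul_const, hq.laplace l hl _ (Real.sqrt_nonneg _)]
  rcases hs.1.eq_or_lt with rfl | h0
  · simp
  · have h1 : 0 ≤ s⁻¹ - 1 := sub_nonneg.2 ((one_le_inv₀ h0).2 hs.2)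
    rw [Real.sq_sqrt h1]
    have h2 : l ^ 2 + (s⁻¹ - 1) ≠ 0 := by positivity
    have h3 : (0 : ℝ) < l ^ 2 - 1 := by nlinarith
    have h4 : 1 + (l ^ 2 - 1) * s ≠ 0 := by positivity
    have h5 : l ^ 2 + (s⁻¹ - 1) = (1 + (l ^ 2 - 1) * s) / s := by field_simp; ring
    rw [h5]
    field_simp

end Symbol

section Operator

variable {H : Type*} [NormedAddCommGroup H] [InnerProductSpace ℂ H] [CompleteSpace H]

/-- The inequality `‖R x‖² ≤ ⟨R x, x⟩` says that `R² ≤ R`. -/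
theorem spectrum_subset_Icc_of_inner {R : H →L[ℂ] H} (hR : IsSelfAdjoint R)
    (hpos : ∀ x, ‖R x‖ ^ 2 ≤ (inner ℂ (R x) x).re) : spectrum ℝ R ⊆ Icc 0 1 := by
  have h0 : 0 ≤ R := by
    rw [ContinuousLinearMap.nonneg_iff_isPositive]
    refine ⟨hR.isSymmetric, fun x => ?_⟩
    exact (sq_nonneg _).trans (hpos x)
  have h1 : ‖R‖ ≤ 1 := by
    refine R.opNorm_le_bound zero_le_one fun x => ?_
    have h2 := hpos x
    have h3 : (inner ℂ (R x) x).re ≤ ‖R x‖ * ‖x‖ :=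
      (Complex.re_le_norm _).trans (norm_inner_le_norm _ _)
    rcases (norm_nonneg (R x)).eq_or_lt with h | h
    · rw [← h]; positivity
    · rw [one_mul]
      nlinarith
  intro s hs
  refine ⟨spectrum_nonneg_of_nonneg h0 hs, ?_⟩
  have h2 := spectrum.norm_le_norm_mul_of_mem hs
  have h4 : ‖(1 : H →L[ℂ] H)‖ ≤ 1 := ContinuousLinearMap.norm_id_le
  calc s ≤ ‖s‖ := le_abs_self _
    _ ≤ ‖R‖ * ‖(1 : H →L[ℂ] H)‖ := h2
    _ ≤ 1 * 1 := by gcongr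
    _ = 1 := one_mul 1

/-- If `B R = φ(R)` with `|φ(s)| ≤ c s`, then `‖B x‖ ≤ c ‖x‖`: on the dense range of `R` this is the
inequality `φ(R)² ≤ c² R²`. -/
theorem norm_apply_le_of_comp_eq_cfc {R B : H →L[ℂ] H} (hR : IsSelfAdjoint R) (hd : DenseRange R)
    {φ : ℝ → ℝ} {c : ℝ} (hc : 0 ≤ c) (hφ : ContinuousOn φ (spectrum ℝ R))
    (hle : ∀ s ∈ spectrum ℝ R, |φ s| ≤ c * s) (hB : B ∘L R = cfc φ R) (x : H) :
    ‖B x‖ ≤ c * ‖x‖ := by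
  refine hd.induction_on (p := fun x => ‖B x‖ ≤ c * ‖x‖) x
    (isClosed_le (by fun_prop) (by fun_prop)) fun g => ?_
  have e1 : B (R g) = cfc φ R g := by rw [← hB]; rfl
  rw [e1]
  have hsa : IsSelfAdjoint (cfc φ R) := cfc_predicate φ R
  have key : ∀ T : H →L[ℂ] H, IsSelfAdjoint T → ‖T g‖ ^ 2 = (inner ℂ ((T * T) g) g).re := by
    intro T hT
    rw [mul_apply_eq_comp, ← ContinuousLinearMap.adjoint_inner_right,
      ContinuousLinearMap.isSelfAdjoint_iff'.1 hT, ← inner_self_eq_norm_sq (𝕜 := ℂ)]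
    rfl
  have h1 : cfc φ R * cfc φ R ≤ (c ^ 2 : ℝ) • (R * R) := by
    rw [← cfc_mul φ φ R]
    have e2 : (c ^ 2 : ℝ) • (R * R) = cfc (fun s : ℝ => c ^ 2 * (s * s)) R := by
      rw [cfc_const_mul (c ^ 2) (fun s : ℝ => s * s) R, cfc_mul (fun s : ℝ => s) (fun s => s) R,
        cfc_id' ℝ R]
    rw [e2]
    refine cfc_mono fun s hs => ?_
    have := hle s hs
    calc φ s * φ s = |φ s| ^ 2 := by rw [sq_abs, sq]
      _ ≤ (c * s) ^ 2 := by gcongr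
      _ = _ := by ring
  have h2 : ‖cfc φ R g‖ ^ 2 ≤ (c * ‖R g‖) ^ 2 := by
    rw [key _ hsa, mul_pow, key _ hR]
    have h3 := (ContinuousLinearMap.le_def _ _).1 h1
    have h4 := h3.re_inner_nonneg_left g
    simp only [sub_apply, inner_sub_left, map_sub, sub_nonneg] at h4
    refine h4.trans (le_of_eq ?_)
    rw [smul_apply, ← Complex.coe_smul, inner_smul_left, Complex.conj_ofReal]
    exact Complex.re_ofReal_mul _ _
  exact (sq_le_sq₀ (norm_nonneg _) (by positivity)).1 h2

variable {q : ℝ → ℝ → ℝ} {m : ℝ → ℝ} {R : H →L[ℂ] H} {B : ℝ → H →L[ℂ] H}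

theorem norm_waveFamily_le (hq : IsWaveSymbol q m) (hR : IsSelfAdjoint R) (hd : DenseRange R)
    (hs : spectrum ℝ R ⊆ Icc 0 1) (hB : ∀ t, 0 ≤ t → B t ∘L R = cfc (resolventSymbol q t) R) {t : ℝ}
    (ht : 0 ≤ t) (x : H) : ‖B t x‖ ≤ (1 + |t|) * ‖x‖ :=
  norm_apply_le_of_comp_eq_cfc hR hd (by positivity)
    ((continuousOn_resolventSymbol_right hq t).mono hs)
    (fun s h => abs_resolventSymbol_le hq t (hs h).1) (hB t ht) x

/-- Norm continuity in `t` of `q_t(√A) (A + 1)⁻¹`: the symbols converge uniformly on the compact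
spectrum of `R = (A + 1)⁻¹`. -/
theorem continuous_cfc_resolventSymbol (hq : IsWaveSymbol q m)
    (hs : spectrum ℝ R ⊆ Icc 0 1) : Continuous fun t => cfc (resolventSymbol q t) R := by
  refine continuous_iff_continuousAt.2 fun t => ?_
  have hK : IsCompact (spectrum ℝ R) := isCompact_Icc.of_isClosed_subset (spectrum.isClosed R) hs
  have hc : ContinuousOn (Function.uncurry (resolventSymbol q)) (univ ×ˢ spectrum ℝ R) :=
    (continuousOn_resolventSymbol hq).mono (prod_mono_right hs)
  refine continuousAt_cfc_fun ?_ (Eventually.of_forall fun x =>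
    (continuousOn_resolventSymbol_right hq x).mono hs)
  intro u hu
  obtain ⟨v, hv, hvu⟩ := hK.mem_uniformity_of_prod hc (mem_univ t) (symm_le_uniformity hu)
  rw [nhdsWithin_univ] at hv
  filter_upwards [hv] with p hp s h using hvu p hp s h

/-- Strong continuity of `q_t(√A)`: it is plain on the dense range of `R`, and the operators are
bounded locally uniformly in `t`. -/
theorem continuousOn_waveFamily (hq : IsWaveSymbol q m) (hR : IsSelfAdjoint R) (hd : DenseRange R)
    (hs : spectrum ℝ R ⊆ Icc 0 1) (hB : ∀ t, 0 ≤ t → B t ∘L R = cfc (resolventSymbol q t) R)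
    (x : H) : ContinuousOn (fun t => B t x) (Ici 0) := by
  obtain ⟨y, hy, hyx⟩ := mem_closure_iff_seq_limit.1 (hd x)
  choose z hz using hy
  have hF : ∀ n, ContinuousOn (fun t => B t (y n)) (Ici 0) := fun n => by
    have h := ((ContinuousLinearMap.apply ℂ H (z n)).continuous.comp
      (continuous_cfc_resolventSymbol hq hs)).continuousOn (s := Ici 0)
    refine h.congr fun t ht => ?_
    simp only [Function.comp_apply, ContinuousLinearMap.apply_apply, ← hB t ht, ← hz]
    rfl
  refine TendstoLocallyUniformlyOn.continuousOn (F := fun n t => B t (y n)) (p := atTop) ?_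
    (Eventually.of_forall hF).frequently
  refine Metric.tendstoLocallyUniformlyOn_iff.2 fun ε hε t ht => ?_
  refine ⟨Ici 0 ∩ Iio (t + 1), inter_mem self_mem_nhdsWithin
    (mem_nhdsWithin_of_mem_nhds (Iio_mem_nhds (by linarith))), ?_⟩
  have ht : 0 ≤ t := ht
  filter_upwards [Metric.tendsto_nhds.1 hyx (ε / (2 + t)) (by positivity)] with n hn s hs
  rw [dist_eq_norm, ← map_sub]
  have hs0 : 0 ≤ s := hs.1
  have hs1 : s < t + 1 := hs.2
  rw [dist_comm, dist_eq_norm, lt_div_iff₀ (by positivity)] at hn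
  calc ‖B s (x - y n)‖ ≤ (1 + |s|) * ‖x - y n‖ := norm_waveFamily_le hq hR hd ‹_› hB hs0 _
    _ ≤ (2 + t) * ‖x - y n‖ := by
      rw [abs_of_nonneg hs0]; exact mul_le_mul_of_nonneg_right (by linarith) (norm_nonneg _)
    _ < ε := by linarith

theorem one_add_le_exp_half {t : ℝ} (ht : 0 ≤ t) : 1 + |t| ≤ 2 * Real.exp (t / 2) := by
  rw [abs_of_nonneg ht]
  linarith [Real.add_one_le_exp (t / 2)]

/-- The Laplace transform of `q_t(√A)` is `m(λ) (A + λ²)⁻¹`. -/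
theorem laplace_waveFamily (hq : IsWaveSymbol q m) (hR : IsSelfAdjoint R) (hd : DenseRange R)
    (hs : spectrum ℝ R ⊆ Icc 0 1) (hB : ∀ t, 0 ≤ t → B t ∘L R = cfc (resolventSymbol q t) R)
    (h x : H) {l : ℝ} (hl : 1 < l) :
    ∫ t in Ioi (0 : ℝ), Real.exp (-l * t) • inner ℂ h (B t x) =
      m l * inner ℂ h (cfc (fun s : ℝ => s / (1 + (l ^ 2 - 1) * s)) R x) := by
  have hcont : ∀ x, ContinuousOn (fun t => inner ℂ h (B t x)) (Ici 0) := fun x =>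
    ContinuousOn.inner (𝕜 := ℂ) continuousOn_const (continuousOn_waveFamily hq hR hd hs hB x)
  have hbd : ∀ x t, 0 ≤ t → ‖inner ℂ h (B t x)‖ ≤ (‖h‖ * (2 * ‖x‖)) * Real.exp (t / 2) := by
    intro x t ht
    calc _ ≤ ‖h‖ * ‖B t x‖ := norm_inner_le_norm _ _
      _ ≤ ‖h‖ * ((2 * Real.exp (t / 2)) * ‖x‖) := by
        gcongr
        exact (norm_waveFamily_le hq hR hd hs hB ht x).trans
          (by gcongr; exact one_add_le_exp_half ht)
      _ = _ := by ring
  -- both sides depend continuously on `x`; for `x = R g` the integral is one of functions of `R`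
  refine hd.induction_on (p := fun x => ∫ t in Ioi (0 : ℝ), Real.exp (-l * t) • inner ℂ h (B t x) =
      m l * inner ℂ h (cfc (fun s : ℝ => s / (1 + (l ^ 2 - 1) * s)) R x)) x
    (isClosed_eq ?_ (by fun_prop)) fun g => ?_
  · refine continuous_iff_continuousAt.2 fun x₀ => ?_
    refine continuousAt_of_dominated
      (bound := fun t => (‖h‖ * (2 * (‖x₀‖ + 1))) * Real.exp ((-1 / 2) * t)) ?_ ?_
      ((integrableOn_exp_mul_Ioi (by norm_num) 0).const_mul _) ?_
    · exact Eventually.of_forall fun x =>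
        (integrableOn_exp_neg_mul_smul (hcont x) (hbd x) hl.le).aestronglyMeasurable
    · have : ∀ᶠ x in 𝓝 x₀, ‖x‖ < ‖x₀‖ + 1 :=
        continuous_norm.continuousAt.eventually_lt continuousAt_const (by linarith)
      filter_upwards [this] with x hx
      refine (ae_restrict_iff' measurableSet_Ioi).2 (Eventually.of_forall fun t ht => ?_)
      have ht : 0 < t := ht
      rw [norm_smul, Real.norm_eq_abs, Real.abs_exp]
      calc _ ≤ Real.exp (-1 * t) * ((‖h‖ * (2 * (‖x₀‖ + 1))) * Real.exp (t / 2)) := by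
            gcongr
            exact (hbd x t ht.le).trans (by gcongr)
        _ = _ := by rw [mul_left_comm, ← Real.exp_add]; ring_nf
    · exact Eventually.of_forall fun t => by fun_prop
  · have e1 : ∀ t ∈ Ioi (0 : ℝ), Real.exp (-l * t) • inner ℂ h (B t (R g)) =
        inner ℂ h (cfc (fun s => Real.exp (-l * t) * resolventSymbol q t s) R g) := by
      intro t ht
      have hc := (continuousOn_resolventSymbol_right hq t).mono hs
      rw [cfc_const_mul _ _ R hc, ← hB t (le_of_lt ht), smul_apply, inner_smul_right_eq_smul]
      rfl
    rw [setIntegral_congr_fun measurableSet_Ioi e1]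
    have hcK : ContinuousOn (Function.uncurry fun t s => Real.exp (-l * t) * resolventSymbol q t s)
        (Ioi 0 ×ˢ spectrum ℝ R) :=
      ContinuousOn.mul (by fun_prop) ((continuousOn_resolventSymbol hq).mono
        (prod_mono (subset_univ _) hs))
    have hbound : ∀ᵐ t ∂(volume.restrict (Ioi (0 : ℝ))), ∀ s ∈ spectrum ℝ R,
        ‖Real.exp (-l * t) * resolventSymbol q t s‖ ≤ 2 * Real.exp ((-1 / 2) * t) := by
      refine (ae_restrict_iff' measurableSet_Ioi).2 (Eventually.of_forall fun t ht s h => ?_)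
      have ht : 0 < t := ht
      rw [norm_mul, Real.norm_eq_abs, Real.abs_exp, Real.norm_eq_abs]
      calc _ ≤ Real.exp (-1 * t) * (2 * Real.exp (t / 2)) := by
            gcongr
            have h1 := abs_resolventSymbol_le hq t (hs h).1
            have h2 := one_add_le_exp_half ht.le
            nlinarith [(hs h).2, (hs h).1, abs_nonneg t]
        _ = _ := by rw [mul_left_comm, ← Real.exp_add]; ring_nf
    have hfin : HasFiniteIntegral (fun t : ℝ => 2 * Real.exp ((-1 / 2) * t))
        (volume.restrict (Ioi 0)) :=
      (Integrable.const_mul (integrableOn_exp_mul_Ioi (a := -1 / 2) (by norm_num) 0) 2).2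
    have hint := integrableOn_cfc measurableSet_Ioi _ _ R hcK hbound hfin
    have e2 := cfc_setIntegral measurableSet_Ioi _ _ R hcK hbound hfin
    have e3 := ((innerSL ℂ h).comp (ContinuousLinearMap.apply ℂ H g)).integral_comp_comm hint
    simp only [ContinuousLinearMap.comp_apply, ContinuousLinearMap.apply_apply,
      innerSL_apply_apply] at e3
    rw [e3, ← e2]
    have hden : ∀ s ∈ spectrum ℝ R, 1 + (l ^ 2 - 1) * s ≠ 0 := fun s h => by
      have h3 : (0 : ℝ) < l ^ 2 - 1 := by nlinarith
      have := (hs h).1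
      positivity
    have hck : ContinuousOn (fun s : ℝ => s / (1 + (l ^ 2 - 1) * s)) (spectrum ℝ R) :=
      ContinuousOn.div (by fun_prop) (by fun_prop) hden
    rw [cfc_congr (g := fun s => m l * (s / (1 + (l ^ 2 - 1) * s) * s))
      (fun s h => laplace_resolventSymbol hq hl (hs h)),
      cfc_const_mul _ (fun s => s / (1 + (l ^ 2 - 1) * s) * s) R (hck.mul continuousOn_id),
      cfc_mul _ (fun s => s) R hck continuousOn_id, cfc_id' ℝ R, smul_apply,
      inner_smul_right_eq_smul]
    simp

/-- If the matrix elements `⟨h, (A + λ²)⁻¹ x⟩` decay like `e^{-λ r}`, then `⟨h, q_t(√A) x⟩ = 0` for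
`t < r`. -/
theorem inner_waveFamily_eq_zero (hq : IsWaveSymbol q m) (hm : ∀ l > 1, |m l| ≤ l)
    (hR : IsSelfAdjoint R) (hd : DenseRange R)
    (hs : spectrum ℝ R ⊆ Icc 0 1) (hB : ∀ t, 0 ≤ t → B t ∘L R = cfc (resolventSymbol q t) R)
    {h x : H} {C r : ℝ} (hdec : ∀ l : ℝ, 1 < l →
      ‖inner ℂ h (cfc (fun s : ℝ => s / (1 + (l ^ 2 - 1) * s)) R x)‖ * l ≤ C * Real.exp (-l * r))
    {t : ℝ} (ht : 0 < t) (htr : t < r) : inner ℂ h (B t x) = 0 := by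
  have hcont : ContinuousOn (fun t => inner ℂ h (B t x)) (Ici 0) :=
    ContinuousOn.inner (𝕜 := ℂ) continuousOn_const (continuousOn_waveFamily hq hR hd hs hB x)
  refine eq_zero_of_laplace_le (F := fun t => inner ℂ h (B t x)) (C := ‖h‖ * (2 * ‖x‖)) (C' := C)
    hcont (fun t ht => ?_) (fun l hl => ?_) ht htr
  · calc _ ≤ ‖h‖ * ‖B t x‖ := norm_inner_le_norm _ _
      _ ≤ ‖h‖ * ((2 * Real.exp (t / 2)) * ‖x‖) := by
        gcongr
        exact (norm_waveFamily_le hq hR hd hs hB ht x).trans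
          (by gcongr; exact one_add_le_exp_half ht)
      _ = _ := by ring
  · rw [laplace_waveFamily hq hR hd hs hB h x hl, norm_mul, Complex.norm_real, Real.norm_eq_abs]
    refine le_trans ?_ (hdec l hl)
    rw [mul_comm]
    gcongr
    exact hm l hl

end Operator

/-! ### Locally Lipschitz functions -/

section Lipschitz

theorem LocallyLipschitz.comp_locallyLipschitzOn {α β γ : Type*} [PseudoEMetricSpace α]
    [PseudoEMetricSpace β] [PseudoEMetricSpace γ] {g : β → γ} {f : α → β} {s : Set α}
    (hg : LocallyLipschitz g) (hf : LocallyLipschitzOn s f) : LocallyLipschitzOn s (g ∘ f) := by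
  intro x hx
  obtain ⟨K, t, ht, hK⟩ := hf hx
  obtain ⟨L, u, hu, hL⟩ := hg (f x)
  have hc : ContinuousWithinAt f s x := hf.continuousOn x hx
  exact ⟨L * K, t ∩ f ⁻¹' u, inter_mem ht (hc hu),
    hL.comp (hK.mono inter_subset_left) fun y hy => hy.2⟩

theorem LocallyLipschitzOn.fun_mul_real {α : Type*} [PseudoEMetricSpace α] {f g : α → ℝ} {s : Set α}
    (hf : LocallyLipschitzOn s f) (hg : LocallyLipschitzOn s g) :
    LocallyLipschitzOn s (fun x => f x * g x) := by
  have h1 : LocallyLipschitzOn s fun x => (f x, g x) := by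
    intro x hx
    obtain ⟨K, t, ht, hK⟩ := hf hx
    obtain ⟨L, u, hu, hL⟩ := hg hx
    exact ⟨max K L, t ∩ u, inter_mem ht hu,
      (hK.mono inter_subset_left).prodMk (hL.mono inter_subset_right)⟩
  have h2 : LocallyLipschitz fun p : ℝ × ℝ => p.1 * p.2 :=
    (contDiff_fst.mul contDiff_snd : ContDiff ℝ 1 fun p : ℝ × ℝ => p.1 * p.2).locallyLipschitz
  exact h2.comp_locallyLipschitzOn h1

theorem LocallyLipschitz.exists_lipschitzWith_of_hasCompactSupport {E : Type*}
    [NormedAddCommGroup E] [ProperSpace E] {f : E → ℝ} (hf : LocallyLipschitz f)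
    (hc : HasCompactSupport f) : ∃ K, LipschitzWith K f := by
  obtain ⟨R, hR⟩ := hc.isCompact.isBounded.subset_closedBall (0 : E)
  obtain ⟨K, hK⟩ := (hf.locallyLipschitzOn (s := Metric.closedBall (0 : E) (R + 1))
    ).exists_lipschitzOnWith_of_compact (isCompact_closedBall _ _)
  obtain ⟨M, hM⟩ := hc.exists_bound_of_continuous hf.continuous
  have hM0 : 0 ≤ M := (norm_nonneg _).trans (hM 0)
  have h0 : ∀ x, R < ‖x‖ → f x = 0 := fun x hx => by
    refine image_eq_zero_of_notMem_tsupport fun h => ?_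
    have := hR h
    rw [mem_closedBall_zero_iff] at this
    linarith
  -- if `x` is far from the support, then `f x` and `f y` differ only if `x` and `y` are far apart
  have key : ∀ x y, R + 1 < ‖x‖ → dist (f x) (f y) ≤ M * dist x y := by
    intro x y hx
    rw [h0 x (by linarith), dist_zero_left]
    rcases lt_or_ge R ‖y‖ with hy | hy
    · rw [h0 y hy, norm_zero]; positivity
    · have h1 : 1 ≤ dist x y := by
        rw [dist_eq_norm]
        linarith [norm_sub_norm_le x y]
      nlinarith [hM y]
  refine ⟨max K M.toNNReal, LipschitzWith.of_dist_le_mul fun x y => ?_⟩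
  have hK' : (K : ℝ) ≤ (max K M.toNNReal : NNReal) := by exact_mod_cast le_max_left _ _
  have hM' : M ≤ (max K M.toNNReal : NNReal) := by
    refine (Real.le_coe_toNNReal M).trans ?_
    exact_mod_cast le_max_right _ _
  rcases lt_or_ge (R + 1) ‖x‖ with hx | hx
  · exact (key x y hx).trans (by gcongr)
  rcases lt_or_ge (R + 1) ‖y‖ with hy | hy
  · rw [dist_comm, dist_comm x y]; exact (key y x hy).trans (by gcongr)
  · exact (hK.dist_le_mul x (by simpa using hx) y (by simpa using hy)).trans (by gcongr)

/-- Rademacher's theorem for locally Lipschitz functions. -/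
theorem LocallyLipschitzOn.ae_differentiableAt {n : ℕ} {f : Euc n → ℝ} {s : Set (Euc n)}
    (hf : LocallyLipschitzOn s f) (hs : IsOpen s) : ∀ᵐ x, x ∈ s → DifferentiableAt ℝ f x := by
  have h : ∀ᵐ x ∂(volume.restrict s), DifferentiableAt ℝ f x := by
    rw [ae_restrict_iff' hs.measurableSet]
    have hcov : ∀ x : s, ∃ U : Set (Euc n), IsOpen U ∧ x.1 ∈ U ∧ ∃ K, LipschitzOnWith K f U := by
      rintro ⟨x, hx⟩
      obtain ⟨K, t, ht, hK⟩ := hf hx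
      rw [hs.nhdsWithin_eq hx] at ht
      exact ⟨interior t, isOpen_interior, mem_interior_iff_mem_nhds.2 ht, K,
        hK.mono interior_subset⟩
    choose U hUo hxU K hK using hcov
    obtain ⟨T, hT, hTU⟩ := isOpen_iUnion_countable U hUo
    have : ∀ᵐ x, ∀ i ∈ T, x ∈ U i → DifferentiableWithinAt ℝ f (U i) x :=
      (ae_ball_iff hT).2 fun i _ => (hK i).ae_differentiableWithinAt_of_mem
    filter_upwards [this] with x hx hxs
    have hx' : x ∈ ⋃ i ∈ T, U i := hTU ▸ mem_iUnion.2 ⟨⟨x, hxs⟩, hxU ⟨x, hxs⟩⟩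
    obtain ⟨i, hi, hxi⟩ := mem_iUnion₂.1 hx'
    exact (hx i hi hxi).differentiableAt ((hUo i).mem_nhds hxi)
  rwa [ae_restrict_iff' hs.measurableSet] at h

end Lipschitz

/-! ### Weak derivatives -/

section WeakDerivative

variable {n : ℕ}

/-- Mollifications of a Lipschitz function `θ` differentiate under the integral sign. -/
theorem fderiv_convolution_bump {θ : Euc n → ℝ} {K : NNReal} (hθ : LipschitzWith K θ)
    (φ : ContDiffBump (0 : Euc n)) (x v : Euc n) :
    fderiv ℝ (convolution (φ.normed volume) θ (ContinuousLinearMap.lsmul ℝ ℝ) volume) x v =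
      convolution (φ.normed volume) (fun y => lineDeriv ℝ θ y v) (ContinuousLinearMap.lsmul ℝ ℝ)
        volume x := by
  set f := convolution (φ.normed volume) θ (ContinuousLinearMap.lsmul ℝ ℝ) volume with hf
  have hd : ContDiff ℝ ∞ f :=
    φ.hasCompactSupport_normed.contDiff_convolution_left _ φ.contDiff_normed
      hθ.continuous.locallyIntegrable
  have hint : Integrable (φ.normed volume : Euc n → ℝ) :=
    φ.continuous_normed.integrable_of_hasCompactSupport φ.hasCompactSupport_normed
  have hθ' : LipschitzWith (K * 1) fun t => θ (x - t) :=
    hθ.comp (LipschitzWith.of_dist_le_mul fun a b => by rw [dist_sub_left]; simp)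
  have h1 := hθ'.integral_inv_smul_sub_mul_tendsto_integral_lineDeriv_mul hint (-v)
  have h2 : Tendsto (fun t : ℝ => t⁻¹ • (f (x + t • v) - f x)) (𝓝[>] 0) (𝓝 (fderiv ℝ f x v)) :=
    ((hd.differentiable (by simp) x).hasFDerivAt.hasLineDerivAt v).tendsto_slope_zero_right
  have h3 : ∀ t : ℝ, t⁻¹ • (f (x + t • v) - f x) =
      ∫ y, (t⁻¹ • (θ (x - (y + t • -v)) - θ (x - y))) * φ.normed volume y := by
    intro t
    have hi : ∀ a, Integrable fun y => φ.normed volume y • θ (a - y) := fun a =>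
      (φ.continuous_normed.smul
        (hθ.continuous.comp (continuous_const.sub continuous_id))).integrable_of_hasCompactSupport
        (φ.hasCompactSupport_normed.smul_right)
    simp only [hf, convolution_def, ContinuousLinearMap.lsmul_apply]
    rw [← integral_sub (hi _) (hi _), ← integral_smul]
    congr 1
    ext y
    rw [show x - (y + t • -v) = x + t • v - y by rw [smul_neg]; abel]
    simp only [smul_eq_mul]
    ring
  simp_rw [h3] at h2
  rw [tendsto_nhds_unique h2 h1, convolution_def]
  congr 1
  ext y
  have : lineDeriv ℝ (fun t => θ (x - t)) y (-v) = lineDeriv ℝ θ (x - y) v := by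
    simp only [lineDeriv]
    congr 1
    ext t
    rw [smul_neg, show x - (y + -(t • v)) = x - y + t • v by abel]
  rw [this, ContinuousLinearMap.lsmul_apply, smul_eq_mul, mul_comm]

/-- `a` is the weak derivative of `u` on `Ω` in the direction `v`, for smooth test functions with
compact support in `Ω`. -/
structure HasWeakDerivOn (Ω : Set (Euc n)) (v : Euc n) (u a : Euc n → ℂ) : Prop where
  left : LocallyIntegrableOn u Ω
  right : LocallyIntegrableOn a Ω
  integral_eq : ∀ ψ : Euc n → ℝ, ContDiff ℝ ∞ ψ → HasCompactSupport ψ → tsupport ψ ⊆ Ω →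
    ∫ x, (fderiv ℝ ψ x v) • u x = - ∫ x, ψ x • a x

theorem MeasureTheory.LocallyIntegrableOn.integrable_smul_of_eq_zero
    {Ω K : Set (Euc n)} {u : Euc n → ℂ} (hu : LocallyIntegrableOn u Ω) (hK : IsCompact K)
    (hKΩ : K ⊆ Ω)
    {f : Euc n → ℝ} (hf : AEStronglyMeasurable f) {C : ℝ} (hC : ∀ x, ‖f x‖ ≤ C)
    (h0 : ∀ x ∉ K, f x = 0) : Integrable fun x => f x • u x := by
  have h1 : IntegrableOn u K := hu.integrableOn_compact_subset hKΩ hK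
  have h2 : Integrable (fun x => f x • u x) (volume.restrict K) :=
    Integrable.bdd_smul (C := C) h1 hf.restrict (Eventually.of_forall hC)
  refine (integrableOn_iff_integrable_of_support_subset fun x hx => ?_).1 h2
  by_contra h
  exact hx (by simp [h0 x h])

/-- The integration by parts formula defining a weak derivative holds for Lipschitz test
functions, by mollification. -/
theorem HasWeakDerivOn.integral_lineDeriv_smul {Ω : Set (Euc n)} {v : Euc n} {u a : Euc n → ℂ}
    (h : HasWeakDerivOn Ω v u a) (hΩ : IsOpen Ω) {θ : Euc n → ℝ} {K : NNReal}
    (hθ : LipschitzWith K θ) (hc : HasCompactSupport θ) (hs : tsupport θ ⊆ Ω) :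
    ∫ x, (lineDeriv ℝ θ x v) • u x = - ∫ x, θ x • a x := by
  obtain ⟨δ, hδ, hδΩ⟩ := hc.isCompact.exists_cthickening_subset_open hΩ hs
  set S := Metric.cthickening δ (tsupport θ) with hS
  have hScomp : IsCompact S := hc.isCompact.cthickening
  -- mollifiers of radius at most `δ`, so that the mollified functions are supported in `S ⊆ Ω`
  let φ : ℕ → ContDiffBump (0 : Euc n) := fun j =>
    { rIn := δ / (2 * (j + 1)), rOut := δ / (j + 1), rIn_pos := by positivity
      rIn_lt_rOut := by
        refine div_lt_div_of_pos_left hδ (by positivity) ?_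
        have : (0 : ℝ) ≤ j := Nat.cast_nonneg j
        linarith }
  have hout : Tendsto (fun j => (φ j).rOut) atTop (𝓝 0) :=
    tendsto_const_div_atTop_nhds_zero_nat δ |>.comp (tendsto_add_atTop_nat 1) |>.congr
      fun j => by simp [φ]
  have houtδ : ∀ j, (φ j).rOut ≤ δ := fun j =>
    div_le_self hδ.le (by have : (0 : ℝ) ≤ j := Nat.cast_nonneg j
                          linarith)
  set f : ℕ → Euc n → ℝ := fun j =>
    convolution ((φ j).normed volume) θ (ContinuousLinearMap.lsmul ℝ ℝ) volume with hf
  have hfd : ∀ j, ContDiff ℝ ∞ (f j) := fun j =>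
    (φ j).hasCompactSupport_normed.contDiff_convolution_left _ (φ j).contDiff_normed
      hθ.continuous.locallyIntegrable
  have hfs : ∀ j, tsupport (f j) ⊆ S := by
    intro j
    refine closure_minimal ?_ Metric.isClosed_cthickening
    refine (support_convolution_subset _).trans ?_
    rintro _ ⟨y, hy, z, hz, rfl⟩
    rw [(φ j).support_normed_eq] at hy
    refine Metric.mem_cthickening_of_dist_le _ z _ _ (subset_tsupport _ hz) ?_
    rw [dist_eq_norm, add_sub_cancel_right]
    exact (mem_ball_zero_iff.1 hy).le.trans (houtδ j)
  have hfc : ∀ j, HasCompactSupport (f j) := fun j =>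
    hScomp.of_isClosed_subset (isClosed_tsupport _) (hfs j)
  have heq : ∀ j, ∫ x, (fderiv ℝ (f j) x v) • u x = - ∫ x, f j x • a x := fun j =>
    h.integral_eq _ (hfd j) (hfc j) ((hfs j).trans hδΩ)
  obtain ⟨M, hM⟩ := hc.exists_bound_of_continuous hθ.continuous
  have hnorm : ∀ (j : ℕ) (g : Euc n → ℝ) (C : ℝ) (x : Euc n), (∀ y, ‖g y‖ ≤ C) →
      ‖convolution ((φ j).normed volume) g (ContinuousLinearMap.lsmul ℝ ℝ) volume x‖ ≤ C := by
    intro j g C x hg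
    rw [convolution_def]
    have hint : Integrable ((φ j).normed volume : Euc n → ℝ) :=
      (φ j).continuous_normed.integrable_of_hasCompactSupport (φ j).hasCompactSupport_normed
    refine (norm_integral_le_of_norm_le (hint.mul_const C) (Eventually.of_forall fun y => ?_)).trans
      (le_of_eq ?_)
    · rw [ContinuousLinearMap.lsmul_apply, norm_smul, Real.norm_eq_abs,
        abs_of_nonneg ((φ j).nonneg_normed y)]
      exact mul_le_mul_of_nonneg_left (hg _) ((φ j).nonneg_normed y)
    · rw [integral_mul_const, (φ j).integral_normed, one_mul]
  have hzero : ∀ j, ∀ x ∉ S, f j x = 0 := fun j x hx =>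
    image_eq_zero_of_notMem_tsupport fun h => hx (hfs j h)
  have hzero' : ∀ j, ∀ x ∉ S, fderiv ℝ (f j) x v = 0 := fun j x hx => by
    have : fderiv ℝ (f j) x = 0 := by
      by_contra h
      exact hx (hfs j (support_fderiv_subset ℝ h))
    rw [this]; rfl
  have huS : IntegrableOn u S := h.left.integrableOn_compact_subset hδΩ hScomp
  have haS : IntegrableOn a S := h.right.integrableOn_compact_subset hδΩ hScomp
  have hSm : MeasurableSet S := hScomp.isClosed.measurableSet
  have lim1 : Tendsto (fun j => ∫ x, f j x • a x) atTop (𝓝 (∫ x, θ x • a x)) := by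
    refine tendsto_integral_of_dominated_convergence (S.indicator fun x => M * ‖a x‖)
      (fun j => (h.right.integrable_smul_of_eq_zero hScomp hδΩ
        (hfd j).continuous.aestronglyMeasurable (fun x => hnorm j θ M x hM)
        (hzero j)).aestronglyMeasurable)
      (IntegrableOn.integrable_indicator (haS.norm.const_mul M) hSm)
      (fun j => Eventually.of_forall fun x => ?_)
      (Eventually.of_forall fun x => ?_)
    · by_cases hx : x ∈ S
      · rw [indicator_of_mem hx, norm_smul]
        exact mul_le_mul_of_nonneg_right (hnorm j θ M x hM) (norm_nonneg _)
      · simp [hzero j x hx, hx]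
    · exact (ContDiffBump.convolution_tendsto_right_of_continuous hout hθ.continuous x).smul_const _
  have lim2 : Tendsto (fun j => ∫ x, (fderiv ℝ (f j) x v) • u x) atTop
      (𝓝 (∫ x, (lineDeriv ℝ θ x v) • u x)) := by
    refine tendsto_integral_of_dominated_convergence (S.indicator fun x => (K * ‖v‖) * ‖u x‖)
      (fun j => (h.left.integrable_smul_of_eq_zero hScomp hδΩ
        (((hfd j).continuous_fderiv (by simp)).clm_apply continuous_const).aestronglyMeasurable
        (C := K * ‖v‖) (fun x => ?_) (hzero' j)).aestronglyMeasurable)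
      (IntegrableOn.integrable_indicator (huS.norm.const_mul _) hSm)
      (fun j => Eventually.of_forall fun x => ?_)
      ?_
    · rw [fderiv_convolution_bump hθ]
      exact hnorm j _ _ x fun y => norm_lineDeriv_le_of_lipschitz ℝ hθ
    · by_cases hx : x ∈ S
      · rw [indicator_of_mem hx, norm_smul]
        refine mul_le_mul_of_nonneg_right ?_ (norm_nonneg _)
        rw [fderiv_convolution_bump hθ]
        exact hnorm j _ _ x fun y => norm_lineDeriv_le_of_lipschitz ℝ hθ
      · simp [hzero' j x hx, hx]
    · have hae := ContDiffBump.ae_convolution_tendsto_right_of_locallyIntegrable (μ := volume)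
        (φ := φ) (l := atTop) (K := 2) hout (Eventually.of_forall fun j => by
          simp only [φ]
          rw [mul_div_assoc', mul_div_mul_left _ _ two_ne_zero]) (hθ.locallyIntegrable_lineDeriv v)
      filter_upwards [hae] with x hx
      simp only [hf, fderiv_convolution_bump hθ]
      exact hx.smul_const _
  exact tendsto_nhds_unique lim2 (by simpa only [heq] using lim1.neg)

/-- The product rule for a weak derivative and a locally Lipschitz function `φ`: for a test function
`ψ` the product `φ ψ` is a Lipschitz test function. -/
theorem HasWeakDerivOn.smul {Ω : Set (Euc n)} {v : Euc n} {u a : Euc n → ℂ}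
    (h : HasWeakDerivOn Ω v u a) (hΩ : IsOpen Ω) {φ : Euc n → ℝ} (hφ : LocallyLipschitzOn Ω φ) :
    HasWeakDerivOn Ω v (fun x => φ x • u x) (fun x => φ x • a x + (fderiv ℝ φ x v) • u x) := by
  have hbound : ∀ x ∈ Ω, ∃ C : NNReal, ∃ U, IsOpen U ∧ x ∈ U ∧ U ⊆ Ω ∧ LipschitzOnWith C φ U := by
    intro x hx
    obtain ⟨C, t, ht, hC⟩ := hφ hx
    rw [hΩ.nhdsWithin_eq hx] at ht
    exact ⟨C, interior t ∩ Ω, isOpen_interior.inter hΩ, ⟨mem_interior_iff_mem_nhds.2 ht, hx⟩,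
      inter_subset_right, hC.mono (inter_subset_left.trans interior_subset)⟩
  have hφc : ContinuousOn φ Ω := hφ.continuousOn
  have hD : LocallyIntegrableOn (fun x => (fderiv ℝ φ x v) • u x) Ω := by
    rw [locallyIntegrableOn_iff hΩ.isLocallyClosed]
    intro k hkΩ hk
    have huk : IntegrableOn u k := h.left.integrableOn_compact_subset hkΩ hk
    obtain ⟨C, hC⟩ : ∃ C : ℝ, ∀ x ∈ k, ‖fderiv ℝ φ x v‖ ≤ C := by
      refine hk.induction_on (p := fun k => ∃ C : ℝ, ∀ x ∈ k, ‖fderiv ℝ φ x v‖ ≤ C) ⟨0, by simp⟩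
        (fun s t hst ⟨C, hC⟩ => ⟨C, fun x hx => hC x (hst hx)⟩)
        (fun s t ⟨C, hC⟩ ⟨D, hD⟩ => ⟨max C D, fun x hx => hx.elim
          (fun h => (hC x h).trans (le_max_left _ _))
          fun h => (hD x h).trans (le_max_right _ _)⟩) ?_
      intro x hx
      obtain ⟨C, U, hU, hxU, -, hC⟩ := hbound x (hkΩ hx)
      refine ⟨U, mem_nhdsWithin_of_mem_nhds (hU.mem_nhds hxU), C * ‖v‖, fun y hy => ?_⟩
      exact (ContinuousLinearMap.le_opNorm _ _).trans (mul_le_mul_of_nonneg_right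
        (norm_fderiv_le_of_lipschitzOn ℝ (hU.mem_nhds hy) hC) (norm_nonneg _))
    exact Integrable.bdd_smul (C := C) huk
      (measurable_fderiv_apply_const ℝ φ v).aestronglyMeasurable
      ((ae_restrict_iff' hk.measurableSet).2 (Eventually.of_forall hC))
  have hA : LocallyIntegrableOn (fun x => φ x • a x) Ω :=
    h.right.continuousOn_smul hΩ.isLocallyClosed hφc
  have hU : LocallyIntegrableOn (fun x => φ x • u x) Ω :=
    h.left.continuousOn_smul hΩ.isLocallyClosed hφc
  refine ⟨hU, hA.add hD, fun ψ hψ hψc hψs => ?_⟩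
  set θ : Euc n → ℝ := fun x => φ x * ψ x with hθ
  have hθs : tsupport θ ⊆ tsupport ψ := tsupport_mul_subset_right
  have hθc : HasCompactSupport θ := hψc.mul_left
  have hθl : LocallyLipschitz θ := by
    rw [← locallyLipschitzOn_univ]
    intro x _
    rw [nhdsWithin_univ]
    by_cases hx : x ∈ Ω
    · have := hφ.fun_mul_real
        ((hψ.of_le (by simp)).locallyLipschitz (𝕂 := ℝ)).locallyLipschitzOn hx
      rwa [hΩ.nhdsWithin_eq hx] at this
    · refine ⟨0, (tsupport ψ)ᶜ, (isClosed_tsupport ψ).isOpen_compl.mem_nhds fun h => hx (hψs h), ?_⟩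
      refine LipschitzOnWith.of_dist_le_mul fun y hy z hz => ?_
      simp [hθ, image_eq_zero_of_notMem_tsupport hy, image_eq_zero_of_notMem_tsupport hz]
  obtain ⟨K, hK⟩ := hθl.exists_lipschitzWith_of_hasCompactSupport hθc
  have key := h.integral_lineDeriv_smul hΩ hK hθc (hθs.trans hψs)
  have hψ0 : ∀ x ∉ tsupport ψ, ψ x = 0 := fun x hx => image_eq_zero_of_notMem_tsupport hx
  have hψ0' : ∀ x ∉ tsupport ψ, fderiv ℝ ψ x = 0 := fun x hx => by
    by_contra h
    exact hx (support_fderiv_subset ℝ h)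
  have hline : ∀ᵐ x, (lineDeriv ℝ θ x v) • u x =
      (fderiv ℝ ψ x v) • (φ x • u x) + ψ x • ((fderiv ℝ φ x v) • u x) := by
    filter_upwards [hφ.ae_differentiableAt hΩ] with x hx
    by_cases hxs : x ∈ tsupport ψ
    · have h1 := hx (hψs hxs)
      have h2 : DifferentiableAt ℝ ψ x := hψ.differentiable (by simp) x
      have h3 : lineDeriv ℝ θ x v = fderiv ℝ θ x v := (h1.fun_mul h2).lineDeriv_eq_fderiv
      rw [h3, fderiv_fun_mul h1 h2]
      simp only [add_apply, smul_apply, smul_eq_mul, Complex.real_smul]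
      push_cast
      ring
    · have : lineDeriv ℝ θ x v = 0 := by
        have h0 : θ =ᶠ[𝓝 x] fun _ => 0 := by
          filter_upwards [(isClosed_tsupport ψ).isOpen_compl.mem_nhds hxs] with y hy
          simp [hθ, hψ0 y hy]
        rw [h0.lineDeriv_eq]
        simp [lineDeriv]
      simp [this, hψ0 x hxs, hψ0' x hxs]
  obtain ⟨M, hM⟩ := hψc.exists_bound_of_continuous hψ.continuous
  obtain ⟨M', hM'⟩ := (hψc.fderiv_apply (𝕜 := ℝ) v).exists_bound_of_continuous
    ((hψ.continuous_fderiv (by simp)).clm_apply continuous_const)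
  have i1 : Integrable fun x => (fderiv ℝ ψ x v) • (φ x • u x) :=
    hU.integrable_smul_of_eq_zero hψc hψs
      ((hψ.continuous_fderiv (by simp)).clm_apply continuous_const).aestronglyMeasurable hM'
      fun x hx => by rw [hψ0' x hx]; rfl
  have i2 : Integrable fun x => ψ x • ((fderiv ℝ φ x v) • u x) :=
    hD.integrable_smul_of_eq_zero hψc hψs hψ.continuous.aestronglyMeasurable hM hψ0
  have i3 : Integrable fun x => ψ x • (φ x • a x) :=
    hA.integrable_smul_of_eq_zero hψc hψs hψ.continuous.aestronglyMeasurable hM hψ0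
  rw [integral_congr_ae hline, integral_add i1 i2] at key
  simp only [smul_add]
  rw [integral_add i3 i2, neg_add, ← sub_eq_iff_eq_add]
  rw [sub_neg_eq_add, key]
  congr 2
  ext x
  simp only [hθ, smul_smul, mul_comm]

end WeakDerivative

/-! ### The cometric -/

open scoped MatrixOrder Matrix.Norms.L2Operator in
/-- The rows of `B` are the coordinates of an orthonormal basis for the inner product `G`. -/
theorem Matrix.PosDef.exists_inv_eq_transpose_mul {n : ℕ} {G : Matrix (Fin n) (Fin n) ℝ}
    (hG : G.PosDef) : ∃ B : Matrix (Fin n) (Fin n) ℝ, G⁻¹ = B.transpose * B ∧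
      B * G * B.transpose = 1 := by
  obtain ⟨B, hB⟩ := CStarAlgebra.nonneg_iff_eq_star_mul_self.mp hG.inv.posSemidef.nonneg
  rw [star_eq_conjTranspose, conjTranspose_eq_transpose_of_trivial] at hB
  refine ⟨B, hB, ?_⟩
  have hdet : IsUnit G.det := (Matrix.isUnit_iff_isUnit_det _).1 hG.isUnit
  have h1 : B.transpose * B * G = 1 := by rw [← hB, Matrix.nonsing_inv_mul _ hdet]
  rw [Matrix.mul_assoc] at h1
  exact mul_eq_one_comm.1 h1

namespace CMGA

variable {n : ℕ} {M : Type*} [TopologicalSpace M] (X : CMGA n M)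

/-- The squared `g`-length of a tangent vector. -/
noncomputable def normSq (x : X.reg) (v : TangentSpace 𝓘(ℝ, Euc n) x) : ℝ := X.metric.inner x v v

variable {X}

theorem normSq_nonneg (x : X.reg) (v : TangentSpace 𝓘(ℝ, Euc n) x) : 0 ≤ X.normSq x v := by
  by_cases h : v = 0
  · simp [normSq, h]
  · exact (X.metric.pos x v h).le

theorem sum_smul_stdVec (v : Euc n) : ∑ i, v i • stdVec n i = v := by
  have h := (EuclideanSpace.basisFun (Fin n) ℝ).sum_repr v
  simpa [stdVec] using h

theorem inner_sum_smul (x : X.reg) (b : Fin n → TangentSpace 𝓘(ℝ, Euc n) x) (c d : Fin n → ℝ) :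
    X.metric.inner x (∑ i, c i • b i) (∑ i, d i • b i) =
      c ⬝ᵥ (Matrix.of fun i j => X.metric.inner x (b i) (b j)).mulVec d := by
  simp only [dotProduct, Matrix.mulVec, Matrix.of_apply, map_sum, map_smul,
    sum_apply, smul_apply, smul_eq_mul, Finset.mul_sum]
  rw [Finset.sum_comm]
  refine Finset.sum_congr rfl fun i _ => Finset.sum_congr rfl fun j _ => ?_
  ring

/-- In terms of a `g`-orthonormal frame the cometric is the standard hermitian product of the
components. -/
theorem exists_orthonormal_cometric (x : X.reg) :
    ∃ e : Fin n → TangentSpace 𝓘(ℝ, Euc n) x,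
      (∀ i j, X.metric.inner x (e i) (e j) = if i = j then 1 else 0) ∧
      ∀ α β : TangentSpace 𝓘(ℝ, Euc n) x →L[ℝ] ℂ,
        X.cometric x α β = ∑ k, α (e k) * (starRingEnd ℂ) (β (e k)) := by
  let b : Fin n → TangentSpace 𝓘(ℝ, Euc n) x := fun i => stdVec n i
  set G : Matrix (Fin n) (Fin n) ℝ := Matrix.of fun i j => X.metric.inner x (b i) (b j) with hG
  have hpd : G.PosDef := by
    refine Matrix.PosDef.of_dotProduct_mulVec_pos ?_ fun c hc => ?_
    · ext i j
      simp [hG, X.metric.symm x (b i) (b j)]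
    · have hv : ((∑ i, c i • b i : TangentSpace 𝓘(ℝ, Euc n) x)) ≠ 0 := by
        intro h0
        apply hc
        have h1 := sum_smul_stdVec (WithLp.toLp 2 c : Euc n)
        have h2 : (WithLp.toLp 2 c : Euc n) = 0 := h1.symm.trans h0
        simpa using congrArg (WithLp.ofLp) h2
      have := X.metric.pos x _ hv
      rw [inner_sum_smul] at this
      exact this
  obtain ⟨B, hB, hB1⟩ := hpd.exists_inv_eq_transpose_mul
  refine ⟨fun k => ∑ i, B k i • b i, fun i j => ?_, fun α β => ?_⟩
  · rw [inner_sum_smul]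
    have h1 := congrFun (congrFun hB1 i) j
    rw [Matrix.one_apply] at h1
    rw [← h1, Matrix.mul_assoc]
    simp only [Matrix.mul_apply, Matrix.transpose_apply, dotProduct, Matrix.mulVec, hG]
  · have e1 : X.cometric x α β =
        ∑ i, ∑ j, ((G⁻¹ i j : ℝ) : ℂ) * α (b i) * (starRingEnd ℂ) (β (b j)) := rfl
    rw [e1, hB]
    simp only [Matrix.mul_apply, Matrix.transpose_apply, map_sum, map_smul, Complex.real_smul,
      map_mul, Complex.conj_ofReal, Complex.ofReal_sum, Complex.ofReal_mul]
    simp only [Finset.sum_mul, Finset.mul_sum]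
    rw [Finset.sum_congr rfl fun i _ => Finset.sum_comm, Finset.sum_comm]
    refine Finset.sum_congr rfl fun k _ => ?_
    rw [Finset.sum_comm]
    refine Finset.sum_congr rfl fun i _ => Finset.sum_congr rfl fun j _ => ?_
    ring

theorem conj_cometric (x : X.reg) (α β : TangentSpace 𝓘(ℝ, Euc n) x →L[ℝ] ℂ) :
    (starRingEnd ℂ) (X.cometric x α β) = X.cometric x β α := by
  obtain ⟨e, -, he⟩ := exists_orthonormal_cometric x
  simp only [he, map_sum, map_mul, Complex.conj_conj]
  exact Finset.sum_congr rfl fun k _ => mul_comm _ _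

theorem cometric_self_nonneg (x : X.reg) (α : TangentSpace 𝓘(ℝ, Euc n) x →L[ℝ] ℂ) :
    0 ≤ (X.cometric x α α).re := by
  obtain ⟨e, -, he⟩ := exists_orthonormal_cometric x
  rw [he, Complex.re_sum]
  refine Finset.sum_nonneg fun k _ => ?_
  rw [Complex.mul_conj]
  exact_mod_cast Complex.normSq_nonneg _

/-- The sum of squares of the components of a covector, in an orthonormal frame, is bounded by the
square of its norm. -/
theorem sum_sq_le_of_abs_le (x : X.reg) {L : TangentSpace 𝓘(ℝ, Euc n) x →L[ℝ] ℝ} {c : ℝ}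
    (hL : ∀ v, |L v| ≤ c * √(X.normSq x v)) {e : Fin n → TangentSpace 𝓘(ℝ, Euc n) x}
    (he : ∀ i j, X.metric.inner x (e i) (e j) = if i = j then 1 else 0) :
    ∑ k, L (e k) ^ 2 ≤ c ^ 2 := by
  set S := ∑ k, L (e k) ^ 2 with hS
  have hS0 : 0 ≤ S := Finset.sum_nonneg fun k _ => sq_nonneg _
  -- test the hypothesis on the gradient of `L`
  have h1 : L (∑ k, L (e k) • e k) = S := by
    simp only [map_sum, map_smul, smul_eq_mul, hS, sq]
  have h2 : X.normSq x (∑ k, L (e k) • e k) = S := by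
    rw [normSq, inner_sum_smul]
    simp only [he, dotProduct, Matrix.mulVec, Matrix.of_apply, hS, sq]
    simp
  have h3 := hL (∑ k, L (e k) • e k)
  rw [h1, h2, abs_of_nonneg hS0] at h3
  have h4 := Real.sq_sqrt hS0
  have h5 := Real.sqrt_nonneg S
  nlinarith [sq_nonneg (√S - c)]

section Leibniz

variable {x : X.reg} {L : TangentSpace 𝓘(ℝ, Euc n) x →L[ℝ] ℝ} {φ c : ℝ}

/-- A bound for the energy density of `φ u`, where `L = dφ`, `α = du` and `w = u` at the point `x`.
-/
theorem cometric_leibniz_le (hL : ∀ v, |L v| ≤ c * √(X.normSq x v))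
    (α : TangentSpace 𝓘(ℝ, Euc n) x →L[ℝ] ℂ) (w : ℂ) :
    (X.cometric x (φ • α + L.smulRight w) (φ • α + L.smulRight w)).re ≤
      2 * φ ^ 2 * (X.cometric x α α).re + 2 * c ^ 2 * ‖w‖ ^ 2 := by
  obtain ⟨e, he, hcom⟩ := exists_orthonormal_cometric x
  have h1 := sum_sq_le_of_abs_le x hL he
  simp only [hcom, Complex.re_sum, Complex.mul_conj, Complex.ofReal_re, Complex.normSq_eq_norm_sq]
  calc ∑ k, ‖(φ • α + L.smulRight w) (e k)‖ ^ 2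
      ≤ ∑ k, (2 * φ ^ 2 * ‖α (e k)‖ ^ 2 + 2 * ‖w‖ ^ 2 * L (e k) ^ 2) := by
        refine Finset.sum_le_sum fun k _ => ?_
        have h2 : ‖(φ • α + L.smulRight w) (e k)‖ ≤ |φ| * ‖α (e k)‖ + |L (e k)| * ‖w‖ := by
          refine (norm_add_le (φ • α (e k)) (L (e k) • w)).trans (le_of_eq ?_)
          rw [norm_smul, norm_smul]; rfl
        have h3 : ‖(φ • α + L.smulRight w) (e k)‖ ^ 2 ≤
            (|φ| * ‖α (e k)‖ + |L (e k)| * ‖w‖) ^ 2 := by gcongr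
        rw [← sq_abs φ, ← sq_abs (L (e k))]
        nlinarith [sq_nonneg (|φ| * ‖α (e k)‖ - |L (e k)| * ‖w‖)]
    _ = 2 * φ ^ 2 * ∑ k, ‖α (e k)‖ ^ 2 + 2 * ‖w‖ ^ 2 * ∑ k, L (e k) ^ 2 := by
        rw [Finset.sum_add_distrib, Finset.mul_sum, Finset.mul_sum]
    _ ≤ _ := by nlinarith [sq_nonneg ‖w‖]

/-- For a weight `φ` with `|dφ| ≤ 2 κ φ`, the pairing of `du` with `d(φ u) = φ du + u dφ` has real
part at least `-κ² φ |u|²`: the cross term is at most `φ |du|² + |u|² |dφ|² / (4 φ)`. -/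
theorem neg_le_cometric_leibniz {κ : ℝ} (hφ : 0 < φ)
    (hL : ∀ v, |L v| ≤ 2 * κ * φ * √(X.normSq x v))
    (α : TangentSpace 𝓘(ℝ, Euc n) x →L[ℝ] ℂ) (w : ℂ) :
    -(κ ^ 2 * φ * ‖w‖ ^ 2) ≤ (X.cometric x α (φ • α + L.smulRight w)).re := by
  obtain ⟨e, he, hcom⟩ := exists_orthonormal_cometric x
  have h1 := sum_sq_le_of_abs_le x hL he
  rw [hcom, Complex.re_sum]
  calc -(κ ^ 2 * φ * ‖w‖ ^ 2) = -((2 * κ * φ) ^ 2 * (‖w‖ ^ 2 / (4 * φ))) := by field_simp; ring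
    _ ≤ -((∑ k, L (e k) ^ 2) * (‖w‖ ^ 2 / (4 * φ))) := by gcongr
    _ = ∑ k, -(L (e k) ^ 2 * (‖w‖ ^ 2 / (4 * φ))) := by rw [Finset.sum_mul, Finset.sum_neg_distrib]
    _ ≤ _ := by
      refine Finset.sum_le_sum fun k _ => ?_
      have e1 : (φ • α + L.smulRight w) (e k) = φ • α (e k) + L (e k) • w := rfl
      rw [e1]
      set a := α (e k)
      set l := L (e k)
      have e2 : (a * (starRingEnd ℂ) (φ • a + l • w)).re =
          φ * ‖a‖ ^ 2 + l * (a * (starRingEnd ℂ) w).re := by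
        rw [← Complex.normSq_eq_norm_sq, Complex.normSq_apply]
        simp
        ring
      have h3 : |l * (a * (starRingEnd ℂ) w).re| ≤ |l| * (‖a‖ * ‖w‖) := by
        rw [abs_mul]
        gcongr
        refine (Complex.abs_re_le_norm _).trans (le_of_eq ?_)
        rw [norm_mul, RCLike.norm_conj]
      have h4 : |l| * (‖a‖ * ‖w‖) ≤ φ * ‖a‖ ^ 2 + l ^ 2 * (‖w‖ ^ 2 / (4 * φ)) := by
        have h5 : φ * ‖a‖ ^ 2 + l ^ 2 * (‖w‖ ^ 2 / (4 * φ)) - |l| * (‖a‖ * ‖w‖) =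
            (2 * φ * ‖a‖ - |l| * ‖w‖) ^ 2 / (4 * φ) := by
          rw [← sq_abs l]; field_simp; ring
        have : 0 ≤ (2 * φ * ‖a‖ - |l| * ‖w‖) ^ 2 / (4 * φ) := by positivity
        linarith
      rw [e2]
      linarith [(abs_le.1 h3).1]

end Leibniz

theorem cometric_zero_left (x : X.reg) (β : TangentSpace 𝓘(ℝ, Euc n) x →L[ℝ] ℂ) :
    X.cometric x 0 β = 0 := by
  have h0 : ∀ v, (0 : TangentSpace 𝓘(ℝ, Euc n) x →L[ℝ] ℂ) v = 0 := fun _ => rfl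
  obtain ⟨e, -, he⟩ := exists_orthonormal_cometric x
  rw [he]
  exact Finset.sum_eq_zero fun k _ => by rw [h0, zero_mul]

/-! ### Charts of the regular part -/

theorem contMDiffOn_chart_symm {e : OpenPartialHomeomorph X.reg (Euc n)}
    (he : e ∈ atlas (Euc n) X.reg) : ContMDiffOn 𝓘(ℝ, Euc n) 𝓘(ℝ, Euc n) ∞ e.symm e.target :=
  contMDiffOn_symm_of_mem_maximalAtlas (IsManifold.subset_maximalAtlas he)

theorem contMDiffOn_chart {e : OpenPartialHomeomorph X.reg (Euc n)}
    (he : e ∈ atlas (Euc n) X.reg) : ContMDiffOn 𝓘(ℝ, Euc n) 𝓘(ℝ, Euc n) ∞ e e.source :=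
  contMDiffOn_of_mem_maximalAtlas (IsManifold.subset_maximalAtlas he)

theorem mdifferentiable_chart {e : OpenPartialHomeomorph X.reg (Euc n)}
    (he : e ∈ atlas (Euc n) X.reg) : e.MDifferentiable 𝓘(ℝ, Euc n) 𝓘(ℝ, Euc n) :=
  ⟨(contMDiffOn_chart he).mdifferentiableOn (by simp),
    (contMDiffOn_chart_symm he).mdifferentiableOn (by simp)⟩

theorem contMDiffAt_chart_symm {e : OpenPartialHomeomorph X.reg (Euc n)}
    (he : e ∈ atlas (Euc n) X.reg) {a : Euc n} (ha : a ∈ e.target) :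
    ContMDiffAt 𝓘(ℝ, Euc n) 𝓘(ℝ, Euc n) ∞ e.symm a :=
  (contMDiffOn_chart_symm he).contMDiffAt (e.open_target.mem_nhds ha)

theorem mdifferentiableAt_chart_symm {e : OpenPartialHomeomorph X.reg (Euc n)}
    (he : e ∈ atlas (Euc n) X.reg) {a : Euc n} (ha : a ∈ e.target) :
    MDifferentiableAt 𝓘(ℝ, Euc n) 𝓘(ℝ, Euc n) e.symm a :=
  (contMDiffAt_chart_symm he ha).mdifferentiableAt (by simp)

/-- The metric pulled back by a `C¹` map of an open subset of a normed space is continuous. -/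
theorem continuousOn_metric_comp {E : Type*} [NormedAddCommGroup E] [NormedSpace ℝ E]
    {F : E → X.reg} {s : Set E} (hs : IsOpen s) (hF : ContMDiffOn 𝓘(ℝ, E) 𝓘(ℝ, Euc n) 1 F s) :
    ContinuousOn (fun p : E × E × E => X.metric.inner (F p.1)
      (mfderiv 𝓘(ℝ, E) 𝓘(ℝ, Euc n) F p.1 p.2.1) (mfderiv 𝓘(ℝ, E) 𝓘(ℝ, Euc n) F p.1 p.2.2))
      (s ×ˢ univ) := by
  have hT := hF.continuousOn_tangentMapWithin le_rfl hs.uniqueMDiffOn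
  have hT' : ContinuousOn (fun p : E × E => (Bundle.TotalSpace.mk' (Euc n) (F p.1)
      (mfderiv 𝓘(ℝ, E) 𝓘(ℝ, Euc n) F p.1 p.2) :
      TangentBundle 𝓘(ℝ, Euc n) X.reg)) (s ×ˢ univ) := by
    have h1 : Continuous fun p : E × E => ((tangentBundleModelSpaceHomeomorph 𝓘(ℝ, E)).symm p) :=
      (tangentBundleModelSpaceHomeomorph 𝓘(ℝ, E)).symm.continuous
    refine (hT.comp h1.continuousOn (s := s ×ˢ univ) fun p hp => hp.1).congr fun p hp => ?_
    have h2 : mfderivWithin 𝓘(ℝ, E) 𝓘(ℝ, Euc n) F s p.1 = mfderiv 𝓘(ℝ, E) 𝓘(ℝ, Euc n) F p.1 :=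
      mfderivWithin_of_mem_nhds (hs.mem_nhds hp.1)
    exact congrArg (fun A : E →L[ℝ] TangentSpace 𝓘(ℝ, Euc n) (F p.1) =>
      (Bundle.TotalSpace.mk' (Euc n) (F p.1) (A p.2) : TangentBundle 𝓘(ℝ, Euc n) X.reg)) h2.symm
  intro p hp
  have hv := (hT'.comp (f := fun p : E × E × E => (p.1, p.2.1)) (s := s ×ˢ univ) (by fun_prop)
    fun p hp => ⟨hp.1, mem_univ _⟩) p hp
  have hw := (hT'.comp (f := fun p : E × E × E => (p.1, p.2.2)) (s := s ×ˢ univ) (by fun_prop)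
    fun p hp => ⟨hp.1, mem_univ _⟩) p hp
  have hb : ContinuousWithinAt (fun p : E × E × E => F p.1) (s ×ˢ univ) p :=
    (hF.continuousOn.comp continuousOn_fst fun p hp => hp.1) p hp
  have hg := (X.metric.contMDiff.continuous.continuousAt.comp_continuousWithinAt hb)
  have := hg.clm_bundle_apply₂ (F₁ := Euc n) (F₂ := Euc n) (F₃ := ℝ)
    (E₃ := Bundle.Trivial X.reg ℝ) hv hw
  simp only [FiberBundle.continuousWithinAt_totalSpace] at this
  exact this.2

section Chart

variable {e e' : OpenPartialHomeomorph X.reg (Euc n)}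

theorem mfderiv_chart_symm_mfderiv_chart (he : e ∈ atlas (Euc n) X.reg) {x : X.reg}
    (hx : x ∈ e.source) (v : TangentSpace 𝓘(ℝ, Euc n) x) :
    (mfderiv 𝓘(ℝ, Euc n) 𝓘(ℝ, Euc n) e.symm (e x) (mfderiv 𝓘(ℝ, Euc n) 𝓘(ℝ, Euc n) e x v) : Euc n) =
      v := by
  have h := (mdifferentiable_chart he).symm_comp_deriv hx
  exact congrArg (fun A : Euc n →L[ℝ] Euc n => A v) h

theorem mfderiv_chart_mfderiv_chart_symm (he : e ∈ atlas (Euc n) X.reg) {a : Euc n}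
    (ha : a ∈ e.target) (v : Euc n) :
    (mfderiv 𝓘(ℝ, Euc n) 𝓘(ℝ, Euc n) e (e.symm a)
      (mfderiv 𝓘(ℝ, Euc n) 𝓘(ℝ, Euc n) e.symm a v) : Euc n) = v := by
  have h := (mdifferentiable_chart he).comp_symm_deriv ha
  exact congrArg (fun A : Euc n →L[ℝ] Euc n => A v) h

theorem mfderiv_chart_symm_apply (a : Euc n) (v : Euc n) :
    mfderiv 𝓘(ℝ, Euc n) 𝓘(ℝ, Euc n) e.symm a v = ∑ i, v i • X.coordVec e a i := by
  conv_lhs => rw [← sum_smul_stdVec v]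
  exact (map_sum _ _ _).trans (Finset.sum_congr rfl fun i _ => map_smul _ _ _)

theorem continuousOn_metricMatrix (he : e ∈ atlas (Euc n) X.reg) (i j : Fin n) :
    ContinuousOn (fun a => X.metricMatrix e a i j) e.target :=
  (continuousOn_metric_comp e.open_target ((contMDiffOn_chart_symm he).of_le (by simp))).comp
    (f := fun a => (a, stdVec n i, stdVec n j)) (by fun_prop) fun a ha => ⟨ha, mem_univ _⟩

theorem normSq_mfderiv_chart_symm (a v : Euc n) :
    X.normSq (e.symm a) (mfderiv 𝓘(ℝ, Euc n) 𝓘(ℝ, Euc n) e.symm a v) =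
      v.ofLp ⬝ᵥ (X.metricMatrix e a).mulVec v.ofLp := by
  rw [mfderiv_chart_symm_apply, normSq, inner_sum_smul]
  rfl

theorem posDef_metricMatrix (he : e ∈ atlas (Euc n) X.reg) {a : Euc n} (ha : a ∈ e.target) :
    (X.metricMatrix e a).PosDef := by
  refine Matrix.PosDef.of_dotProduct_mulVec_pos ?_ fun c hc => ?_
  · ext i j
    simp [metricMatrix, X.metric.symm _ (X.coordVec e a i) (X.coordVec e a j)]
  · have h := normSq_mfderiv_chart_symm (X := X) (e := e) a (WithLp.toLp 2 c)
    rw [star_trivial, ← h]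
    refine X.metric.pos _ _ fun h0 => hc ?_
    have h1 := mfderiv_chart_mfderiv_chart_symm he ha (WithLp.toLp 2 c)
    rw [h0] at h1
    have h2 : (WithLp.toLp 2 c : Euc n) = 0 := h1.symm.trans (map_zero _)
    simpa using congrArg WithLp.ofLp h2

theorem continuousOn_det_metricMatrix (he : e ∈ atlas (Euc n) X.reg) :
    ContinuousOn (fun a => (X.metricMatrix e a).det) e.target := by
  simp only [Matrix.det_apply]
  exact continuousOn_finsetSum _ fun σ _ => ContinuousOn.const_smul
    (continuousOn_finsetProd _ fun i _ => continuousOn_metricMatrix he _ _) _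

/-- The change of coordinates between two charts. -/
noncomputable def transition (e e' : OpenPartialHomeomorph X.reg (Euc n)) : Euc n → Euc n :=
  e' ∘ e.symm

theorem differentiableAt_transition (he : e ∈ atlas (Euc n) X.reg) (he' : e' ∈ atlas (Euc n) X.reg)
    {a : Euc n} (ha : a ∈ e.target) (ha' : e.symm a ∈ e'.source) :
    DifferentiableAt ℝ (transition e e') a :=
  (((mdifferentiable_chart he').mdifferentiableAt ha').comp a
    (mdifferentiableAt_chart_symm he ha)).differentiableAt

theorem mfderiv_chart_symm_eq_comp (he : e ∈ atlas (Euc n) X.reg) (he' : e' ∈ atlas (Euc n) X.reg)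
    {a : Euc n} (ha : a ∈ e.target) (ha' : e.symm a ∈ e'.source) (v : Euc n) :
    (mfderiv 𝓘(ℝ, Euc n) 𝓘(ℝ, Euc n) e.symm a v : Euc n) =
      mfderiv 𝓘(ℝ, Euc n) 𝓘(ℝ, Euc n) e'.symm (transition e e' a)
        (fderiv ℝ (transition e e') a v) := by
  have hev : (e.symm : Euc n → X.reg) =ᶠ[𝓝 a] e'.symm ∘ transition e e' := by
    have h1 : ∀ᶠ b in 𝓝 a, e.symm b ∈ e'.source :=
      (e.symm.continuousAt ha).eventually (e'.open_source.mem_nhds ha')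
    filter_upwards [h1] with b hb
    simp [transition, e'.left_inv hb]
  have h2 : MDifferentiableAt 𝓘(ℝ, Euc n) 𝓘(ℝ, Euc n) e'.symm (transition e e' a) :=
    mdifferentiableAt_chart_symm he' (e'.map_source ha')
  have h3 := mfderiv_comp a h2
    (differentiableAt_transition he he' ha ha').mdifferentiableAt
  rw [mfderiv_eq_fderiv] at h3
  have h4 := hev.mfderiv_eq (I := 𝓘(ℝ, Euc n)) (I' := 𝓘(ℝ, Euc n))
  exact congrArg (fun A : Euc n →L[ℝ] Euc n => A v) (h4.trans h3)

/-- The transformation rule `det g = (det D)² det g'` under a change of coordinates with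
differential `D`. -/
theorem det_metricMatrix_eq (he : e ∈ atlas (Euc n) X.reg) (he' : e' ∈ atlas (Euc n) X.reg)
    {a : Euc n} (ha : a ∈ e.target) (ha' : e.symm a ∈ e'.source) :
    (X.metricMatrix e a).det =
      (fderiv ℝ (transition e e') a).det ^ 2 * (X.metricMatrix e' (transition e e' a)).det := by
  set D := fderiv ℝ (transition e e') a
  set J : Matrix (Fin n) (Fin n) ℝ := Matrix.of fun i j => D (stdVec n j) i with hJ
  set G' := X.metricMatrix e' (transition e e' a) with hG'
  -- the metric as a function of the point and of vectors of the model space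
  let gI : X.reg → Euc n → Euc n → ℝ := fun y v w => X.metric.inner y v w
  have hpt : e'.symm (transition e e' a) = e.symm a := by simp [transition, e'.left_inv ha']
  have h1 : X.metricMatrix e a = J.transpose * G' * J := by
    ext i j
    have h2 : X.metricMatrix e a i j = gI (e'.symm (transition e e' a))
        (mfderiv 𝓘(ℝ, Euc n) 𝓘(ℝ, Euc n) e'.symm (transition e e' a) (D (stdVec n i)))
        (mfderiv 𝓘(ℝ, Euc n) 𝓘(ℝ, Euc n) e'.symm (transition e e' a) (D (stdVec n j))) := by
      rw [← mfderiv_chart_symm_eq_comp he he' ha ha',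
        ← mfderiv_chart_symm_eq_comp he he' ha ha', hpt]
      rfl
    rw [h2, mfderiv_chart_symm_apply, mfderiv_chart_symm_apply]
    refine (inner_sum_smul _ _ _ _).trans ?_
    rw [Matrix.mul_assoc]
    simp only [Matrix.mul_apply, Matrix.transpose_apply, dotProduct, Matrix.mulVec, hJ, hG',
      Matrix.of_apply]
    rfl
  have h3 : J.det = D.det := by
    have h4 : J = LinearMap.toMatrix (EuclideanSpace.basisFun (Fin n) ℝ).toBasis
        (EuclideanSpace.basisFun (Fin n) ℝ).toBasis (D : Euc n →ₗ[ℝ] Euc n) := by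
      ext i j
      simp [hJ, LinearMap.toMatrix_apply, stdVec]
    rw [h4, LinearMap.det_toMatrix]
  rw [h1, Matrix.det_mul, Matrix.det_mul, Matrix.det_transpose, h3]
  ring

end Chart

/-! ### The Riemannian volume -/

section Volume

variable [MeasurableSpace M] {e e' : OpenPartialHomeomorph X.reg (Euc n)}

theorem chartVolume_le (he : e ∈ atlas (Euc n) X.reg) : X.chartVolume e ≤ X.regVolume :=
  le_iSup₂ (f := fun e (_ : e ∈ atlas (Euc n) X.reg) => X.chartVolume e) e he

variable [BorelSpace M]

theorem _root_.ContinuousOn.measurableSet_inter_preimage {α β : Type*} [TopologicalSpace α]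
    [MeasurableSpace α] [BorelSpace α] [TopologicalSpace β] [MeasurableSpace β] [BorelSpace β]
    {f : α → β} {s : Set α} (hf : ContinuousOn f s) (hs : MeasurableSet s) {A : Set β}
    (hA : MeasurableSet A) : MeasurableSet (s ∩ f ⁻¹' A) := by
  rw [← Subtype.image_preimage_coe]
  exact hs.subtype_image (hf.domRestrict.measurable hA)

theorem measurableSet_target_inter_preimage (e : OpenPartialHomeomorph X.reg (Euc n))
    {A : Set X.reg} (hA : MeasurableSet A) : MeasurableSet (e.target ∩ e.symm ⁻¹' A) :=
  e.continuousOn_symm.measurableSet_inter_preimage e.open_target.measurableSet hA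

theorem measurableSet_source_inter_preimage (e : OpenPartialHomeomorph X.reg (Euc n))
    {A : Set (Euc n)} (hA : MeasurableSet A) : MeasurableSet (e.source ∩ e ⁻¹' A) :=
  e.continuousOn.measurableSet_inter_preimage e.open_source.measurableSet hA

theorem aemeasurable_chart_symm (e : OpenPartialHomeomorph X.reg (Euc n)) :
    AEMeasurable e.symm ((volume : Measure (Euc n)).restrict e.target) :=
  e.continuousOn_symm.aemeasurable e.open_target.measurableSet

theorem chartVolume_apply (e : OpenPartialHomeomorph X.reg (Euc n))
    {A : Set X.reg} (hA : MeasurableSet A) : X.chartVolume e A =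
      ∫⁻ a in e.target ∩ e.symm ⁻¹' A, ENNReal.ofReal (√(X.metricMatrix e a).det) := by
  rw [chartVolume, Measure.map_apply_of_aemeasurable
    ((aemeasurable_chart_symm e).mono_ac (withDensity_absolutelyContinuous _ _)) hA,
    withDensity_apply', Measure.restrict_restrict' e.open_target.measurableSet, inter_comm]

/-- The measures `det(g)^{1/2} dx` of two charts agree on the overlap. -/
theorem chartVolume_eq (he : e ∈ atlas (Euc n) X.reg) (he' : e' ∈ atlas (Euc n) X.reg)
    {A : Set X.reg} (hA : MeasurableSet A) (h : A ⊆ e.source) (h' : A ⊆ e'.source) :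
    X.chartVolume e A = X.chartVolume e' A := by
  rw [chartVolume_apply e hA, chartVolume_apply e' hA]
  set D := e.target ∩ e.symm ⁻¹' A
  have himg : e'.target ∩ e'.symm ⁻¹' A = transition e e' '' D := by
    ext b
    constructor
    · rintro ⟨hb, hbA⟩
      refine ⟨e (e'.symm b), ⟨e.map_source (h hbA), ?_⟩, ?_⟩
      · rw [mem_preimage, e.left_inv (h hbA)]; exact hbA
      · simp [transition, e.left_inv (h hbA), e'.right_inv hb]
    · rintro ⟨a, ⟨ha, haA⟩, rfl⟩
      refine ⟨e'.map_source (h' haA), ?_⟩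
      simp only [transition, Function.comp_apply, mem_preimage, e'.left_inv (h' haA)]
      exact haA
  have hinj : InjOn (transition e e') D := by
    rintro a ⟨ha, haA⟩ b ⟨hb, hbA⟩ hab
    exact e.symm.injOn ha hb (e'.injOn (h' haA) (h' hbA) hab)
  rw [himg, lintegral_image_eq_lintegral_abs_det_fderiv_mul volume
    (measurableSet_target_inter_preimage e hA) (fun a ha =>
      (differentiableAt_transition he he' ha.1 (h' ha.2)).hasFDerivAt.hasFDerivWithinAt) hinj]
  refine setLIntegral_congr_fun (measurableSet_target_inter_preimage e hA) fun a ha => ?_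
  beta_reduce
  rw [det_metricMatrix_eq he he' ha.1 (h' ha.2), Real.sqrt_mul (sq_nonneg _), Real.sqrt_sq_eq_abs,
    ENNReal.ofReal_mul (abs_nonneg _)]

/-- On the domain of a chart `e` the Riemannian volume is `det(g)^{1/2} dx`: no other chart charges
more mass there. The reverse inequality is `chartVolume_le`. -/
theorem regVolume_restrict_le (he : e ∈ atlas (Euc n) X.reg) :
    X.regVolume.restrict e.source ≤ X.chartVolume e := by
  have hs := e.open_source.measurableSet
  have key : X.regVolume ≤ X.chartVolume e + X.regVolume.restrict e.sourceᶜ := by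
    refine iSup₂_le fun e' he' => Measure.le_iff.2 fun A hA => ?_
    rw [Measure.add_apply, Measure.restrict_apply hA, ← measure_inter_add_sdiff A hs]
    refine add_le_add ?_ (chartVolume_le he' _)
    -- only the part of `A` in both charts is charged by `chartVolume e'`
    have h1 : X.chartVolume e' (A ∩ e.source) = X.chartVolume e' (A ∩ e.source ∩ e'.source) := by
      rw [chartVolume_apply _ (hA.inter hs),
        chartVolume_apply _ ((hA.inter hs).inter e'.open_source.measurableSet)]
      congr 2
      ext a
      simp only [mem_inter_iff, mem_preimage]
      constructor
      · rintro ⟨h1, h2⟩; exact ⟨h1, h2, e'.map_target h1⟩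
      · rintro ⟨h1, h2, -⟩; exact ⟨h1, h2⟩
    rw [h1, ← chartVolume_eq he he' ((hA.inter hs).inter e'.open_source.measurableSet)
      (inter_subset_left.trans inter_subset_right) inter_subset_right]
    exact measure_mono (inter_subset_left.trans inter_subset_left)
  refine Measure.le_iff.2 fun A hA => ?_
  rw [Measure.restrict_apply hA]
  refine (key _).trans ?_
  rw [Measure.add_apply, Measure.restrict_apply (hA.inter hs)]
  have : A ∩ e.source ∩ e.sourceᶜ = ∅ := by rw [inter_assoc, inter_compl_self, inter_empty]
  rw [this, measure_empty, add_zero]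
  exact measure_mono inter_subset_left

instance isLocallyFiniteMeasure_regVolume : IsLocallyFiniteMeasure X.regVolume := by
  refine ⟨fun x => ?_⟩
  set e := chartAt (Euc n) x
  have he : e ∈ atlas (Euc n) X.reg := chart_mem_atlas _ x
  have hx : x ∈ e.source := mem_chart_source _ x
  obtain ⟨r, hr, hrt⟩ := Metric.nhds_basis_closedBall.mem_iff.1
    (e.open_target.mem_nhds (e.map_source hx))
  have hU : e.source ∩ e ⁻¹' Metric.ball (e x) r ∈ 𝓝 x :=
    inter_mem (e.open_source.mem_nhds hx) (e.continuousAt hx (Metric.ball_mem_nhds _ hr))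
  refine ⟨_, hU, ?_⟩
  set U := e.source ∩ e ⁻¹' Metric.ball (e x) r
  have hUm : MeasurableSet U :=
    measurableSet_source_inter_preimage e Metric.isOpen_ball.measurableSet
  have h1 : X.regVolume U ≤ X.chartVolume e U := by
    have := regVolume_restrict_le he U
    rwa [Measure.restrict_apply hUm, inter_eq_left.2 inter_subset_left] at this
  refine h1.trans_lt ?_
  rw [chartVolume_apply e hUm]
  have hsub : e.target ∩ e.symm ⁻¹' U ⊆ Metric.closedBall (e x) r := by
    rintro a ⟨ha, -, haU⟩
    rw [mem_preimage, e.right_inv ha] at haU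
    exact Metric.ball_subset_closedBall haU
  refine (lintegral_mono_set hsub).trans_lt ?_
  have hc : ContinuousOn (fun a => √(X.metricMatrix e a).det) (Metric.closedBall (e x) r) :=
    ((continuousOn_det_metricMatrix he).mono hrt).sqrt
  exact (hc.integrableOn_compact (isCompact_closedBall _ _)).lintegral_lt_top

/-- Null sets of the Riemannian volume are Lebesgue null in charts, as `det g` is positive. -/
theorem ae_chart_of_ae_regVolume (he : e ∈ atlas (Euc n) X.reg) {p : X.reg → Prop}
    (hp : ∀ᵐ x ∂X.regVolume, p x) : ∀ᵐ a, a ∈ e.target → p (e.symm a) := by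
  have h1 : ∀ᵐ x ∂X.chartVolume e, p x := ae_mono (chartVolume_le he) hp
  have h2 := ae_of_ae_map
    ((aemeasurable_chart_symm e).mono_ac (withDensity_absolutelyContinuous _ _)) h1
  have hm : AEMeasurable (fun a => ENNReal.ofReal (√(X.metricMatrix e a).det))
      ((volume : Measure (Euc n)).restrict e.target) :=
    ((continuousOn_det_metricMatrix he).sqrt.aemeasurable
      e.open_target.measurableSet).ennreal_ofReal
  rw [ae_withDensity_iff' hm, ae_restrict_iff' e.open_target.measurableSet] at h2
  filter_upwards [h2] with a ha hat
  exact ha hat (by simpa using (posDef_metricMatrix he hat).det_pos)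

theorem ae_regVolume_of_ae_chart [SecondCountableTopology M] {p : X.reg → Prop}
    (hp : ∀ e ∈ atlas (Euc n) X.reg, ∀ᵐ a, a ∈ e.target → p (e.symm a)) :
    ∀ᵐ x ∂X.regVolume, p x := by
  refine measure_null_of_locally_null _ fun x _ => ?_
  set e := chartAt (Euc n) x
  have he : e ∈ atlas (Euc n) X.reg := chart_mem_atlas _ x
  have hx : x ∈ e.source := mem_chart_source _ x
  refine ⟨e.source ∩ {x | ¬ p x}, ?_, ?_⟩
  · exact inter_mem (mem_nhdsWithin_of_mem_nhds (e.open_source.mem_nhds hx)) self_mem_nhdsWithin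
  set Z : Set (Euc n) := {a | ¬ (a ∈ e.target → p (e.symm a))} with hZ
  have hZ0 : volume Z = 0 := hp e he
  set B := e.source ∩ e ⁻¹' toMeasurable volume Z
  have hB : MeasurableSet B :=
    measurableSet_source_inter_preimage e (measurableSet_toMeasurable _ _)
  have hsub : e.source ∩ {x | ¬ p x} ⊆ B := by
    rintro y ⟨hy, hpy⟩
    refine ⟨hy, subset_toMeasurable _ _ fun h => hpy ?_⟩
    have := h (e.map_source hy)
    rwa [e.left_inv hy] at this
  refine measure_mono_null hsub (le_antisymm ?_ zero_le)
  have h1 : X.regVolume B ≤ X.chartVolume e B := by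
    have := regVolume_restrict_le he B
    rwa [Measure.restrict_apply hB, inter_eq_left.2 inter_subset_left] at this
  refine h1.trans (le_of_eq ?_)
  rw [chartVolume_apply e hB]
  refine setLIntegral_measure_zero _ _ (measure_mono_null ?_ ((measure_toMeasurable _).trans hZ0))
  rintro a ⟨ha, -, haB⟩
  rwa [mem_preimage, e.right_inv ha] at haB

end Volume

end CMGA

theorem HasWeakDerivOn.congr_ae {n : ℕ} {Ω : Set (Euc n)} {v : Euc n} {u u' a a' : Euc n → ℂ}
    (h : HasWeakDerivOn Ω v u a) (hΩ : IsOpen Ω) (hu : ∀ᵐ x, x ∈ Ω → u' x = u x)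
    (ha : ∀ᵐ x, x ∈ Ω → a' x = a x) : HasWeakDerivOn Ω v u' a' := by
  have aux : ∀ {w w' : Euc n → ℂ}, LocallyIntegrableOn w Ω → (∀ᵐ x, x ∈ Ω → w' x = w x) →
      LocallyIntegrableOn w' Ω := by
    intro w w' hw hww'
    rw [locallyIntegrableOn_iff hΩ.isLocallyClosed] at hw ⊢
    intro k hkΩ hk
    refine (hw k hkΩ hk).congr_fun_ae ?_
    rw [EventuallyEq, ae_restrict_iff' hk.measurableSet]
    filter_upwards [hww'] with x hx hxk using (hx (hkΩ hxk)).symm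
  refine ⟨aux h.left hu, aux h.right ha, fun ψ hψ hc hs => ?_⟩
  have e1 : ∫ x, (fderiv ℝ ψ x v) • u' x = ∫ x, (fderiv ℝ ψ x v) • u x := by
    refine integral_congr_ae ?_
    filter_upwards [hu] with x hx
    by_cases hxΩ : x ∈ Ω
    · simp only [hx hxΩ]
    · have : fderiv ℝ ψ x = 0 := by
        by_contra h0
        exact hxΩ (hs (support_fderiv_subset ℝ h0))
      simp [this]
  have e2 : ∫ x, ψ x • a' x = ∫ x, ψ x • a x := by
    refine integral_congr_ae ?_
    filter_upwards [ha] with x hx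
    by_cases hxΩ : x ∈ Ω
    · simp only [hx hxΩ]
    · simp [image_eq_zero_of_notMem_tsupport fun h0 => hxΩ (hs h0)]
  rw [e1, e2]
  exact h.integral_eq ψ hψ hc hs

theorem hasWeakDerivOn_one {n : ℕ} (Ω : Set (Euc n)) (v : Euc n) :
    HasWeakDerivOn Ω v (fun _ => 1) (fun _ => 0) := by
  refine ⟨(locallyIntegrable_const _).locallyIntegrableOn _,
    (locallyIntegrable_const _).locallyIntegrableOn _, fun ψ hψ hc _ => ?_⟩
  have h1 : Integrable fun x => fderiv ℝ ψ x v :=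
    ((hψ.continuous_fderiv (by simp)).clm_apply continuous_const).integrable_of_hasCompactSupport
      (hc.fderiv_apply ℝ v)
  have h2 : ∫ x, fderiv ℝ ψ x v = 0 := by
    have := integral_mul_fderiv_eq_neg_fderiv_mul_of_integrable (μ := volume)
      (f := fun _ : Euc n => (1 : ℝ)) (g := ψ) (v := v) (by simp) (by simpa using h1)
      (by simpa using hψ.continuous.integrable_of_hasCompactSupport hc) (by fun_prop)
      (fun x _ => hψ.differentiable (by simp) x)
    simpa using this
  simp only [smul_zero, integral_zero, neg_zero]
  rw [integral_smul_const, h2, zero_smul]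

namespace CMGA

variable {n : ℕ} {M : Type*} [TopologicalSpace M] {X : CMGA n M}

/-! ### Weights -/

variable (X) in
/-- `φ` is locally Lipschitz in the charts of the regular part. -/
def IsLocLip (φ : M → ℝ) : Prop :=
  ∀ e ∈ atlas (Euc n) X.reg, LocallyLipschitzOn e.target fun a => φ (e.symm a : X.reg)

variable (X) in
/-- The differential of `φ` at a regular point; it is zero where `φ` is not differentiable. -/
noncomputable def diff (φ : M → ℝ) (x : X.reg) : TangentSpace 𝓘(ℝ, Euc n) x →L[ℝ] ℝ :=
  mfderiv 𝓘(ℝ, Euc n) 𝓘(ℝ, ℝ) (fun y : X.reg => φ y) x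

theorem mdifferentiableAt_of_chart {e : OpenPartialHomeomorph X.reg (Euc n)}
    (he : e ∈ atlas (Euc n) X.reg) {x : X.reg} (hx : x ∈ e.source) {φ : M → ℝ}
    (h : DifferentiableAt ℝ (fun b => φ (e.symm b : X.reg)) (e x)) :
    MDifferentiableAt 𝓘(ℝ, Euc n) 𝓘(ℝ, ℝ) (fun y : X.reg => φ y) x := by
  have h1 := h.mdifferentiableAt.comp x ((mdifferentiable_chart he).mdifferentiableAt hx)
  refine h1.congr_of_eventuallyEq ?_
  filter_upwards [e.open_source.mem_nhds hx] with y hy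
  simp [e.left_inv hy]

theorem diff_chart_symm {e : OpenPartialHomeomorph X.reg (Euc n)}
    (he : e ∈ atlas (Euc n) X.reg) {a : Euc n} (ha : a ∈ e.target) {φ : M → ℝ}
    (h : DifferentiableAt ℝ (fun b => φ (e.symm b : X.reg)) a) (v : Euc n) :
    X.diff φ (e.symm a) (mfderiv 𝓘(ℝ, Euc n) 𝓘(ℝ, Euc n) e.symm a v) =
      fderiv ℝ (fun b => φ (e.symm b : X.reg)) a v := by
  have h1 : MDifferentiableAt 𝓘(ℝ, Euc n) 𝓘(ℝ, ℝ) (fun y : X.reg => φ y) (e.symm a) :=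
    mdifferentiableAt_of_chart he (e.map_target ha) (by rwa [e.right_inv ha])
  have h2 := mfderiv_comp a h1 (mdifferentiableAt_chart_symm he ha)
  have h3 : mfderiv 𝓘(ℝ, Euc n) 𝓘(ℝ, ℝ) ((fun y : X.reg => φ y) ∘ e.symm) a =
    fderiv ℝ (fun b => φ (e.symm b : X.reg)) a := mfderiv_eq_fderiv
  exact congrArg (fun A : Euc n →L[ℝ] ℝ => A v) (h2.symm.trans h3)

theorem IsLocLip.continuous {φ : M → ℝ} (h : X.IsLocLip φ) : Continuous fun y : X.reg => φ y := by
  refine continuous_iff_continuousAt.2 fun x => ?_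
  set e := chartAt (Euc n) x
  have he : e ∈ atlas (Euc n) X.reg := chart_mem_atlas _ x
  have hx : x ∈ e.source := mem_chart_source _ x
  have h1 : ContinuousAt (fun a => φ (e.symm a : X.reg)) (e x) :=
    (h e he).continuousOn.continuousAt (e.open_target.mem_nhds (e.map_source hx))
  have h2 : ContinuousAt (fun y => φ (e.symm (e y) : X.reg)) x := by
    exact ContinuousAt.comp (g := fun a => φ (e.symm a : X.reg)) h1 (e.continuousAt hx)
  refine h2.congr ?_
  filter_upwards [e.open_source.mem_nhds hx] with y hy
  rw [e.left_inv hy]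

theorem isWeakDifferential_iff {u : M → ℂ} {α : X.CovectorField} : X.IsWeakDifferential u α ↔
    ∀ e ∈ atlas (Euc n) X.reg, LocallyIntegrableOn (fun a => u (e.symm a : X.reg)) e.target ∧
      ∀ i, HasWeakDerivOn e.target (stdVec n i)
      (fun a => u (e.symm a : X.reg)) (fun a => α (e.symm a) (X.coordVec e a i)) := by
  constructor
  · exact fun h e he => ⟨(h e he).1, fun i => ⟨(h e he).1, ((h e he).2 i).1, ((h e he).2 i).2⟩⟩
  · exact fun h e he => ⟨(h e he).1, fun i => ⟨((h e he).2 i).right, ((h e he).2 i).integral_eq⟩⟩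

variable (X) in
/-- The differential of `φ u`, where `α` is the differential of `u`. -/
noncomputable def leibniz (φ : M → ℝ) (u : M → ℂ) (α : X.CovectorField) : X.CovectorField :=
  fun x => φ x • α x + (X.diff φ x).smulRight (u x)

section Measure

variable [MeasurableSpace M]

theorem exists_L2_eq_smul {φ : M → ℝ} (hφ : AEStronglyMeasurable φ X.vol) {B : ℝ}
    (hB : ∀ x, |φ x| ≤ B) (u : X.L2) : ∃ v : X.L2, ∀ᵐ x ∂X.vol, v x = φ x • u x := by
  have h : MemLp (fun x => φ x • u x) 2 X.vol := by
    refine (Lp.memLp u).of_le_mul (c := B) (hφ.smul (Lp.aestronglyMeasurable u)) ?_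
    filter_upwards with x
    rw [norm_smul]
    gcongr
    exact hB x
  exact ⟨h.toLp _, h.coeFn_toLp⟩

variable [BorelSpace M]

theorem measurableEmbedding_coe_reg : MeasurableEmbedding (Subtype.val : X.reg → M) :=
  MeasurableEmbedding.subtype_coe X.reg.isOpen.measurableSet

theorem ae_reg_of_ae_vol {p : M → Prop} (h : ∀ᵐ x ∂X.vol, p x) : ∀ᵐ x : X.reg ∂X.regVolume, p x :=
  ae_of_ae_map measurableEmbedding_coe_reg.measurable.aemeasurable h

theorem ae_vol_iff {p : M → Prop} : (∀ᵐ x ∂X.vol, p x) ↔ ∀ᵐ x : X.reg ∂X.regVolume, p x :=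
  measurableEmbedding_coe_reg.ae_map_iff

theorem IsWeakDifferential.leibniz {u v : M → ℂ} {α : X.CovectorField}
    (h : X.IsWeakDifferential u α) {φ : M → ℝ} (hφ : X.IsLocLip φ)
    (hv : ∀ᵐ x ∂X.vol, v x = φ x • u x) : X.IsWeakDifferential v (X.leibniz φ u α) := by
  rw [isWeakDifferential_iff] at h ⊢
  intro e he
  have hv' := ae_chart_of_ae_regVolume he (ae_reg_of_ae_vol hv)
  have h1 : ∀ i, HasWeakDerivOn e.target (stdVec n i)
      (fun a => v (e.symm a : X.reg)) (fun a => X.leibniz φ u α (e.symm a) (X.coordVec e a i)) := by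
    intro i
    refine (((h e he).2 i).smul e.open_target (hφ e he)).congr_ae e.open_target hv' ?_
    filter_upwards [(hφ e he).ae_differentiableAt e.open_target] with a ha hat
    have := diff_chart_symm he hat (ha hat) (stdVec n i)
    rw [← this]
    rfl
  refine ⟨?_, h1⟩
  -- for `n = 0` local integrability is not contained in `h1`
  have h2 := (h e he).1
  rw [locallyIntegrableOn_iff e.open_target.isLocallyClosed] at h2 ⊢
  intro k hkΩ hk
  have h3 := (h2 k hkΩ hk).continuousOn_smul ((hφ e he).continuousOn.mono hkΩ) hk
  refine h3.congr_fun_ae ?_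
  rw [EventuallyEq, ae_restrict_iff' hk.measurableSet]
  filter_upwards [hv'] with x hx hxk using (hx (hkΩ hxk)).symm

theorem lintegral_vol (f : M → ℝ≥0∞) : ∫⁻ x, f x ∂X.vol = ∫⁻ x : X.reg, f x ∂X.regVolume :=
  measurableEmbedding_coe_reg.lintegral_map _

theorem lintegral_norm_sq_lt_top (u : X.L2) :
    ∫⁻ x : X.reg, ENNReal.ofReal (‖u x‖ ^ 2) ∂X.regVolume < ⊤ := by
  have h := (Lp.memLp u).integrable_norm_pow (by norm_num)
  rw [← lintegral_vol (X := X) fun x => ENNReal.ofReal (‖u x‖ ^ 2)]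
  exact h.lintegral_lt_top

/-- `H¹(M)` is stable under multiplication by bounded Lipschitz functions. -/
theorem IsH1.leibniz {u v : X.L2} {α : X.CovectorField} (h : X.IsH1 u α) {φ : M → ℝ}
    (hφ : X.IsLocLip φ) {B c : ℝ} (hB : ∀ x, |φ x| ≤ B)
    (hc : ∀ x v, |X.diff φ x v| ≤ c * √(X.normSq x v))
    (hv : ∀ᵐ x ∂X.vol, v x = φ x • u x) : X.IsH1 v (X.leibniz φ u α) := by
  refine ⟨h.1.leibniz hφ hv, ?_⟩
  have h1 : ∀ x : X.reg, ENNReal.ofReal (X.cometric x (X.leibniz φ u α x) (X.leibniz φ u α x)).re ≤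
      ENNReal.ofReal (2 * B ^ 2) * ENNReal.ofReal (X.cometric x (α x) (α x)).re +
      ENNReal.ofReal (2 * c ^ 2) * ENNReal.ofReal (‖u x‖ ^ 2) := by
    intro x
    rw [← ENNReal.ofReal_mul (by positivity), ← ENNReal.ofReal_mul (by positivity),
      ← ENNReal.ofReal_add (mul_nonneg (by positivity) (cometric_self_nonneg _ _)) (by positivity)]
    refine ENNReal.ofReal_le_ofReal ((cometric_leibniz_le (hc x) (α x) (u x)).trans ?_)
    have h2 := cometric_self_nonneg x (α x)
    have h3 : φ x ^ 2 ≤ B ^ 2 := by rw [← sq_abs]; gcongr; exact hB x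
    nlinarith
  refine (lintegral_mono h1).trans_lt ?_
  have hm : AEMeasurable (fun x : X.reg =>
      ENNReal.ofReal (2 * c ^ 2) * ENNReal.ofReal (‖u x‖ ^ 2)) X.regVolume := by
    have h4 : AEStronglyMeasurable (fun x : X.reg => u x) X.regVolume :=
      (measurableEmbedding_coe_reg.aestronglyMeasurable_map_iff).1 (Lp.aestronglyMeasurable u)
    exact ((h4.norm.pow 2).aemeasurable.ennreal_ofReal).const_mul _
  rw [lintegral_add_right' _ hm, lintegral_const_mul' _ _ ENNReal.ofReal_ne_top,
    lintegral_const_mul' _ _ ENNReal.ofReal_ne_top]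
  exact ENNReal.add_lt_top.2 ⟨ENNReal.mul_lt_top ENNReal.ofReal_lt_top h.2,
    ENNReal.mul_lt_top ENNReal.ofReal_lt_top (lintegral_norm_sq_lt_top u)⟩

theorem IsLocLip.aestronglyMeasurable {φ : M → ℝ} (hφ : X.IsLocLip φ) :
    AEStronglyMeasurable φ X.vol :=
  measurableEmbedding_coe_reg.aestronglyMeasurable_map_iff.2 hφ.continuous.aestronglyMeasurable

end Measure

/-! ### The resolvent of the Laplacian -/

section Resolvent

variable [MeasurableSpace M]

variable (X) in
/-- `R = (A + 1)⁻¹`, for `A = -Δ_g`; only `(A + 1) R = 1` is required, the rest follows. -/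
def IsResolvent (R : X.L2 →L[ℂ] X.L2) : Prop := ∀ h, X.IsNegLaplacian (R h) (h - R h)

/-- Any two resolvents are adjoint to each other, by the symmetry of the form `Q`. -/
theorem IsResolvent.inner_eq {R R' : X.L2 →L[ℂ] X.L2} (hR : X.IsResolvent R)
    (hR' : X.IsResolvent R') (k h : X.L2) : inner ℂ k (R h) = inner ℂ (R' k) h := by
  obtain ⟨α, hα, hα'⟩ := hR h
  obtain ⟨β, hβ, hβ'⟩ := hR' k
  have h1 := hα' _ β hβ
  have h2 := hβ' _ α hα
  have h3 : (starRingEnd ℂ) (∫ x, X.cometric x (β x) (α x) ∂X.regVolume) =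
      ∫ x, X.cometric x (α x) (β x) ∂X.regVolume := by
    rw [← integral_conj]
    simp only [conj_cometric]
  rw [h2, h1, inner_conj_symm, inner_sub_left, inner_sub_right] at h3
  linear_combination h3

theorem IsResolvent.eq {R R' : X.L2 →L[ℂ] X.L2} (hR : X.IsResolvent R)
    (hR' : X.IsResolvent R') : R = R' := by
  ext1 k
  refine ext_inner_right ℂ fun h => ?_
  rw [← hR.inner_eq hR, hR.inner_eq hR']

theorem IsResolvent.isSelfAdjoint {R : X.L2 →L[ℂ] X.L2} (hR : X.IsResolvent R) :
    IsSelfAdjoint R := by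
  rw [ContinuousLinearMap.isSelfAdjoint_iff_isSymmetric]
  exact fun k h => (hR.inner_eq hR k h).symm

/-- The form `Q` is nonnegative. -/
theorem IsResolvent.norm_sq_le {R : X.L2 →L[ℂ] X.L2} (hR : X.IsResolvent R) (h : X.L2) :
    ‖R h‖ ^ 2 ≤ (inner ℂ (R h) h).re := by
  obtain ⟨α, hα, hα'⟩ := hR h
  have h1 := hα' _ α hα
  have h2 : 0 ≤ (∫ x, X.cometric x (α x) (α x) ∂X.regVolume).re := by
    by_cases hi : Integrable (fun x => X.cometric x (α x) (α x)) X.regVolume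
    · have := integral_re hi
      simp only [RCLike.re_eq_complex_re] at this
      rw [← this]
      exact integral_nonneg fun x => cometric_self_nonneg x _
    · rw [integral_undef hi]; simp
  rw [h1, inner_sub_right, Complex.sub_re] at h2
  have h3 : (inner ℂ (R h) (R h)).re = ‖R h‖ ^ 2 := inner_self_eq_norm_sq (𝕜 := ℂ) (R h)
  linarith

end Resolvent

/-! ### The metric and differentials in charts -/

section Comparison

/-- A bound that holds on the unit sphere holds, up to the factor `‖v‖ ^ 2`, for quadratic functions
of `v`, locally uniformly in a parameter. -/
theorem _root_.eventually_forall_lt_mul_norm_sq {P E : Type*} [TopologicalSpace P]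
    [NormedAddCommGroup E] [NormedSpace ℝ E] [ProperSpace E] {Q : P → E → ℝ}
    (hQ : ∀ p (c : ℝ) v, Q p (c • v) = c ^ 2 * Q p v) {p₀ : P} {B : ℝ}
    (hc : ∀ v, ‖v‖ = 1 → ContinuousAt (fun q : P × E => Q q.1 q.2) (p₀, v))
    (hB : ∀ v, ‖v‖ = 1 → Q p₀ v < B) : ∀ᶠ p in 𝓝 p₀, ∀ v, Q p v ≤ B * ‖v‖ ^ 2 := by
  have h1 : ∀ᶠ p in 𝓝 p₀, ∀ v ∈ Metric.sphere (0 : E) 1, Q p v < B := by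
    refine (isCompact_sphere (0 : E) 1).eventually_forall_of_forall_eventually fun v hv => ?_
    rw [mem_sphere_zero_iff_norm] at hv
    exact (hc v hv).eventually (gt_mem_nhds (hB v hv))
  filter_upwards [h1] with p hp v
  rcases eq_or_ne v 0 with rfl | hv
  · have := hQ p 0 0
    simp only [smul_zero, ne_eq, OfNat.ofNat_ne_zero, not_false_eq_true, zero_pow, zero_mul] at this
    simp [this]
  · have hv' : ‖v‖ ≠ 0 := norm_ne_zero_iff.2 hv
    have h3 := hp (‖v‖⁻¹ • v) (by simp [norm_smul, hv'])
    have h4 : Q p v = ‖v‖ ^ 2 * Q p (‖v‖⁻¹ • v) := by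
      rw [hQ]; field_simp
    rw [h4]
    nlinarith [norm_nonneg v, sq_nonneg ‖v‖]

variable {e : OpenPartialHomeomorph X.reg (Euc n)}

theorem continuousAt_normSq_chart_symm (he : e ∈ atlas (Euc n) X.reg) {a : Euc n}
    (ha : a ∈ e.target) (v : Euc n) : ContinuousAt (fun q : Euc n × Euc n =>
      X.normSq (e.symm q.1) (mfderiv 𝓘(ℝ, Euc n) 𝓘(ℝ, Euc n) e.symm q.1 q.2)) (a, v) := by
  have h := continuousOn_metric_comp e.open_target ((contMDiffOn_chart_symm he).of_le (by simp))
  have h2 : ContinuousAt _ (a, v, v) :=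
    h.continuousAt ((e.open_target.prod isOpen_univ).mem_nhds ⟨ha, mem_univ _⟩)
  exact ContinuousAt.comp (f := fun q : Euc n × Euc n => (q.1, q.2, q.2)) (x := (a, v)) h2
    (by fun_prop)

theorem normSq_smul (x : X.reg) (c : ℝ) (v : TangentSpace 𝓘(ℝ, Euc n) x) :
    X.normSq x (c • v) = c ^ 2 * X.normSq x v := by
  simp only [normSq, map_smul, smul_apply, smul_eq_mul]
  ring

theorem normSq_chart_symm_smul (a : Euc n) (c : ℝ) (v : Euc n) :
    X.normSq (e.symm a) (mfderiv 𝓘(ℝ, Euc n) 𝓘(ℝ, Euc n) e.symm a (c • v)) =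
      c ^ 2 * X.normSq (e.symm a) (mfderiv 𝓘(ℝ, Euc n) 𝓘(ℝ, Euc n) e.symm a v) := by
  exact (congrArg (fun u : Euc n => X.normSq (e.symm a) u) (map_smul _ c v)).trans
    (normSq_smul _ _ _)

theorem exists_eventually_normSq_le (he : e ∈ atlas (Euc n) X.reg) {a : Euc n}
    (ha : a ∈ e.target) : ∃ C > 0, ∀ᶠ b in 𝓝 a, ∀ v : Euc n,
      X.normSq (e.symm b) (mfderiv 𝓘(ℝ, Euc n) 𝓘(ℝ, Euc n) e.symm b v) ≤ C * ‖v‖ ^ 2 := by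
  have h1 : ContinuousOn (fun v : Euc n => X.normSq (e.symm a)
      (mfderiv 𝓘(ℝ, Euc n) 𝓘(ℝ, Euc n) e.symm a v)) (Metric.sphere 0 1) := fun v _ =>
    (ContinuousAt.comp (f := fun v : Euc n => (a, v)) (x := v)
      (continuousAt_normSq_chart_symm he ha v) (by fun_prop)).continuousWithinAt
  obtain ⟨C, hC⟩ := (isCompact_sphere (0 : Euc n) 1).exists_bound_of_continuousOn h1
  refine ⟨|C| + 1, by positivity, eventually_forall_lt_mul_norm_sq normSq_chart_symm_smul
    (fun v _ => continuousAt_normSq_chart_symm he ha v) fun v hv => ?_⟩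
  have := hC v (by simpa using hv)
  rw [Real.norm_eq_abs] at this
  linarith [le_abs_self C, (abs_le.1 this).2]

theorem exists_eventually_norm_sq_le (he : e ∈ atlas (Euc n) X.reg) {a : Euc n}
    (ha : a ∈ e.target) : ∃ C > 0, ∀ᶠ b in 𝓝 a, ∀ v : Euc n,
      ‖v‖ ^ 2 ≤ C * X.normSq (e.symm b) (mfderiv 𝓘(ℝ, Euc n) 𝓘(ℝ, Euc n) e.symm b v) := by
  have h1 : ContinuousOn (fun v : Euc n => X.normSq (e.symm a)
      (mfderiv 𝓘(ℝ, Euc n) 𝓘(ℝ, Euc n) e.symm a v)) (Metric.sphere 0 1) := fun v _ =>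
    (ContinuousAt.comp (f := fun v : Euc n => (a, v)) (x := v)
      (continuousAt_normSq_chart_symm he ha v) (by fun_prop)).continuousWithinAt
  have hpos : ∀ v : Euc n, ‖v‖ = 1 → 0 < X.normSq (e.symm a)
      (mfderiv 𝓘(ℝ, Euc n) 𝓘(ℝ, Euc n) e.symm a v) := by
    intro v hv
    refine X.metric.pos _ _ fun h0 => ?_
    have h1 := mfderiv_chart_mfderiv_chart_symm he ha v
    rw [h0] at h1
    have h2 : v = 0 := h1.symm.trans (map_zero _)
    simp [h2] at hv
  obtain ⟨m, hm, hm'⟩ : ∃ m > 0, ∀ v : Euc n, ‖v‖ = 1 → m < X.normSq (e.symm a)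
      (mfderiv 𝓘(ℝ, Euc n) 𝓘(ℝ, Euc n) e.symm a v) := by
    -- for `n = 0` the unit sphere is empty
    rcases (Metric.sphere (0 : Euc n) 1).eq_empty_or_nonempty with hemp | hne
    · refine ⟨1, one_pos, fun v hv => ?_⟩
      have : v ∈ Metric.sphere (0 : Euc n) 1 := by simpa using hv
      rw [hemp] at this
      exact this.elim
    · obtain ⟨w, hw, hmin⟩ := (isCompact_sphere (0 : Euc n) 1).exists_isMinOn hne h1
      have hw' := hpos w (by simpa using hw)
      refine ⟨_, half_pos hw', fun v hv => ?_⟩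
      have := hmin (show v ∈ Metric.sphere (0 : Euc n) 1 by simpa using hv)
      rw [mem_ofPred_eq] at this
      linarith
  have h2 := eventually_forall_lt_mul_norm_sq (B := -m)
    (Q := fun b (v : Euc n) => -X.normSq (e.symm b) (mfderiv 𝓘(ℝ, Euc n) 𝓘(ℝ, Euc n) e.symm b v))
    (fun p c v => by simp only [normSq_chart_symm_smul]; ring)
    (fun v _ => (continuousAt_normSq_chart_symm he ha v).neg) (fun v hv => neg_lt_neg (hm' v hv))
  refine ⟨m⁻¹, inv_pos.2 hm, ?_⟩
  filter_upwards [h2] with b hb v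
  have := hb v
  rw [inv_mul_eq_div, le_div_iff₀ hm]
  linarith

/-- The differential of a `C¹` function is locally bounded. -/
theorem exists_eventually_abs_diff_le {φ : M → ℝ}
    (hφ : ContMDiff 𝓘(ℝ, Euc n) 𝓘(ℝ, ℝ) 1 fun y : X.reg => φ y) (x : X.reg) :
    ∃ C, ∀ᶠ y in 𝓝 x, ∀ v, |X.diff φ y v| ≤ C * √(X.normSq y v) := by
  set e := chartAt (Euc n) x
  have he : e ∈ atlas (Euc n) X.reg := chart_mem_atlas _ x
  have hx : x ∈ e.source := mem_chart_source _ x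
  set f : Euc n → ℝ := fun b => φ (e.symm b : X.reg)
  have hf : ContDiffOn ℝ 1 f e.target := by
    rw [← contMDiffOn_iff_contDiffOn]
    exact hφ.comp_contMDiffOn ((contMDiffOn_chart_symm he).of_le (by simp))
  have hd : ContinuousAt (fderiv ℝ f) (e x) :=
    (hf.continuousOn_fderiv_of_isOpen e.open_target le_rfl).continuousAt
      (e.open_target.mem_nhds (e.map_source hx))
  obtain ⟨C, hC, hC'⟩ := exists_eventually_norm_sq_le he (e.map_source hx)
  have h1 : ∀ᶠ b in 𝓝 (e x), ‖fderiv ℝ f b‖ < ‖fderiv ℝ f (e x)‖ + 1 :=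
    hd.norm.eventually (gt_mem_nhds (by linarith))
  refine ⟨(‖fderiv ℝ f (e x)‖ + 1) * √C, ?_⟩
  filter_upwards [e.open_source.mem_nhds hx, (e.continuousAt hx).eventually hC',
    (e.continuousAt hx).eventually h1] with y hy h2 h3 v
  have hdf : DifferentiableAt ℝ f (e y) := (hf.differentiableOn (by simp)).differentiableAt
    (e.open_target.mem_nhds (e.map_source hy))
  set w : Euc n := mfderiv 𝓘(ℝ, Euc n) 𝓘(ℝ, Euc n) e y v
  -- stated for all `z = y`, so that the tangent space can be transported from `y` to `e.symm (e y)`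
  have key : ∀ z : X.reg, z = y →
      |X.diff φ z v| ≤ (‖fderiv ℝ f (e x)‖ + 1) * √C * √(X.normSq z v) := by
    intro z hz
    have h4 : z = e.symm (e y) := by rw [hz, e.left_inv hy]
    subst h4
    have h5 := diff_chart_symm he (e.map_source hy) hdf w
    have h6 := h2 w
    have h7 := mfderiv_chart_symm_mfderiv_chart he hy v
    have h8 : X.diff φ (e.symm (e y)) v = fderiv ℝ f (e y) w := by
      rw [← h5]
      exact congrArg (fun u : Euc n => (X.diff φ (e.symm (e y)) : Euc n →L[ℝ] ℝ) u) h7.symm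
    have h9 : X.normSq (e.symm (e y)) v = X.normSq (e.symm (e y))
        (mfderiv 𝓘(ℝ, Euc n) 𝓘(ℝ, Euc n) e.symm (e y) w) :=
      congrArg (fun u : Euc n => X.normSq (e.symm (e y)) u) h7.symm
    rw [h8, h9, mul_assoc, ← Real.sqrt_mul hC.le]
    refine ((fderiv ℝ f (e y)).le_opNorm w).trans ?_
    gcongr
    exact Real.le_sqrt_of_sq_le h6
  exact key y rfl

theorem diff_eq_zero_of_notMem_tsupport {φ : M → ℝ} {x : X.reg}
    (hx : x ∉ tsupport fun y : X.reg => φ y) (v : TangentSpace 𝓘(ℝ, Euc n) x) :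
    X.diff φ x v = 0 := by
  have h1 : (fun y : X.reg => φ y) =ᶠ[𝓝 x] fun _ => 0 := by
    rwa [notMem_tsupport_iff_eventuallyEq] at hx
  have h2 := h1.mfderiv_eq (I := 𝓘(ℝ, Euc n)) (I' := 𝓘(ℝ, ℝ))
  have h3 : mfderiv 𝓘(ℝ, Euc n) 𝓘(ℝ, ℝ) (fun _ : X.reg => (0 : ℝ)) x = 0 := mfderiv_const
  exact congrArg (fun A : Euc n →L[ℝ] ℝ => A v) (h2.trans h3)

theorem exists_abs_diff_le_of_hasCompactSupport {φ : M → ℝ}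
    (hφ : ContMDiff 𝓘(ℝ, Euc n) 𝓘(ℝ, ℝ) 1 fun y : X.reg => φ y)
    (hc : HasCompactSupport fun y : X.reg => φ y) :
    ∃ C, ∀ x v, |X.diff φ x v| ≤ C * √(X.normSq x v) := by
  obtain ⟨C, hC⟩ : ∃ C, ∀ x ∈ tsupport (fun y : X.reg => φ y), ∀ v,
      |X.diff φ x v| ≤ C * √(X.normSq x v) := by
    refine hc.isCompact.induction_on
      (p := fun s => ∃ C, ∀ x ∈ s, ∀ v, |X.diff φ x v| ≤ C * √(X.normSq x v)) ⟨0, by simp⟩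
      (fun s t hst ⟨C, hC⟩ => ⟨C, fun x hx => hC x (hst hx)⟩)
      (fun s t ⟨C, hC⟩ ⟨D, hD⟩ => ⟨max C D, fun x hx v => hx.elim
        (fun h => (hC x h v).trans (by gcongr; exact le_max_left _ _))
        fun h => (hD x h v).trans (by gcongr; exact le_max_right _ _)⟩) ?_
    intro x hx
    obtain ⟨C, hC⟩ := exists_eventually_abs_diff_le hφ x
    exact ⟨_, mem_nhdsWithin_of_mem_nhds hC, C, fun y hy => hy⟩
  refine ⟨max C 0, fun x v => ?_⟩
  by_cases hx : x ∈ tsupport fun y : X.reg => φ y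
  · exact (hC x hx v).trans (by gcongr; exact le_max_left _ _)
  · rw [diff_eq_zero_of_notMem_tsupport hx, abs_zero]
    positivity

theorem isLocLip_of_contMDiff {φ : M → ℝ}
    (hφ : ContMDiff 𝓘(ℝ, Euc n) 𝓘(ℝ, ℝ) 1 fun y : X.reg => φ y) : X.IsLocLip φ := by
  intro e he
  have hf : ContDiffOn ℝ 1 (fun b => φ (e.symm b : X.reg)) e.target := by
    rw [← contMDiffOn_iff_contDiffOn]
    exact hφ.comp_contMDiffOn ((contMDiffOn_chart_symm he).of_le (by simp))
  intro a ha
  obtain ⟨K, t, ht, hK⟩ := (hf.contDiffAt (e.open_target.mem_nhds ha)).exists_lipschitzOnWith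
  exact ⟨K, t, mem_nhdsWithin_of_mem_nhds ht, hK⟩

end Comparison

/-! ### Density of the domain of the Laplacian -/

section Injective

theorem isWeakDifferential_one : X.IsWeakDifferential (fun _ => 1) fun _ => 0 :=
  isWeakDifferential_iff.2 fun e _ =>
    ⟨(hasWeakDerivOn_one e.target 0).left, fun i => hasWeakDerivOn_one e.target (stdVec n i)⟩

variable [MeasurableSpace M]

theorem inner_congr_ae {u v u' v' : X.L2} (h : ∀ᵐ x ∂X.vol,
    (starRingEnd ℂ) (u x) * v x = (starRingEnd ℂ) (u' x) * v' x) :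
    (inner ℂ u v : ℂ) = inner ℂ u' v' := by
  rw [L2.inner_def, L2.inner_def]
  refine integral_congr_ae ?_
  filter_upwards [h] with x hx
  rw [RCLike.inner_apply, RCLike.inner_apply, mul_comm, hx, mul_comm]

variable [BorelSpace M]

theorem inner_eq_integral_reg (u v : X.L2) :
    (inner ℂ u v : ℂ) = ∫ x : X.reg, (starRingEnd ℂ) (u x) * v x ∂X.regVolume := by
  rw [L2.inner_def]
  refine (measurableEmbedding_coe_reg.integral_map _).trans ?_
  simp only [RCLike.inner_apply, mul_comm]

theorem norm_sq_eq_integral_reg (u : X.L2) :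
    ‖u‖ ^ 2 = ∫ x : X.reg, ‖u x‖ ^ 2 ∂X.regVolume := by
  have h1 := inner_eq_integral_reg u u
  have h2 : ∀ x : X.reg, (starRingEnd ℂ) (u x) * u x = ((‖u x‖ ^ 2 : ℝ) : ℂ) := fun x => by
    rw [← Complex.normSq_eq_norm_sq, Complex.normSq_eq_conj_mul_self]
  simp only [h2] at h1
  rw [inner_self_eq_norm_sq_to_K] at h1
  have h3 : ((‖u‖ ^ 2 : ℝ) : ℂ) = ∫ x : X.reg, ((‖u x‖ ^ 2 : ℝ) : ℂ) ∂X.regVolume := by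
    rw [← h1]; norm_cast
  rw [integral_complex_ofReal] at h3
  exact_mod_cast h3

/-- Smooth compactly supported functions on the regular part are in `H¹`. -/
theorem exists_isH1_of_contMDiff {f : X.reg → ℝ} (hf : ContMDiff 𝓘(ℝ, Euc n) 𝓘(ℝ, ℝ) ∞ f)
    (hc : HasCompactSupport f) : ∃ (v : X.L2) (β : X.CovectorField), X.IsH1 v β ∧
      ∀ᵐ x : X.reg ∂X.regVolume, v x = f x := by
  -- the extension of `f` by zero, the product of itself and the constant function `1`
  set φ : M → ℝ := Function.extend Subtype.val f 0
  have hφ : (fun y : X.reg => φ y) = f := funext fun y => Subtype.val_injective.extend_apply f 0 y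
  have hm : MemLp (fun x => (φ x : ℂ)) 2 X.vol := by
    rw [vol, measurableEmbedding_coe_reg.memLp_map_measure_iff]
    have h1 : MemLp (fun x => (f x : ℂ)) 2 X.regVolume := by
      refine Continuous.memLp_of_hasCompactSupport (Complex.continuous_ofReal.comp hf.continuous) ?_
      exact hc.comp_left (g := ((↑) : ℝ → ℂ)) (by simp)
    rw [← hφ] at h1
    exact h1
  have hv : ∀ᵐ x ∂X.vol, hm.toLp _ x = φ x • (1 : ℂ) := by
    filter_upwards [hm.coeFn_toLp] with x hx
    rw [hx]; simp
  rw [← hφ] at hf hc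
  have hf1 : ContMDiff 𝓘(ℝ, Euc n) 𝓘(ℝ, ℝ) 1 fun y : X.reg => φ y := hf.of_le (by simp)
  obtain ⟨C, hC⟩ := exists_abs_diff_le_of_hasCompactSupport hf1 hc
  refine ⟨hm.toLp _, X.leibniz φ (fun _ => 1) fun _ => 0,
    ⟨isWeakDifferential_one.leibniz (isLocLip_of_contMDiff hf1) hv, ?_⟩, ?_⟩
  · set K := tsupport fun y : X.reg => φ y
    have hK : ∀ x : X.reg, ENNReal.ofReal (X.cometric x (X.leibniz φ (fun _ => 1) (fun _ => 0) x)
        (X.leibniz φ (fun _ => 1) (fun _ => 0) x)).re ≤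
        K.indicator (fun _ => ENNReal.ofReal (2 * C ^ 2)) x := by
      intro x
      by_cases hx : x ∈ K
      · rw [indicator_of_mem hx]
        refine ENNReal.ofReal_le_ofReal ((cometric_leibniz_le (hC x) _ _).trans ?_)
        rw [cometric_zero_left]
        simp
      · rw [indicator_of_notMem hx, nonpos_iff_eq_zero, ENNReal.ofReal_eq_zero]
        refine (cometric_leibniz_le (c := 0) (fun v => ?_) _ _).trans ?_
        · rw [diff_eq_zero_of_notMem_tsupport hx, abs_zero, zero_mul]
        · rw [cometric_zero_left]
          simp
    refine (lintegral_mono hK).trans_lt ?_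
    rw [lintegral_indicator (isClosed_tsupport _).measurableSet, setLIntegral_const]
    exact ENNReal.mul_lt_top ENNReal.ofReal_lt_top hc.isCompact.measure_lt_top
  · filter_upwards [ae_reg_of_ae_vol hv] with x hx
    rw [hx, ← hφ]; simp

/-- The weak differential of zero vanishes. -/
theorem ae_eq_zero_of_isWeakDifferential_zero [SecondCountableTopology M] {u : M → ℂ}
    {α : X.CovectorField}
    (h : X.IsWeakDifferential u α) (hu : ∀ᵐ x ∂X.vol, u x = 0) : ∀ᵐ x ∂X.regVolume, α x = 0 := by
  refine ae_regVolume_of_ae_chart fun e he => ?_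
  have hu' := ae_chart_of_ae_regVolume he (ae_reg_of_ae_vol hu)
  have h1 : ∀ i, ∀ᵐ a, a ∈ e.target → α (e.symm a) (X.coordVec e a i) = 0 := by
    intro i
    refine e.open_target.ae_eq_zero_of_integral_contDiff_smul_eq_zero ((h e he).2 i).1
      fun ψ hψ hc hs => ?_
    have h2 := ((h e he).2 i).2 ψ hψ hc hs
    have h3 : ∫ a, (fderiv ℝ ψ a (stdVec n i)) • u (e.symm a : X.reg) = 0 := by
      refine integral_eq_zero_of_ae ?_
      filter_upwards [hu'] with a ha
      by_cases hat : a ∈ e.target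
      · simp [ha hat]
      · have : fderiv ℝ ψ a = 0 := by
          by_contra h0
          exact hat (hs (support_fderiv_subset ℝ h0))
        simp [this]
    rw [h3] at h2
    exact neg_eq_zero.1 h2.symm
  filter_upwards [ae_all_iff.2 h1] with a ha hat
  ext v
  have h4 := mfderiv_chart_symm_mfderiv_chart he (e.map_target hat) v
  rw [e.right_inv hat] at h4
  set w : Euc n := mfderiv 𝓘(ℝ, Euc n) 𝓘(ℝ, Euc n) e (e.symm a) v
  have h5 : α (e.symm a) (mfderiv 𝓘(ℝ, Euc n) 𝓘(ℝ, Euc n) e.symm a w) = 0 := by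
    rw [mfderiv_chart_symm_apply, map_sum]
    refine Finset.sum_eq_zero fun i _ => ?_
    rw [map_smul, ha i hat, smul_zero]
  exact (congrArg (fun u : Euc n => (α (e.symm a) : Euc n →L[ℝ] ℂ) u) h4).symm.trans h5

/-- The range of `R`, that is the domain of `A`, is dense: `R` is self-adjoint, and injective since
`R h = 0` makes `h` orthogonal to `H¹(M)`, which contains the test functions on the regular part. -/
theorem IsResolvent.denseRange [T2Space M] [SecondCountableTopology M] {R : X.L2 →L[ℂ] X.L2}
    (hR : X.IsResolvent R) : DenseRange R := by
  have hinj : ∀ h, R h = 0 → h = 0 := by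
    intro h hh
    obtain ⟨α, hα, hα'⟩ := hR h
    rw [hh, sub_zero] at hα'
    have hu : ∀ᵐ x ∂X.vol, (R h) x = 0 := by
      rw [hh]; exact Lp.coeFn_zero _ _ _
    have hα0 := ae_eq_zero_of_isWeakDifferential_zero hα.1 hu
    have hH1 : ∀ (v : X.L2) (β : X.CovectorField), X.IsH1 v β → inner ℂ v h = 0 := by
      intro v β hv
      rw [← hα' v β hv]
      refine integral_eq_zero_of_ae ?_
      filter_upwards [hα0] with x hx
      rw [hx, cometric_zero_left, Pi.zero_apply]
    have := ChartedSpace.locallyCompactSpace (Euc n) X.reg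
    have hmem : MemLp (fun x : X.reg => h x) 2 X.regVolume :=
      (measurableEmbedding_coe_reg.memLp_map_measure_iff).1 (Lp.memLp h)
    have h0 : ∀ᵐ x : X.reg ∂X.regVolume, h x = 0 := by
      refine ae_eq_zero_of_integral_contMDiff_smul_eq_zero 𝓘(ℝ, Euc n)
        (hmem.locallyIntegrable (by norm_num)) fun f hf hc => ?_
      obtain ⟨v, β, hv, hvf⟩ := exists_isH1_of_contMDiff hf hc
      have h1 := hH1 v β hv
      rw [inner_eq_integral_reg] at h1
      rw [← h1]
      refine integral_congr_ae ?_
      filter_upwards [hvf] with x hx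
      rw [hx, Complex.conj_ofReal, Complex.real_smul]
    rw [Lp.eq_zero_iff_ae_eq_zero]
    exact ae_vol_iff.2 h0
  have hbot : (R.range)ᗮ = ⊥ := by
    rw [ContinuousLinearMap.orthogonal_range, hR.isSelfAdjoint.adjoint_eq, LinearMap.ker_eq_bot']
    exact hinj
  have := Submodule.dense_iff_topologicalClosure_eq_top.2
    (Submodule.topologicalClosure_eq_top_iff.2 hbot)
  exact this

end Injective

/-! ### Exponentially weighted estimates -/

section Weighted

/-- The weight `e^{2 κ ρ}` satisfies the hypothesis of `neg_le_cometric_leibniz` if `|dρ| ≤ 1`; both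
`ρ` and the weight have differential zero, by convention, where they are not differentiable. -/
theorem diff_exp_le {ρ : M → ℝ} {κ : ℝ} (hκ : 0 < κ) {x : X.reg}
    (hd : ∀ v, |X.diff ρ x v| ≤ √(X.normSq x v)) (v : TangentSpace 𝓘(ℝ, Euc n) x) :
    |X.diff (fun y => Real.exp (2 * κ * ρ y)) x v| ≤
      2 * κ * Real.exp (2 * κ * ρ x) * √(X.normSq x v) := by
  by_cases h : MDifferentiableAt 𝓘(ℝ, Euc n) 𝓘(ℝ, ℝ) (fun y : X.reg => ρ y) x
  · have h1 : HasFDerivAt (fun t : ℝ => Real.exp (2 * κ * t))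
        (ContinuousLinearMap.toSpanSingleton ℝ (Real.exp (2 * κ * ρ x) * (2 * κ))) (ρ x) := by
      have := ((hasDerivAt_id (ρ x)).const_mul (2 * κ)).exp
      simpa using this.hasFDerivAt
    have h2 := HasMFDerivAt.comp x (g := fun t : ℝ => Real.exp (2 * κ * t))
      (f := fun y : X.reg => ρ y) h1.hasMFDerivAt h.hasMFDerivAt
    have h3 : X.diff (fun y => Real.exp (2 * κ * ρ y)) x v =
        X.diff ρ x v * (Real.exp (2 * κ * ρ x) * (2 * κ)) :=
      congrArg (fun A : Euc n →L[ℝ] ℝ => A v) h2.mfderiv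
    rw [h3, abs_mul, abs_of_pos (by positivity : 0 < Real.exp (2 * κ * ρ x) * (2 * κ)), mul_comm,
      mul_comm (Real.exp _)]
    gcongr
    exact hd v
  · have h1 : ¬ MDifferentiableAt 𝓘(ℝ, Euc n) 𝓘(ℝ, ℝ)
        (fun y : X.reg => Real.exp (2 * κ * ρ y)) x := by
      intro h2
      have h3 : DifferentiableAt ℝ (fun s : ℝ => Real.log s / (2 * κ)) (Real.exp (2 * κ * ρ x)) :=
        (Real.differentiableAt_log (Real.exp_pos _).ne').div_const _
      have h4 := MDifferentiableAt.comp x (g := fun s : ℝ => Real.log s / (2 * κ))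
        (f := fun y : X.reg => Real.exp (2 * κ * ρ y)) h3.mdifferentiableAt h2
      refine h (h4.congr_of_eventuallyEq (Eventually.of_forall fun y => ?_))
      simp only [Function.comp_apply, Real.log_exp]
      field_simp
    have h2 := mfderiv_zero_of_not_mdifferentiableAt h1
    have h3 : X.diff (fun y => Real.exp (2 * κ * ρ y)) x v = 0 :=
      congrArg (fun A : Euc n →L[ℝ] ℝ => A v) h2
    rw [h3, abs_zero]
    positivity

theorem IsLocLip.comp {ρ : M → ℝ} (hρ : X.IsLocLip ρ) {g : ℝ → ℝ} (hg : ContDiff ℝ 1 g) :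
    X.IsLocLip fun y => g (ρ y) := fun e he =>
  hg.locallyLipschitz.comp_locallyLipschitzOn (hρ e he)

variable [MeasurableSpace M] [BorelSpace M]

/-- The exponentially weighted energy estimate for `(A + λ²) u = f`, with `|dρ| ≤ 1` and `f`
supported in `{ρ = 0}`. The weak form of the equation is tested with `v = e^{2 κ ρ} u = e^{κ ρ} w`,
and the term `Q(u, v)` is at least `-κ² ‖w‖²` by `neg_le_cometric_leibniz`. -/
theorem IsNegLaplacian.weighted_norm_le {u w f : X.L2} {κ l : ℝ} (hκ : 0 < κ)
    (hu : X.IsNegLaplacian u (f - ((l ^ 2 : ℝ) : ℂ) • u)) {ρ : M → ℝ}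
    (hρ : X.IsLocLip ρ) (hd : ∀ x v, |X.diff ρ x v| ≤ √(X.normSq x v)) {B : ℝ} (hB : ∀ x, |ρ x| ≤ B)
    (hf : ∀ᵐ x ∂X.vol, ρ x ≠ 0 → f x = 0)
    (hw : ∀ᵐ x ∂X.vol, w x = Real.exp (κ * ρ x) • u x) :
    (l ^ 2 - κ ^ 2) * ‖w‖ ≤ ‖f‖ := by
  obtain ⟨α, hα, hα'⟩ := hu
  set φ : M → ℝ := fun y => Real.exp (2 * κ * ρ y) with hφ
  have hφL : X.IsLocLip φ := hρ.comp (g := fun t => Real.exp (2 * κ * t)) (by fun_prop)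
  have hφB : ∀ x, |φ x| ≤ Real.exp (2 * κ * B) := fun x => by
    rw [hφ, abs_of_pos (Real.exp_pos _)]
    gcongr
    exact (le_abs_self _).trans (hB x)
  have hφd : ∀ x v, |X.diff φ x v| ≤ 2 * κ * φ x * √(X.normSq x v) :=
    fun x v => diff_exp_le hκ (hd x) v
  have hφd' : ∀ x v, |X.diff φ x v| ≤ 2 * κ * Real.exp (2 * κ * B) * √(X.normSq x v) :=
    fun x v => (hφd x v).trans (by gcongr; exact (le_abs_self _).trans (hφB x))
  obtain ⟨v, hv⟩ := exists_L2_eq_smul hφL.aestronglyMeasurable hφB u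
  have h1 := hα' v _ (hα.leibniz hφL hφB hφd' hv)
  have hφw : ∀ x, φ x = Real.exp (κ * ρ x) * Real.exp (κ * ρ x) := fun x => by
    rw [hφ, ← Real.exp_add]; ring_nf
  have h2 : (inner ℂ v u : ℂ) = inner ℂ w w := by
    refine inner_congr_ae ?_
    filter_upwards [hv, hw] with x hvx hwx
    rw [hvx, hwx, hφw]
    simp only [Complex.real_smul, map_mul, Complex.conj_ofReal, Complex.ofReal_mul]
    ring
  have h3 : (inner ℂ v f : ℂ) = inner ℂ w f := by
    refine inner_congr_ae ?_
    filter_upwards [hv, hw, hf] with x hvx hwx hfx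
    by_cases hx : ρ x = 0
    · rw [hvx, hwx, hφw, hx]; simp
    · rw [hfx hx]; simp
  have hww : (inner ℂ w w : ℂ) = ((‖w‖ ^ 2 : ℝ) : ℂ) := by
    rw [inner_self_eq_norm_sq_to_K]; norm_cast
  have h4 : -(κ ^ 2 * ‖w‖ ^ 2) ≤
      (∫ x, X.cometric x (α x) (X.leibniz φ u α x) ∂X.regVolume).re := by
    by_cases hi : Integrable (fun x => X.cometric x (α x) (X.leibniz φ u α x)) X.regVolume
    · have h5 := integral_re hi
      simp only [RCLike.re_eq_complex_re] at h5
      rw [← h5]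
      have hwi : Integrable (fun x : X.reg => ‖w x‖ ^ 2) X.regVolume :=
        (measurableEmbedding_coe_reg.integrable_map_iff).1
          ((Lp.memLp w).integrable_norm_pow (by norm_num))
      rw [norm_sq_eq_integral_reg w, ← integral_const_mul, ← integral_neg]
      refine integral_mono_ae (hwi.const_mul _).neg hi.re ?_
      filter_upwards [ae_reg_of_ae_vol hw] with x hwx
      refine le_trans (le_of_eq ?_) (neg_le_cometric_leibniz (Real.exp_pos _) (hφd x) (α x) (u x))
      have h6 : Real.exp (2 * κ * ρ x) = _ := hφw x
      rw [hwx, norm_smul, Real.norm_eq_abs, mul_pow, sq_abs, h6]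
      ring
    · rw [integral_undef hi, Complex.zero_re]
      exact neg_nonpos.2 (by positivity)
  rw [h1, inner_sub_right, inner_smul_right, h2, h3, hww, ← Complex.ofReal_mul, Complex.sub_re,
    Complex.ofReal_re] at h4
  have h5 : (inner ℂ w f : ℂ).re ≤ ‖w‖ * ‖f‖ := re_inner_le_norm (𝕜 := ℂ) w f
  rcases (norm_nonneg w).eq_or_lt with h0 | h0
  · rw [← h0, mul_zero]; exact norm_nonneg f
  · refine le_of_mul_le_mul_right ?_ h0
    linarith

end Weighted

end CMGA

/-! ### Vanishing of the wave operators -/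

section Abstract

variable {H : Type*} [NormedAddCommGroup H] [InnerProductSpace ℂ H] [CompleteSpace H]

/-- `(A + λ²)⁻¹` as a function of `R = (A + 1)⁻¹`. -/
noncomputable def shiftedResolvent (R : H →L[ℂ] H) (l : ℝ) : H →L[ℂ] H :=
  cfc (fun s : ℝ => s / (1 + (l ^ 2 - 1) * s)) R

/-- With `u = (A + λ²)⁻¹ f`, the equation `(A + 1) u = f - (λ² - 1) u` in terms of `R = (A + 1)⁻¹`.
-/
theorem apply_sub_shiftedResolvent {R : H →L[ℂ] H} (hR : IsSelfAdjoint R)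
    (hs : spectrum ℝ R ⊆ Icc 0 1) {l : ℝ} (hl : 1 < l) (f : H) :
    R (f - ((l ^ 2 - 1 : ℝ) : ℂ) • shiftedResolvent R l f) = shiftedResolvent R l f := by
  set G := shiftedResolvent R l with hG
  rw [shiftedResolvent] at hG
  have hden : ∀ s ∈ spectrum ℝ R, 1 + (l ^ 2 - 1) * s ≠ 0 := fun s h => by
    have h3 : (0 : ℝ) < l ^ 2 - 1 := by nlinarith
    have := (hs h).1
    positivity
  have hck : ContinuousOn (fun s : ℝ => s / (1 + (l ^ 2 - 1) * s)) (spectrum ℝ R) :=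
    ContinuousOn.div (by fun_prop) (by fun_prop) hden
  have hck' : ContinuousOn (fun s : ℝ => (l ^ 2 - 1) * (s / (1 + (l ^ 2 - 1) * s)))
      (spectrum ℝ R) := continuousOn_const.mul hck
  have h1 : R * (1 - (l ^ 2 - 1) • G) = G := by
    have e1 : R = cfc (fun s : ℝ => s) R := (cfc_id' ℝ R hR).symm
    have e2 : (1 : H →L[ℂ] H) - (l ^ 2 - 1) • G =
        cfc (fun s : ℝ => 1 - (l ^ 2 - 1) * (s / (1 + (l ^ 2 - 1) * s))) R := by
      rw [cfc_sub (fun _ : ℝ => (1 : ℝ)) (fun s : ℝ => (l ^ 2 - 1) * (s / (1 + (l ^ 2 - 1) * s))) R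
        continuousOn_const hck', cfc_const_one ℝ R hR,
        cfc_const_mul (l ^ 2 - 1) (fun s : ℝ => s / (1 + (l ^ 2 - 1) * s)) R hck,
        hG]
    rw [e2]
    nth_rw 1 [e1]
    rw [← cfc_mul (fun s : ℝ => s) (fun s : ℝ => 1 - (l ^ 2 - 1) * (s / (1 + (l ^ 2 - 1) * s))) R
      continuousOn_id (continuousOn_const.sub hck'), hG]
    refine cfc_congr fun s h => ?_
    have h0 := hden s h
    rw [eq_div_iff h0, mul_assoc, sub_mul, mul_assoc, div_mul_cancel₀ _ h0]
    ring
  have := congrArg (fun A : H →L[ℂ] H => A f) h1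
  rw [Complex.coe_smul]
  exact this

section Wave

/- In the following two lemmas `A` is the graph of an operator whose only resolvent is `R`. -/

variable {A : H → H → Prop} {R : H →L[ℂ] H} {B : ℝ → H →L[ℂ] H} {h x : H} {K r t : ℝ}

theorem inner_cos_eq_zero (hR : IsSelfAdjoint R) (hd : DenseRange R)
    (hs : spectrum ℝ R ⊆ Icc 0 1) (hu : ∀ R' : H →L[ℂ] H, (∀ h, A (R' h) (h - R' h)) → R' = R)
    (hdec : ∀ l : ℝ, 1 < l → ‖inner ℂ h (shiftedResolvent R l x)‖ * l ≤ K * Real.exp (-l * r))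
    (ht : 0 < t) (htr : t < r)
    (hB : ∀ t, IsFunctionOf A (fun l => Real.cos (t * √l)) (B t)) :
    inner ℂ h (B t x) = 0 := by
  refine inner_waveFamily_eq_zero isWaveSymbol_cos
    (fun l hl => (abs_of_pos (by linarith : (0 : ℝ) < l)).le) hR hd hs (fun t _ => ?_) hdec ht htr
  obtain ⟨R', hR', h⟩ := hB t
  rwa [hu R' hR'] at h

theorem inner_sinc_eq_zero (hR : IsSelfAdjoint R) (hd : DenseRange R)
    (hs : spectrum ℝ R ⊆ Icc 0 1) (hu : ∀ R' : H →L[ℂ] H, (∀ h, A (R' h) (h - R' h)) → R' = R)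
    (hdec : ∀ l : ℝ, 1 < l → ‖inner ℂ h (shiftedResolvent R l x)‖ * l ≤ K * Real.exp (-l * r))
    (ht : 0 < t) (htr : t < r)
    (hB : ∀ t, IsFunctionOf A
    (fun l => if l = 0 then t else Real.sin (t * √l) / √l) (B t)) :
    inner ℂ h (B t x) = 0 := by
  refine inner_waveFamily_eq_zero isWaveSymbol_sinc
    (fun l hl => by rw [abs_one]; exact hl.le) hR hd hs (fun t _ => ?_) hdec ht htr
  obtain ⟨R', hR', h⟩ := hB t
  rw [hu R' hR'] at h
  rw [h]
  refine cfc_congr fun s hs' => ?_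
  simp only [resolventSymbol]
  rcases (hs hs').1.eq_or_lt with h0 | h0
  · simp [← h0]
  congr 1
  have h1 : 0 ≤ s⁻¹ - 1 := by
    rw [sub_nonneg]
    exact (one_le_inv₀ h0).2 (hs hs').2
  split_ifs with h2
  · simp [h2]
  · have h3 : 0 < √(s⁻¹ - 1) := Real.sqrt_pos.2 (lt_of_le_of_ne h1 (Ne.symm h2))
    rcases eq_or_ne t 0 with rfl | ht
    · simp
    · rw [Real.sinc_of_ne_zero (by positivity)]
      field_simp

end Wave

end Abstract

namespace CMGA

variable {n : ℕ} {M : Type*} [TopologicalSpace M] {X : CMGA n M}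
  [MeasurableSpace M]

theorem IsResolvent.spectrum_subset {R : X.L2 →L[ℂ] X.L2} (hR : X.IsResolvent R) :
    spectrum ℝ R ⊆ Icc 0 1 :=
  spectrum_subset_Icc_of_inner hR.isSelfAdjoint hR.norm_sq_le

theorem IsResolvent.isNegLaplacian_shiftedResolvent {R : X.L2 →L[ℂ] X.L2} (hR : X.IsResolvent R)
    {l : ℝ} (hl : 1 < l) (f : X.L2) : X.IsNegLaplacian (shiftedResolvent R l f)
      (f - ((l ^ 2 : ℝ) : ℂ) • shiftedResolvent R l f) := by
  have h3 := hR (f - ((l ^ 2 - 1 : ℝ) : ℂ) • shiftedResolvent R l f)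
  rw [apply_sub_shiftedResolvent hR.isSelfAdjoint hR.spectrum_subset hl] at h3
  convert h3 using 1
  push_cast
  rw [sub_sub]
  congr 1
  rw [sub_smul, one_smul, sub_add_cancel]

variable [BorelSpace M]

/-- The matrix elements of `(A + λ²)⁻¹` between functions supported in `{ρ = 0}` and `{ρ ≥ r}` decay
like `e^{-λ r}`, for a bounded function `ρ` with `|dρ| ≤ 1`. -/
theorem IsResolvent.norm_inner_shiftedResolvent_mul_le {R : X.L2 →L[ℂ] X.L2}
    (hR : X.IsResolvent R) {ρ : M → ℝ} (hρ : X.IsLocLip ρ)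
    (hd : ∀ x v, |X.diff ρ x v| ≤ √(X.normSq x v)) {B : ℝ} (hB : ∀ x, |ρ x| ≤ B)
    {f h : X.L2} (hf : ∀ᵐ x ∂X.vol, ρ x ≠ 0 → f x = 0) {r : ℝ}
    (hh : ∀ᵐ x ∂X.vol, ρ x < r → h x = 0) {l : ℝ} (hl : 1 < l) :
    ‖inner ℂ h (shiftedResolvent R l f)‖ * l ≤
      Real.exp r * ‖h‖ * ‖f‖ * Real.exp (-l * r) := by
  set u := shiftedResolvent R l f
  -- `κ = λ - 1` costs the factor `e^r` and gains `λ² - κ² ≥ λ`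
  set κ := l - 1 with hκ
  have hκ0 : 0 < κ := by linarith
  have hw0 : ∀ c x, |Real.exp (c * ρ x)| ≤ Real.exp (|c| * B) := fun c x => by
    rw [abs_of_pos (Real.exp_pos _)]
    refine Real.exp_le_exp.2 ((le_abs_self _).trans ?_)
    rw [abs_mul]
    exact mul_le_mul_of_nonneg_left (hB x) (abs_nonneg c)
  obtain ⟨w, hw⟩ := exists_L2_eq_smul
    (hρ.comp (g := fun t => Real.exp (κ * t)) (by fun_prop)).aestronglyMeasurable (hw0 κ) u
  obtain ⟨k, hk⟩ := exists_L2_eq_smul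
    (hρ.comp (g := fun t => Real.exp (-κ * t)) (by fun_prop)).aestronglyMeasurable (hw0 (-κ)) h
  have h1 := (hR.isNegLaplacian_shiftedResolvent hl f).weighted_norm_le hκ0 hρ hd hB hf hw
  have h2 : (inner ℂ h u : ℂ) = inner ℂ k w := by
    refine inner_congr_ae ?_
    filter_upwards [hw, hk] with x hwx hkx
    have h3 : (Real.exp (-κ * ρ x) : ℂ) * Real.exp (κ * ρ x) = 1 := by
      rw [← Complex.ofReal_mul, ← Real.exp_add]; simp
    rw [hwx, hkx]
    simp only [Complex.real_smul, map_mul, Complex.conj_ofReal]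
    linear_combination (-((starRingEnd ℂ) (h x) * u x)) * h3
  have h3 : ‖k‖ ≤ Real.exp (-κ * r) * ‖h‖ := by
    refine Lp.norm_le_mul_norm_of_ae_le_mul ?_
    filter_upwards [hk, hh] with x hkx hhx
    rw [hkx, norm_smul, Real.norm_eq_abs, abs_of_pos (Real.exp_pos _)]
    rcases lt_or_ge (ρ x) r with hx | hx
    · rw [hhx hx]; simp
    · gcongr ?_ * _
      exact Real.exp_le_exp.2 (by nlinarith)
  have h4 : ‖w‖ * l ≤ ‖f‖ := by
    refine le_trans ?_ h1
    rw [mul_comm]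
    gcongr
    nlinarith
  calc ‖inner ℂ h u‖ * l = ‖(inner ℂ k w : ℂ)‖ * l := by rw [h2]
    _ ≤ (‖k‖ * ‖w‖) * l := by gcongr; exact norm_inner_le_norm _ _
    _ = ‖k‖ * (‖w‖ * l) := by ring
    _ ≤ (Real.exp (-κ * r) * ‖h‖) * ‖f‖ := by gcongr
    _ = _ := by
      rw [show -κ * r = r + -l * r by rw [hκ]; ring, Real.exp_add]; ring

variable [T2Space M] [SecondCountableTopology M]

/-- If the data vanish where a function `ρ` with `|dρ| ≤ 1` does not, then the solution at time `T`
vanishes where `ρ ≥ r > T`: it is orthogonal to its own restriction to that set. -/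
theorem IsWaveSolution.ae_eq_zero {v₀ v₁ : X.L2} {u : ℝ → X.L2} (hu : X.IsWaveSolution v₀ v₁ u)
    {ρ : M → ℝ} (hρ : X.IsLocLip ρ) (hd : ∀ x v, |X.diff ρ x v| ≤ √(X.normSq x v)) {B : ℝ}
    (hB : ∀ x, |ρ x| ≤ B) (h₀ : ∀ᵐ x ∂X.vol, ρ x ≠ 0 → v₀ x = 0)
    (h₁ : ∀ᵐ x ∂X.vol, ρ x ≠ 0 → v₁ x = 0) {T r : ℝ} (hT : 0 < T) (hTr : T < r) :
    ∀ᵐ x ∂X.vol, r ≤ ρ x → u T x = 0 := by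
  choose C S hC hS hCS using hu
  obtain ⟨R, hR, -⟩ := hC T
  have hR : X.IsResolvent R := hR
  -- the part of `u T` in `{ρ ≥ r}`
  have hind : AEStronglyMeasurable (fun x => if r ≤ ρ x then (1 : ℝ) else 0) X.vol := by
    refine measurableEmbedding_coe_reg.aestronglyMeasurable_map_iff.2 ?_
    exact (Measurable.ite (measurableSet_le measurable_const hρ.continuous.measurable)
      measurable_const measurable_const).aestronglyMeasurable
  obtain ⟨h, hh⟩ := exists_L2_eq_smul (B := 1) hind
    (fun x => by split_ifs <;> simp) (u T)
  have hh0 : ∀ᵐ x ∂X.vol, ρ x < r → h x = 0 := by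
    filter_upwards [hh] with x hx hxr
    rw [hx, if_neg hxr.not_ge, zero_smul]
  have hu : ∀ R', X.IsResolvent R' → R' = R := fun R' hR' => hR'.eq hR
  have e0 := inner_cos_eq_zero hR.isSelfAdjoint hR.denseRange hR.spectrum_subset hu
    (fun l hl => hR.norm_inner_shiftedResolvent_mul_le hρ hd hB h₀ hh0 hl) hT hTr hC
  have e1 := inner_sinc_eq_zero hR.isSelfAdjoint hR.denseRange hR.spectrum_subset hu
    (fun l hl => hR.norm_inner_shiftedResolvent_mul_le hρ hd hB h₁ hh0 hl) hT hTr hS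
  have e2 : (inner ℂ h (u T) : ℂ) = 0 := by rw [hCS T, inner_add_right, e0, e1, add_zero]
  have e3 : (inner ℂ h (u T) : ℂ) = inner ℂ h h := by
    refine inner_congr_ae ?_
    filter_upwards [hh] with x hx
    rw [hx]
    split_ifs <;> simp
  rw [e3, inner_self_eq_zero] at e2
  filter_upwards [hh, (Lp.eq_zero_iff_ae_eq_zero).1 e2] with x hx hx0 hxr
  rw [if_pos hxr, one_smul] at hx
  rw [← hx, hx0, Pi.zero_apply]

end CMGA

namespace CMGA

variable {n : ℕ} {M : Type*} [TopologicalSpace M] {X : CMGA n M}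

/-! ### Admissible paths -/

open Classical in
/-- The path `μ` as a path in the regular part, with the value `x` where `μ` is singular. -/
noncomputable def regPath (μ : ℝ → M) (x : X.reg) (t : ℝ) : X.reg :=
  if h : μ t ∈ X.reg then ⟨μ t, h⟩ else x

/-- The speed of a path in the regular part. -/
noncomputable def regSpeed (ν : ℝ → X.reg) (s : ℝ) : ℝ :=
  √(X.normSq (ν s) (mfderiv 𝓘(ℝ, ℝ) 𝓘(ℝ, Euc n) ν s (1 : ℝ)))

theorem speed_eq_regSpeed_regPath {μ : ℝ → M} {s : ℝ} (h : μ s ∈ X.reg) :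
    X.speed μ s = ENNReal.ofReal (regSpeed (regPath μ ⟨μ s, h⟩) s) := by
  rw [speed, dif_pos h]
  rfl

theorem speed_eq_zero {μ : ℝ → M} {s : ℝ} (h : μ s ∉ X.reg) : X.speed μ s = 0 := by
  rw [speed, dif_neg h]

theorem regSpeed_congr {ν ν' : ℝ → X.reg} {s : ℝ} (h : ν =ᶠ[𝓝 s] ν') :
    regSpeed ν s = regSpeed ν' s := by
  have h1 := h.mfderiv_eq (I := 𝓘(ℝ, ℝ)) (I' := 𝓘(ℝ, Euc n))
  have h2 : (mfderiv 𝓘(ℝ, ℝ) 𝓘(ℝ, Euc n) ν s (1 : ℝ) : Euc n) =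
    mfderiv 𝓘(ℝ, ℝ) 𝓘(ℝ, Euc n) ν' s (1 : ℝ) := congrArg (fun A : ℝ →L[ℝ] Euc n => A 1) h1
  let F : X.reg → Euc n → ℝ := fun x v => √(X.normSq x v)
  exact congrArg₂ F h.self_of_nhds h2

theorem speed_eq_regSpeed {μ : ℝ → M} {ν : ℝ → X.reg} {s : ℝ} (h : ∀ᶠ t in 𝓝 s, (ν t : M) = μ t) :
    X.speed μ s = ENNReal.ofReal (regSpeed ν s) := by
  have hs : μ s ∈ X.reg := h.self_of_nhds ▸ (ν s).2
  rw [speed_eq_regSpeed_regPath hs]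
  congr 1
  refine regSpeed_congr ?_
  filter_upwards [h] with t ht
  have : μ t ∈ X.reg := ht ▸ (ν t).2
  rw [regPath, dif_pos this]
  exact Subtype.ext ht.symm

theorem regSpeed_eq_zero {ν : ℝ → X.reg} {s : ℝ}
    (h : mfderiv 𝓘(ℝ, ℝ) 𝓘(ℝ, Euc n) ν s = 0) : regSpeed ν s = 0 := by
  have h1 : (mfderiv 𝓘(ℝ, ℝ) 𝓘(ℝ, Euc n) ν s (1 : ℝ) : TangentSpace 𝓘(ℝ, Euc n) (ν s)) = 0 :=
    congrArg (fun A : ℝ →L[ℝ] Euc n => A 1) h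
  rw [regSpeed, h1, normSq, map_zero, Real.sqrt_zero]

theorem regSpeed_comp {E : Type*} [NormedAddCommGroup E] [NormedSpace ℝ E] {F : E → X.reg}
    {γ : ℝ → E} {s : ℝ} {v : E} (hF : MDifferentiableAt 𝓘(ℝ, E) 𝓘(ℝ, Euc n) F (γ s))
    (hγ : HasDerivAt γ v s) :
    regSpeed (fun t => F (γ t)) s =
      √(X.normSq (F (γ s)) (mfderiv 𝓘(ℝ, E) 𝓘(ℝ, Euc n) F (γ s) v)) := by
  have h1 := mfderiv_comp s hF hγ.differentiableAt.mdifferentiableAt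
  rw [mfderiv_eq_fderiv, hγ.hasFDerivAt.fderiv] at h1
  have h2 : (mfderiv 𝓘(ℝ, ℝ) 𝓘(ℝ, Euc n) (fun t => F (γ t)) s (1 : ℝ) : Euc n) =
      mfderiv 𝓘(ℝ, E) 𝓘(ℝ, Euc n) F (γ s) v := by
    refine (congrArg (fun A : ℝ →L[ℝ] Euc n => A 1) h1).trans ?_
    change mfderiv 𝓘(ℝ, E) 𝓘(ℝ, Euc n) F (γ s) ((1 : ℝ) • v) = _
    rw [one_smul]
  exact congrArg (fun v : Euc n => √(X.normSq (F (γ s)) v)) h2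

theorem regSpeed_comp_affine (ν : ℝ → X.reg) {c : ℝ} (hc : 0 < c) (d s : ℝ) :
    regSpeed (fun t => ν (c * t + d)) s = c * regSpeed ν (c * s + d) := by
  have hσ : HasDerivAt (fun t : ℝ => c * t + d) c s := by
    simpa using ((hasDerivAt_id s).const_mul c).add_const d
  by_cases h : MDifferentiableAt 𝓘(ℝ, ℝ) 𝓘(ℝ, Euc n) ν (c * s + d)
  · rw [regSpeed_comp (γ := fun t => c * t + d) h hσ, regSpeed]
    have h1 : (mfderiv 𝓘(ℝ, ℝ) 𝓘(ℝ, Euc n) ν (c * s + d) c : TangentSpace 𝓘(ℝ, Euc n) _) =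
        c • mfderiv 𝓘(ℝ, ℝ) 𝓘(ℝ, Euc n) ν (c * s + d) (1 : ℝ) := by
      have := (mfderiv 𝓘(ℝ, ℝ) 𝓘(ℝ, Euc n) ν (c * s + d)).map_smul c (1 : ℝ)
      rw [← this]
      exact congrArg (fun r : ℝ => mfderiv 𝓘(ℝ, ℝ) 𝓘(ℝ, Euc n) ν (c * s + d) r) (mul_one c).symm
    rw [h1, normSq_smul, Real.sqrt_mul (sq_nonneg c), Real.sqrt_sq hc.le]
  · have h1 : ¬ MDifferentiableAt 𝓘(ℝ, ℝ) 𝓘(ℝ, Euc n) (fun t => ν (c * t + d)) s := by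
      intro h2
      refine h ?_
      have h3 : DifferentiableAt ℝ (fun t : ℝ => c⁻¹ * (t - d)) (c * s + d) := by fun_prop
      have e1 : c⁻¹ * (c * s + d - d) = s := by field_simp; ring
      have h5 := MDifferentiableAt.comp (c * s + d) (g := fun t => ν (c * t + d))
        (f := fun t : ℝ => c⁻¹ * (t - d)) (I' := 𝓘(ℝ, ℝ)) (by rwa [e1]) h3.mdifferentiableAt
      refine h5.congr_of_eventuallyEq (Eventually.of_forall fun t => ?_)
      simp only [Function.comp_apply]
      congr 1
      field_simp
      ring
    rw [regSpeed_eq_zero (mfderiv_zero_of_not_mdifferentiableAt h),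
      regSpeed_eq_zero (mfderiv_zero_of_not_mdifferentiableAt h1), mul_zero]

/-- The speed scales under affine changes of the parameter, at singular points too, where it is
zero. -/
theorem speed_eq_of_affine {μ μ' : ℝ → M} {c : ℝ} (hc : 0 < c) {d s : ℝ}
    (h : ∀ᶠ t in 𝓝 s, μ' t = μ (c * t + d)) :
    X.speed μ' s = ENNReal.ofReal c * X.speed μ (c * s + d) := by
  by_cases hs : μ (c * s + d) ∈ X.reg
  · have hs' : μ' s ∈ X.reg := h.self_of_nhds ▸ hs
    rw [speed_eq_regSpeed_regPath hs, speed_eq_regSpeed_regPath hs', ← ENNReal.ofReal_mul hc.le,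
      ← regSpeed_comp_affine _ hc]
    congr 1
    refine regSpeed_congr ?_
    filter_upwards [h] with t ht
    by_cases hm : μ (c * t + d) ∈ X.reg
    · rw [regPath, regPath, dif_pos hm, dif_pos (show μ' t ∈ X.reg from ht ▸ hm)]
      exact Subtype.ext ht
    · rw [regPath, regPath, dif_neg hm, dif_neg (show μ' t ∉ X.reg from ht ▸ hm)]
      exact Subtype.ext h.self_of_nhds
  · have hs' : μ' s ∉ X.reg := h.self_of_nhds ▸ hs
    rw [speed_eq_zero hs, speed_eq_zero hs', mul_zero]

theorem lintegral_speed_eq_of_affine {μ μ' : ℝ → M} {c : ℝ} (hc : 0 < c) {a b d : ℝ}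
    (h : ∀ t ∈ Ioo a b, μ' t = μ (c * t + d)) :
    ∫⁻ s in Ioo a b, X.speed μ' s = ∫⁻ s in Ioo (c * a + d) (c * b + d), X.speed μ s := by
  have himg : Ioo (c * a + d) (c * b + d) = (fun t => c * t + d) '' Ioo a b := by
    rw [show (fun t => c * t + d) = (fun t => t + d) ∘ (fun t => c * t) from rfl, image_comp,
      image_mul_left_Ioo hc, image_add_const_Ioo]
  rw [himg, lintegral_image_eq_lintegral_abs_deriv_mul measurableSet_Ioo (f' := fun _ => c)
    (fun s _ => by simpa using (((hasDerivAt_id s).const_mul c).add_const d).hasDerivWithinAt)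
    (fun s _ t _ hst => by simpa [hc.ne'] using hst)]
  refine setLIntegral_congr_fun measurableSet_Ioo fun s hs => ?_
  simp only [abs_of_pos hc]
  refine speed_eq_of_affine hc ?_
  filter_upwards [isOpen_Ioo.mem_nhds hs] with t ht using h t ht

theorem length_eq (μ : ℝ → M) : X.length μ = ∫⁻ s in Ioo (0 : ℝ) 1, X.speed μ s := by
  rw [length, Measure.restrict_congr_set Ioo_ae_eq_Icc.symm]

theorem IsC1Piece.affine {μ μ' : ℝ → M} {a b a' b' c d : ℝ} (h : X.IsC1Piece μ a b)
    (hmem : ∀ t ∈ Icc a' b', c * t + d ∈ Icc a b) (heq : ∀ t ∈ Icc a' b', μ' t = μ (c * t + d)) :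
    X.IsC1Piece μ' a' b' := by
  have hσ : ContDiff ℝ 1 fun t : ℝ => c * t + d := by fun_prop
  rcases h with ⟨ν, hν, hνμ⟩ | ⟨i, ν, hν, hνμ⟩
  · exact Or.inl ⟨fun t => ν (c * t + d), hν.comp hσ.contMDiff.contMDiffOn hmem,
      fun s hs => by rw [heq s hs, hνμ _ (hmem s hs)]⟩
  · exact Or.inr ⟨i, fun t => ν (c * t + d), hν.comp hσ.contDiffOn hmem,
      fun s hs => by rw [heq s hs]; exact hνμ _ (hmem s hs)⟩

/-- Two admissible paths run through at double speed form an admissible path. -/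
theorem dist_triangle (x y z : M) : X.dist x z ≤ X.dist x y + X.dist y z := by
  have key : ∀ μ, X.IsAdmissiblePath μ x y → ∀ μ', X.IsAdmissiblePath μ' y z →
      X.dist x z ≤ X.length μ + X.length μ' := by
    intro μ hμ μ' hμ'
    obtain ⟨N, t, ht0, htN, ht⟩ := hμ.piecewise
    obtain ⟨N', t', ht0', htN', ht'⟩ := hμ'.piecewise
    set η : ℝ → M := fun s => if s ≤ 1 / 2 then μ (2 * s + 0) else μ' (2 * s + -1) with hη
    have hη1 : ∀ s, s ≤ 1 / 2 → η s = μ (2 * s + 0) := fun s hs => if_pos hs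
    have hη2 : ∀ s, 1 / 2 ≤ s → η s = μ' (2 * s + -1) := by
      intro s hs
      rcases hs.eq_or_lt with rfl | hs
      · rw [hη1 _ le_rfl]
        norm_num
        rw [hμ.target, hμ'.source]
      · exact if_neg hs.not_ge
    have hmono : ∀ j ≤ N, t j ≤ 1 := by
      intro j hj
      refine Nat.decreasingInduction' (P := fun j => t j ≤ 1) (fun k hk _ ih => ?_) hj htN.le
      exact ((ht k hk).1.le).trans ih
    have hmono' : ∀ j ≤ N', 0 ≤ t' j := by
      intro j
      induction j with
      | zero => intro _; exact ht0'.ge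
      | succ j ih => intro hj; exact (ih (by omega)).trans (ht' j (by omega)).1.le
    have hadm : X.IsAdmissiblePath η x z := by
      refine ⟨?_, ?_, ⟨N + N', fun j => if j ≤ N then t j / 2 else 1 / 2 + t' (j - N) / 2, ?_, ?_,
        fun j hj => ?_⟩, ?_⟩
      · rw [hη1 0 (by norm_num)]; simpa using hμ.source
      · rw [hη2 1 (by norm_num)]; norm_num; exact hμ'.target
      · simp [ht0]
      · rcases Nat.eq_zero_or_pos N' with h0 | h0
        · subst h0; rw [ht0'] at htN'; norm_num at htN'
        · beta_reduce
          rw [if_neg (by omega), Nat.add_sub_cancel_left, htN']; norm_num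
      · beta_reduce
        rcases lt_or_ge j N with hjN | hjN
        · rw [if_pos hjN.le, if_pos (by omega)]
          refine ⟨by linarith [(ht j hjN).1], (ht j hjN).2.affine (c := 2) (d := 0) ?_ ?_⟩
          · intro s hs; constructor <;> linarith [hs.1, hs.2]
          · intro s hs; exact hη1 s (by linarith [hs.2, hmono (j + 1) hjN])
        · obtain ⟨i, rfl⟩ := Nat.exists_eq_add_of_le hjN
          have e1 : (if N + i ≤ N then t (N + i) / 2 else 1 / 2 + t' (N + i - N) / 2) =
              1 / 2 + t' i / 2 := by
            split_ifs with h
            · obtain rfl : i = 0 := by omega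
              rw [add_zero, htN, ht0']; norm_num
            · rw [Nat.add_sub_cancel_left]
          rw [e1, if_neg (by omega), add_assoc, Nat.add_sub_cancel_left]
          have hi : i < N' := by omega
          refine ⟨by linarith [(ht' i hi).1], (ht' i hi).2.affine (c := 2) (d := -1) ?_ ?_⟩
          · intro s hs; constructor <;> linarith [hs.1, hs.2]
          · intro s hs; exact hη2 s (by linarith [hs.1, hmono' i hi.le])
      · refine (hμ.finite_sing.union hμ'.finite_sing).subset ?_
        rintro _ ⟨⟨s, hs, rfl⟩, hreg⟩
        rcases le_total s (1 / 2) with h | h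
        · rw [hη1 s h] at hreg ⊢
          exact Or.inl ⟨⟨_, ⟨by linarith [hs.1], by linarith⟩, rfl⟩, hreg⟩
        · rw [hη2 s h] at hreg ⊢
          exact Or.inr ⟨⟨_, ⟨by linarith [hs.1], by linarith [hs.2]⟩, rfl⟩, hreg⟩
    have hlen : X.length η ≤ X.length μ + X.length μ' := by
      have e1 := lintegral_speed_eq_of_affine (X := X) (μ := μ) (μ' := η) (c := 2) two_pos
        (a := 0) (b := 1 / 2) (d := 0) fun s hs => hη1 s hs.2.le
      have e2 := lintegral_speed_eq_of_affine (X := X) (μ := μ') (μ' := η) (c := 2) two_pos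
        (a := 1 / 2) (b := 1) (d := -1) fun s hs => hη2 s hs.1.le
      norm_num at e1 e2
      rw [length_eq μ, length_eq μ', ← e1, ← e2, length]
      have hsub : Icc (0 : ℝ) 1 =ᵐ[volume] (Ioo 0 (1 / 2) ∪ Ioo (1 / 2) 1 : Set ℝ) := by
        have h1 : (Ioo (1 / 2) 1 : Set ℝ) =ᵐ[volume] Ico (1 / 2) 1 := Ioo_ae_eq_Ico
        have h2 := (ae_eq_refl (Ioo (0 : ℝ) (1 / 2))).union h1
        rw [Ioo_union_Ico_eq_Ioo (by norm_num) (by norm_num)] at h2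
        exact Ioo_ae_eq_Icc.symm.trans h2.symm
      rw [Measure.restrict_congr_set hsub]
      exact lintegral_union_le _ _ _
    exact (iInf₂_le η hadm).trans hlen
  conv_rhs => rw [dist, dist]
  simp only [ENNReal.iInf_add, ENNReal.add_iInf]
  exact le_iInf fun μ => le_iInf fun μ' => le_iInf fun h' => le_iInf fun h => key _ ‹_› _ ‹_›

theorem dist_le_of_speed_le {μ : ℝ → M} {x y : M} (h : X.IsAdmissiblePath μ x y) {L : ℝ≥0∞}
    (hL : ∀ s ∈ Ioo (0 : ℝ) 1, X.speed μ s ≤ L) : X.dist x y ≤ L := by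
  refine (iInf₂_le μ h).trans ?_
  rw [length_eq]
  refine (setLIntegral_mono' measurableSet_Ioo hL).trans ?_
  simp

/-- The constant path is admissible, even at a singular point, which it meets in a single point of
`M`. -/
theorem dist_self (x : M) : X.dist x x = 0 := by
  refine le_antisymm ?_ zero_le
  have hadm : X.IsAdmissiblePath (fun _ => x) x x := by
    refine ⟨rfl, rfl,
      ⟨1, fun j => j, by simp, by simp, fun j _ => ⟨by push_cast; linarith, ?_⟩⟩, ?_⟩
    · by_cases hx : x ∈ X.reg
      · exact Or.inl ⟨fun _ => ⟨x, hx⟩, contMDiffOn_const, fun _ _ => rfl⟩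
      · obtain ⟨i, p, hp, rfl⟩ := X.cover x hx
        exact Or.inr ⟨i, fun _ => p, contDiffOn_const, fun _ _ => ⟨hp, rfl⟩⟩
    · exact ((finite_singleton x).subset (by rintro _ ⟨s, _, rfl⟩; rfl)).inter_of_left _
  refine dist_le_of_speed_le hadm fun s _ => ?_
  by_cases hx : x ∈ X.reg
  · rw [speed_eq_regSpeed (ν := fun _ => ⟨x, hx⟩) (Eventually.of_forall fun _ => rfl),
      regSpeed_eq_zero mfderiv_const, ENNReal.ofReal_zero]
  · exact (speed_eq_zero hx).le

end CMGA

namespace ConicChart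

variable {n : ℕ} {M : Type*} [TopologicalSpace M] {X : CMGA n M}
  {C : ConicChart n X.reg X.metric}

/-! ### The metric in conic coordinates -/

variable (C) in
/-- The part `z ≠ 0` of the domain of conic coordinates. -/
def regDom : Set (Euc C.k × Euc C.m) := C.W ×ˢ (Metric.ball 0 C.R₀ \ {0})

theorem isOpen_dom : IsOpen C.dom := C.isOpen_W.prod Metric.isOpen_ball

theorem isOpen_regDom : IsOpen C.regDom :=
  C.isOpen_W.prod (Metric.isOpen_ball.sdiff isClosed_singleton)

theorem regDom_subset_dom : C.regDom ⊆ C.dom := prod_mono le_rfl sdiff_subset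

theorem mem_regDom_iff {p : Euc C.k × Euc C.m} : p ∈ C.regDom ↔ p ∈ C.dom ∧ p.2 ≠ 0 := by
  simp only [regDom, dom, mem_prod, Set.mem_sdiff, mem_singleton_iff, and_assoc, ne_eq]

theorem coe_regProj' {p : Euc C.k × Euc C.m} (hp : p ∈ C.regDom) :
    (C.regProj p : M) = C.proj p :=
  C.coe_regProj p (regDom_subset_dom hp) (mem_regDom_iff.1 hp).2

theorem contMDiffOn_regProj :
    ContMDiffOn 𝓘(ℝ, Euc C.k × Euc C.m) 𝓘(ℝ, Euc n) ∞ C.regProj C.regDom :=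
  C.isLocalDiffeomorphOn_regProj.contMDiffOn

theorem mdifferentiableAt_regProj {p : Euc C.k × Euc C.m} (hp : p ∈ C.regDom) :
    MDifferentiableAt 𝓘(ℝ, Euc C.k × Euc C.m) 𝓘(ℝ, Euc n) C.regProj p :=
  (contMDiffOn_regProj.contMDiffAt (isOpen_regDom.mem_nhds hp)).mdifferentiableAt (by simp)

theorem lift_self (p v : Euc C.k × Euc C.m) : C.lift p v v = X.normSq (C.regProj p)
    (mfderiv 𝓘(ℝ, Euc C.k × Euc C.m) 𝓘(ℝ, Euc n) C.regProj p v) :=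
  C.lift_eq p v v

theorem lift_add_left (p u v w : Euc C.k × Euc C.m) :
    C.lift p (u + v) w = C.lift p u w + C.lift p v w := by
  simp only [lift_eq]
  have h : (mfderiv 𝓘(ℝ, Euc C.k × Euc C.m) 𝓘(ℝ, Euc n) C.regProj p (u + v)) =
    mfderiv 𝓘(ℝ, Euc C.k × Euc C.m) 𝓘(ℝ, Euc n) C.regProj p u +
      mfderiv 𝓘(ℝ, Euc C.k × Euc C.m) 𝓘(ℝ, Euc n) C.regProj p v := map_add _ _ _
  rw [h, map_add]
  rfl

theorem lift_smul_left (p v w : Euc C.k × Euc C.m) (c : ℝ) :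
    C.lift p (c • v) w = c * C.lift p v w := by
  simp only [lift_eq]
  have h : (mfderiv 𝓘(ℝ, Euc C.k × Euc C.m) 𝓘(ℝ, Euc n) C.regProj p (c • v)) =
    c • mfderiv 𝓘(ℝ, Euc C.k × Euc C.m) 𝓘(ℝ, Euc n) C.regProj p v := map_smul _ _ _
  rw [h, map_smul]
  rfl

theorem lift_comm (p v w : Euc C.k × Euc C.m) : C.lift p v w = C.lift p w v := by
  simp only [lift_eq]
  exact X.metric.symm _ _ _

theorem lift_self_add (p v w : Euc C.k × Euc C.m) :
    C.lift p (v + w) (v + w) = C.lift p v v + 2 * C.lift p v w + C.lift p w w := by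
  rw [lift_add_left, lift_comm p v, lift_comm p w, lift_add_left, lift_add_left, lift_comm p w v]
  ring

theorem lift_self_smul (p v : Euc C.k × Euc C.m) (c : ℝ) :
    C.lift p (c • v) (c • v) = c ^ 2 * C.lift p v v := by
  rw [lift_smul_left, lift_comm, lift_smul_left]
  ring

theorem lift_self_nonneg (p v : Euc C.k × Euc C.m) : 0 ≤ C.lift p v v := by
  rw [lift_self]; exact CMGA.normSq_nonneg _ _

theorem lift_self_add_le (p v w : Euc C.k × Euc C.m) :
    C.lift p (v + w) (v + w) ≤ 2 * C.lift p v v + 2 * C.lift p w w := by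
  have h := lift_self_nonneg p (v + (-1 : ℝ) • w)
  rw [lift_self_add, lift_self_smul, lift_comm p v ((-1 : ℝ) • w), lift_smul_left,
    lift_comm p w v] at h
  rw [lift_self_add]
  linarith

theorem continuousAt_lift {p : Euc C.k × Euc C.m} (hp : p ∈ C.regDom) (v : Euc C.k × Euc C.m) :
    ContinuousAt (fun q : (Euc C.k × Euc C.m) × Euc C.k × Euc C.m => C.lift q.1 q.2 q.2)
      (p, v) := by
  have h := CMGA.continuousOn_metric_comp isOpen_regDom
    (contMDiffOn_regProj (C := C).of_le (by simp))
  have h2 : ContinuousAt _ (p, v, v) :=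
    h.continuousAt ((isOpen_regDom.prod isOpen_univ).mem_nhds ⟨hp, mem_univ _⟩)
  simp only [lift_eq]
  exact ContinuousAt.comp (f := fun q : (Euc C.k × Euc C.m) × Euc C.k × Euc C.m => (q.1, q.2, q.2))
    (x := (p, v)) h2 (by fun_prop)

theorem exists_unit_vector (m : ℕ) (hm : 2 ≤ m) : ∃ θ : Euc m, ‖θ‖ = 1 :=
  ⟨EuclideanSpace.single ⟨0, by omega⟩ 1, by simp⟩

variable (C) in
/-- The limit coefficients `â(y)` are locally bounded and locally uniformly positive definite, being
locally uniform limits of the continuous coefficients `a` at a fixed small radius `r`. -/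
theorem exists_aHat_bounds {y₀ : Euc C.k} (hy₀ : y₀ ∈ C.W) : ∃ a > 0, ∃ A, ∀ᶠ y in 𝓝 y₀, ∀ η,
    a * ‖η‖ ^ 2 ≤ C.aHat y η η ∧ C.aHat y η η ≤ A * ‖η‖ ^ 2 := by
  obtain ⟨θ, hθ⟩ := exists_unit_vector C.m C.two_le_m
  obtain ⟨R, hR, hRW⟩ := Metric.nhds_basis_closedBall.mem_iff.1 (C.isOpen_W.mem_nhds hy₀)
  have hcont : Continuous fun η => C.aHat y₀ η η := by
    have h1 := (C.aHat y₀).toContinuousBilinearMap.continuous₂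
    exact h1.comp (f := fun η => (η, η)) (by fun_prop)
  obtain ⟨a, ha, ha'⟩ : ∃ a > 0, ∀ η : Euc C.k, ‖η‖ = 1 → a ≤ C.aHat y₀ η η := by
    rcases (Metric.sphere (0 : Euc C.k) 1).eq_empty_or_nonempty with hemp | hne
    · refine ⟨1, one_pos, fun v hv => ?_⟩
      have : v ∈ Metric.sphere (0 : Euc C.k) 1 := by simpa using hv
      rw [hemp] at this
      exact this.elim
    · obtain ⟨w, hw, hmin⟩ := (isCompact_sphere (0 : Euc C.k) 1).exists_isMinOn hne
        hcont.continuousOn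
      refine ⟨_, C.aHat_pos y₀ hy₀ w (by rintro rfl; simp at hw), fun v hv => ?_⟩
      exact hmin (show v ∈ Metric.sphere (0 : Euc C.k) 1 by simpa using hv)
  obtain ⟨A, hA⟩ := (isCompact_sphere (0 : Euc C.k) 1).exists_bound_of_continuousOn
    hcont.continuousOn
  obtain ⟨δ, hδ, hlim⟩ := C.lift_limit _ hRW (isCompact_closedBall _ _) (a / 8) (by positivity)
  set r := min C.R₀ δ / 2 with hr
  have hr0 : 0 < r := by have := lt_min C.R₀_pos hδ; positivity
  have hrR : r < C.R₀ := by
    have := min_le_left C.R₀ δ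
    linarith [C.R₀_pos]
  have hrδ : r < δ := by
    have := min_le_right C.R₀ δ
    linarith
  have hl : ∀ y ∈ Metric.closedBall y₀ R, ∀ η : Euc C.k,
      |C.lift (y, r • θ) (η, 0) (η, 0) - C.aHat y η η| ≤ a / 8 * ‖η‖ ^ 2 := by
    intro y hy η
    refine ((hlim y hy θ hθ r hr0 hrR hrδ η η 0 0 (by simp) (by simp)).1).trans (le_of_eq ?_)
    ring
  have hp : (y₀, r • θ) ∈ C.regDom := by
    refine ⟨hy₀, ?_, ?_⟩
    · simp [norm_smul, hθ, abs_of_pos hr0, hrR]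
    · have : θ ≠ 0 := by rintro rfl; simp at hθ
      simp [hr0.ne', this]
  have hQ : ∀ v : Euc C.k, ContinuousAt
      (fun q : Euc C.k × Euc C.k => C.lift (q.1, r • θ) (q.2, 0) (q.2, 0)) (y₀, v) := fun v =>
    ContinuousAt.comp (f := fun q : Euc C.k × Euc C.k => ((q.1, r • θ), (q.2, (0 : Euc C.m))))
      (x := (y₀, v)) (continuousAt_lift hp (v, 0)) (by fun_prop)
  have hsm : ∀ (y : Euc C.k) (c : ℝ) (v : Euc C.k), C.lift (y, r • θ) (c • v, 0) (c • v, 0) =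
      c ^ 2 * C.lift (y, r • θ) (v, 0) (v, 0) := fun y c v => by
    rw [← lift_self_smul]; simp
  have e1 := eventually_forall_lt_mul_norm_sq (p₀ := y₀) (B := A + a)
    (Q := fun y η => C.lift (y, r • θ) (η, 0) (η, 0)) hsm (fun v _ => hQ v) fun v hv => by
      have h1 := (abs_le.1 (hl y₀ (Metric.mem_closedBall_self hR.le) v)).2
      have h2 := hA v (by simpa using hv)
      rw [Real.norm_eq_abs] at h2
      rw [hv] at h1
      linarith [le_abs_self (C.aHat y₀ v v)]
  have e2 := eventually_forall_lt_mul_norm_sq (p₀ := y₀) (B := -(a / 2))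
    (Q := fun y η => -C.lift (y, r • θ) (η, 0) (η, 0)) (fun y c v => by rw [hsm]; ring)
    (fun v _ => (hQ v).neg) fun v hv => by
      have h1 := (abs_le.1 (hl y₀ (Metric.mem_closedBall_self hR.le) v)).1
      have h2 := ha' v hv
      rw [hv] at h1
      linarith
  refine ⟨a / 4, by positivity, A + 2 * a, ?_⟩
  filter_upwards [e1, e2, Metric.closedBall_mem_nhds y₀ hR] with y h1 h2 hy η
  have h3 := abs_le.1 (hl y hy η)
  have h1 := h1 η
  have h2 := h2 η
  constructor <;> nlinarith [sq_nonneg ‖η‖]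

variable (C) in
/-- Near the singular stratum the lifted metric is comparable, from below, to the euclidean metric,
and from above on the `y` directions. -/
theorem exists_lift_bounds {y₀ : Euc C.k} (hy₀ : y₀ ∈ C.W) : ∃ K > 0, ∃ δ > 0, δ ≤ C.R₀ ∧
    Metric.ball y₀ δ ⊆ C.W ∧ ∀ y ∈ Metric.ball y₀ δ, ∀ z : Euc C.m, z ≠ 0 → ‖z‖ < δ → ∀ η ζ,
      ‖η‖ ^ 2 + ‖ζ‖ ^ 2 ≤ K * C.lift (y, z) (η, ζ) (η, ζ) ∧
      C.lift (y, z) (η, 0) (η, 0) ≤ K * ‖η‖ ^ 2 := by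
  obtain ⟨a, ha, A, hA⟩ := C.exists_aHat_bounds hy₀
  obtain ⟨R, hR, hRW⟩ := Metric.nhds_basis_closedBall.mem_iff.1 (C.isOpen_W.mem_nhds hy₀)
  obtain ⟨ρ, hρ, hAρ⟩ := Metric.eventually_nhds_iff_ball.1 hA
  obtain ⟨c₀, hc₀, c₁, -, T, hb⟩ := C.bHat_bounds
  set c := min a (min c₀ 1) with hc
  have hc0 : 0 < c := lt_min ha (lt_min hc₀ one_pos)
  have hca : c ≤ a := min_le_left _ _
  have hcc : c ≤ c₀ := (min_le_right _ _).trans (min_le_left _ _)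
  have hc1 : c ≤ 1 := (min_le_right _ _).trans (min_le_right _ _)
  obtain ⟨δ, hδ, hlim⟩ := C.lift_limit _ hRW (isCompact_closedBall _ _) (c / 4) (by positivity)
  refine ⟨max (2 / c) (A + 1), lt_max_of_lt_left (by positivity), min (min R ρ) (min C.R₀ δ),
    lt_min (lt_min hR hρ) (lt_min C.R₀_pos hδ), (min_le_right _ _).trans (min_le_left _ _), ?_, ?_⟩
  · exact (Metric.ball_subset_ball ((min_le_left _ _).trans (min_le_left _ _))).trans
      (Metric.ball_subset_closedBall.trans hRW)
  intro y hy z hz hzδ η ζ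
  have hyR : y ∈ Metric.closedBall y₀ R := Metric.ball_subset_closedBall
    (Metric.ball_subset_ball ((min_le_left _ _).trans (min_le_left _ _)) hy)
  have hyρ : y ∈ Metric.ball y₀ ρ :=
    Metric.ball_subset_ball ((min_le_left _ _).trans (min_le_right _ _)) hy
  have hzR : ‖z‖ < C.R₀ := hzδ.trans_le ((min_le_right _ _).trans (min_le_left _ _))
  have hzδ' : ‖z‖ < δ := hzδ.trans_le ((min_le_right _ _).trans (min_le_right _ _))
  have hr0 : 0 < ‖z‖ := norm_pos_iff.2 hz
  set θ : Euc C.m := ‖z‖⁻¹ • z with hθ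
  have hθ1 : ‖θ‖ = 1 := by simp [hθ, norm_smul, hr0.ne']
  have hzθ : ‖z‖ • θ = z := by simp [hθ, smul_smul, hr0.ne']
  have hlimz : ∀ (η η' : Euc C.k) (ζ ζ' : Euc C.m), inner ℝ θ ζ = 0 → inner ℝ θ ζ' = 0 →
      |C.lift (y, z) (η, 0) (η', 0) - C.aHat y η η'| ≤ c / 4 * ‖η‖ * ‖η'‖ ∧
      |C.lift (y, z) (0, ζ) (0, ζ') - C.bHat y θ ζ ζ'| ≤ c / 4 * ‖ζ‖ * ‖ζ'‖ ∧
      |C.lift (y, z) (η, 0) (0, ζ)| ≤ c / 4 * ‖η‖ * ‖ζ‖ := by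
    have := hlim y hyR θ hθ1 ‖z‖ hr0 hzR hzδ'
    rwa [hzθ] at this
  obtain ⟨ha1, ha2⟩ := hAρ y hyρ η
  -- the decomposition of `ζ` into its radial and spherical parts
  set t : ℝ := inner ℝ θ ζ with ht
  set ζ' : Euc C.m := ζ - t • θ with hζ'
  have hperp : inner ℝ θ ζ' = 0 := by
    rw [hζ', inner_sub_right, inner_smul_right, real_inner_self_eq_norm_sq, hθ1, ← ht]; ring
  have hζnorm : ‖ζ‖ ^ 2 = t ^ 2 + ‖ζ'‖ ^ 2 := by
    have h1 : ζ = ζ' + t • θ := by rw [hζ']; abel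
    rw [h1, norm_add_sq_real, inner_smul_right, real_inner_comm, hperp, norm_smul, hθ1]
    simp [sq_abs]
    ring
  have hrad : ∀ v : Euc C.k × Euc C.m, C.lift (y, z) (0, θ) v = inner ℝ θ v.2 := by
    rintro ⟨η', ξ⟩
    have h1 := C.lift_radial y (hRW hyR) z (by simpa using hzR) hz η' ξ
    have h2 : ((0 : Euc C.k), θ) = ‖z‖⁻¹ • ((0 : Euc C.k), z) := by simp [hθ]
    rw [h2, lift_smul_left, h1, hθ, inner_smul_left]
    simp
  obtain ⟨l1, l2, l3⟩ := hlimz η η ζ' ζ' hperp hperp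
  have hb1 := ((hb y (hRW hyR)).2.2 θ hθ1 ζ' hperp).1
  have hdec : C.lift (y, z) (η, ζ) (η, ζ) = t ^ 2 + (C.lift (y, z) (η, 0) (η, 0) +
      2 * C.lift (y, z) (η, 0) (0, ζ') + C.lift (y, z) (0, ζ') (0, ζ')) := by
    have h1 : ((η, ζ) : Euc C.k × Euc C.m) = t • (0, θ) + ((η, 0) + (0, ζ')) := by
      simp [hζ']
    rw [h1, lift_self_add, lift_self_smul, lift_smul_left, hrad, hrad, lift_self_add]
    simp [hperp, hθ1]
  have n1 := abs_le.1 l1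
  have n2 := abs_le.1 l2
  have n3 := abs_le.1 l3
  have hlow : c / 2 * (‖η‖ ^ 2 + ‖ζ‖ ^ 2) ≤ C.lift (y, z) (η, ζ) (η, ζ) := by
    rw [hdec, hζnorm]
    have q1 : c * ‖η‖ ^ 2 ≤ a * ‖η‖ ^ 2 := by gcongr
    have q2 : c * ‖ζ'‖ ^ 2 ≤ c₀ * ‖ζ'‖ ^ 2 := by gcongr
    have q3 : c * t ^ 2 ≤ 1 * t ^ 2 := by gcongr
    have q4 : 0 ≤ c * (‖η‖ - ‖ζ'‖) ^ 2 := by positivity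
    have q5 : 0 ≤ c * t ^ 2 := by positivity
    nlinarith
  constructor
  · calc ‖η‖ ^ 2 + ‖ζ‖ ^ 2 = 2 / c * (c / 2 * (‖η‖ ^ 2 + ‖ζ‖ ^ 2)) := by field_simp
      _ ≤ 2 / c * C.lift (y, z) (η, ζ) (η, ζ) := by gcongr
      _ ≤ _ := mul_le_mul_of_nonneg_right (le_max_left _ _) (lift_self_nonneg _ _)
  · refine le_trans ?_ (mul_le_mul_of_nonneg_right (le_max_right (2 / c) (A + 1)) (sq_nonneg _))
    nlinarith [sq_nonneg ‖η‖]

end ConicChart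

namespace CMGA

variable {n : ℕ} {M : Type*} [TopologicalSpace M] {X : CMGA n M}

/-! ### The distance function -/

/-- A coordinate segment with speed at most `L` bounds the distance of its end points. -/
theorem dist_chart_symm_le {e : OpenPartialHomeomorph X.reg (Euc n)}
    (he : e ∈ atlas (Euc n) X.reg) {a w : Euc n} (hmem : ∀ s ∈ Icc (0 : ℝ) 1, a + s • w ∈ e.target)
    {L : ℝ} (hL : ∀ s ∈ Icc (0 : ℝ) 1, √(X.normSq (e.symm (a + s • w))
      (mfderiv 𝓘(ℝ, Euc n) 𝓘(ℝ, Euc n) e.symm (a + s • w) w)) ≤ L) :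
    X.dist (e.symm a : X.reg) (e.symm (a + w) : X.reg) ≤ ENNReal.ofReal L := by
  set γ : ℝ → Euc n := fun s => a + s • w with hγ
  have hadm : X.IsAdmissiblePath (fun s => (e.symm (γ s) : M)) (e.symm a : X.reg)
      (e.symm (a + w) : X.reg) := by
    refine ⟨by simp [hγ], by simp [hγ],
      ⟨1, fun j => j, by simp, by simp, fun j hj => ⟨by push_cast; linarith, Or.inl
        ⟨fun s => e.symm (γ s), ?_, fun _ _ => rfl⟩⟩⟩, ?_⟩
    · have hj0 : j = 0 := by omega
      have h1 : ContDiff ℝ 1 γ := by fun_prop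
      refine ((contMDiffOn_chart_symm he).of_le (by simp)).comp h1.contMDiff.contMDiffOn ?_
      rintro s hs
      refine hmem s ?_
      simpa [hj0] using hs
    · convert finite_empty
      rw [eq_empty_iff_forall_notMem]
      rintro _ ⟨⟨s, -, rfl⟩, h⟩
      exact h (e.symm (γ s)).2
  refine dist_le_of_speed_le hadm fun s hs => ?_
  rw [speed_eq_regSpeed (ν := fun s => e.symm (γ s)) (Eventually.of_forall fun _ => rfl),
    regSpeed_comp (γ := γ) (v := w)
      (mdifferentiableAt_chart_symm he (hmem s (Ioo_subset_Icc_self hs)))]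
  · exact ENNReal.ofReal_le_ofReal (hL s (Ioo_subset_Icc_self hs))
  · have := ((hasDerivAt_id s).smul_const w).const_add a
    rwa [one_smul] at this

/-- Regular points near a singular point `x` are at a small distance from `x`: the straight line in
the lifted coordinates from the centre `(y₀, 0)` is singular at its starting point only, and its
speed is controlled by `exists_lift_bounds` in the `y` directions and by `dr²` in the radial one.
-/
theorem eventually_dist_le {x : M} (hx : x ∉ X.reg) {ε : ℝ} (hε : 0 < ε) :
    ∀ᶠ y in 𝓝 x, y ∈ X.reg → X.dist x y ≤ ENNReal.ofReal ε := by
  obtain ⟨i, ⟨y₀, z₀⟩, hp, rfl⟩ := X.cover x hx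
  let C : ConicChart n X.reg X.metric := X.chart i
  have hz₀ : z₀ = 0 := by
    by_contra h
    exact hx (((X.chart i).proj_mem_reg_iff _ hp).2 h)
  subst hz₀
  obtain ⟨K, hK, δ, hδ, hδR, hδW, hlow⟩ := C.exists_lift_bounds hp.1
  set ρ := min δ (ε / (2 * √(K + 1))) with hρ
  have hρ0 : 0 < ρ := lt_min hδ (by positivity)
  set V : Set (Euc C.k × Euc C.m) := Metric.ball y₀ ρ ×ˢ Metric.ball 0 ρ
  have hVsub : V ⊆ C.dom := Set.prod_mono
    ((Metric.ball_subset_ball (min_le_left _ _)).trans hδW)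
    (Metric.ball_subset_ball ((min_le_left _ _).trans hδR))
  have hV : C.proj '' V ∈ 𝓝 (C.proj (y₀, 0)) :=
    (C.isOpen_image V hVsub (Metric.isOpen_ball.prod Metric.isOpen_ball)).mem_nhds
      ⟨_, ⟨Metric.mem_ball_self hρ0, Metric.mem_ball_self hρ0⟩, rfl⟩
  filter_upwards [hV]
  rintro _ ⟨⟨y, z⟩, hyz, rfl⟩ hreg
  have hz : z ≠ 0 := (C.proj_mem_reg_iff _ (hVsub hyz)).1 hreg
  set η := y - y₀ with hη
  have hηρ : ‖η‖ < ρ := mem_ball_iff_norm.1 hyz.1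
  have hzρ : ‖z‖ < ρ := by simpa using hyz.2
  set γ : ℝ → Euc C.k × Euc C.m := fun s => (y₀ + s • η, s • z) with hγ
  have hy1 : y₀ + η = y := by simp [hη]
  have hmem : ∀ s ∈ Icc (0 : ℝ) 1, γ s ∈ V := by
    intro s hs
    have hs' : |s| ≤ 1 := abs_le.2 ⟨by linarith [hs.1], hs.2⟩
    constructor
    · simp only [hγ, mem_ball_iff_norm, add_sub_cancel_left, norm_smul, Real.norm_eq_abs]
      nlinarith [norm_nonneg η]
    · simp only [hγ, mem_ball_iff_norm, sub_zero, norm_smul, Real.norm_eq_abs]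
      nlinarith [norm_nonneg z]
  have hreg_mem : ∀ s ∈ Ioc (0 : ℝ) 1, γ s ∈ C.regDom := fun s hs =>
    ConicChart.mem_regDom_iff.2 ⟨hVsub (hmem s (Ioc_subset_Icc_self hs)),
      smul_ne_zero hs.1.ne' hz⟩
  have hadm : X.IsAdmissiblePath (fun s => C.proj (γ s)) (C.proj (y₀, 0)) (C.proj (y, z)) := by
    refine ⟨by simp [hγ], by simp [hγ, hy1],
      ⟨1, fun j => j, by simp, by simp, fun j hj => ⟨by push_cast; linarith, Or.inr
        ⟨i, γ, ?_, fun s hs => ⟨hVsub (hmem s ?_), rfl⟩⟩⟩⟩, ?_⟩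
    · exact ContDiff.contDiffOn (by fun_prop)
    · have hj0 : j = 0 := by omega
      simpa [hj0] using hs
    · refine (finite_singleton (C.proj (γ 0))).subset ?_
      rintro _ ⟨⟨s, hs, rfl⟩, h⟩
      rcases hs.1.eq_or_lt with rfl | h0
      · rfl
      · refine (h ?_).elim
        have := hreg_mem s ⟨h0, hs.2⟩
        change C.proj (γ s) ∈ X.reg
        rw [← ConicChart.coe_regProj' this]
        exact (C.regProj (γ s)).2
  refine dist_le_of_speed_le hadm fun s hs => ?_
  have hev : ∀ᶠ t in 𝓝 s, (C.regProj (γ t) : M) = C.proj (γ t) := by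
    filter_upwards [isOpen_Ioo.mem_nhds hs] with t ht
    exact ConicChart.coe_regProj' (hreg_mem t ⟨ht.1, ht.2.le⟩)
  have hder : HasDerivAt γ (η, z) s := by
    have h1 : HasDerivAt (fun s : ℝ => y₀ + s • η) η s := by
      simpa using ((hasDerivAt_id s).smul_const η).const_add y₀
    have h2 : HasDerivAt (fun s : ℝ => s • z) z s := by
      simpa using (hasDerivAt_id s).smul_const z
    exact h1.prodMk h2
  have hsr := hreg_mem s ⟨hs.1, hs.2.le⟩
  rw [speed_eq_regSpeed (ν := fun t => C.regProj (γ t)) hev,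
    regSpeed_comp (γ := γ) (ConicChart.mdifferentiableAt_regProj hsr) hder]
  refine ENNReal.ofReal_le_ofReal ?_
  have hbd : C.lift (γ s) (η, z) (η, z) ≤ ε ^ 2 := by
    have h1 : ((η, z) : Euc C.k × Euc C.m) = (η, 0) + (0, z) := by simp
    have hsz : s • z ≠ 0 := hsr.2.2
    have hm := hmem s (Ioo_subset_Icc_self hs)
    have h2 : C.lift (γ s) (η, 0) (η, 0) ≤ K * ‖η‖ ^ 2 := by
      refine (hlow (y₀ + s • η) (Metric.ball_subset_ball (min_le_left _ _) hm.1) (s • z) hsz ?_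
        η 0).2
      have : ‖s • z‖ < ρ := by simpa using hm.2
      exact this.trans_le (min_le_left _ _)
    have h3 : C.lift (γ s) (0, z) (0, z) = ‖z‖ ^ 2 := by
      have e1 : ((0 : Euc C.k), s • z) = s • ((0 : Euc C.k), z) := by simp
      have h4 := C.lift_radial (y₀ + s • η) hsr.1 (s • z) hsr.2.1 hsz 0 z
      rw [e1, ConicChart.lift_smul_left, inner_smul_left, real_inner_self_eq_norm_sq] at h4
      exact mul_left_cancel₀ hs.1.ne' h4
    have h5 := ConicChart.lift_self_add_le (C := C) (γ s) (η, 0) (0, z)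
    rw [← h1] at h5
    have h6 : ρ ^ 2 * (4 * (K + 1)) ≤ ε ^ 2 := by
      have h7 : ρ * (2 * √(K + 1)) ≤ ε := (le_div_iff₀ (by positivity)).1 (min_le_right _ _)
      have h8 : (ρ * (2 * √(K + 1))) ^ 2 ≤ ε ^ 2 := by gcongr
      rw [mul_pow, mul_pow, Real.sq_sqrt (by linarith)] at h8
      linarith
    have h9 : ‖η‖ ^ 2 ≤ ρ ^ 2 := by gcongr
    have h10 : ‖z‖ ^ 2 ≤ ρ ^ 2 := by gcongr
    nlinarith
  rw [← ConicChart.lift_self]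
  exact Real.sqrt_le_iff.2 ⟨hε.le, hbd⟩

variable (X) in
/-- The distance from the set `W`, cut off at `R`, and thereby finite. -/
noncomputable def truncDist (W : Set M) (R : ℝ) (x : M) : ℝ :=
  (min (⨅ w ∈ W, X.dist x w) (ENNReal.ofReal R)).toReal

variable {W : Set M} {R : ℝ}

theorem truncDist_nonneg (x : M) : 0 ≤ X.truncDist W R x := ENNReal.toReal_nonneg

theorem truncDist_le (hR : 0 ≤ R) (x : M) : X.truncDist W R x ≤ R :=
  ENNReal.toReal_le_of_le_ofReal hR (min_le_right _ _)

theorem truncDist_eq_zero {x : M} (hx : x ∈ W) : X.truncDist W R x = 0 := by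
  have : ⨅ w ∈ W, X.dist x w = 0 := le_antisymm ((iInf₂_le x hx).trans (dist_self x).le) zero_le
  rw [truncDist, this, zero_min, ENNReal.toReal_zero]

theorem truncDist_le_add {x y : M} {L : ℝ} (hL : 0 ≤ L) (h : X.dist x y ≤ ENNReal.ofReal L) :
    X.truncDist W R x ≤ L + X.truncDist W R y := by
  have h1 : ⨅ w ∈ W, X.dist x w ≤ ENNReal.ofReal L + ⨅ w ∈ W, X.dist y w := by
    simp only [ENNReal.add_iInf]
    exact iInf₂_mono fun w _ => (dist_triangle x y w).trans (by gcongr)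
  have h2 : min (⨅ w ∈ W, X.dist x w) (ENNReal.ofReal R) ≤
      ENNReal.ofReal L + min (⨅ w ∈ W, X.dist y w) (ENNReal.ofReal R) := by
    rw [← min_add_add_left]
    exact min_le_min h1 le_add_self
  have h3 : min (⨅ w ∈ W, X.dist y w) (ENNReal.ofReal R) ≠ ⊤ :=
    ((min_le_right _ _).trans_lt ENNReal.ofReal_lt_top).ne
  have h4 := ENNReal.toReal_mono (ENNReal.add_ne_top.2 ⟨ENNReal.ofReal_ne_top, h3⟩) h2
  rwa [ENNReal.toReal_add ENNReal.ofReal_ne_top h3, ENNReal.toReal_ofReal hL] at h4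

theorem le_truncDist_of_notMem {x : M} {T : ℝ} (hTR : T ≤ R)
    (hx : x ∉ X.domainOfInfluence W T) : T ≤ X.truncDist W R x := by
  have h1 : ENNReal.ofReal T ≤ ⨅ w ∈ W, X.dist x w := not_lt.1 hx
  have h2 : min (⨅ w ∈ W, X.dist x w) (ENNReal.ofReal R) ≠ ⊤ :=
    ((min_le_right _ _).trans_lt ENNReal.ofReal_lt_top).ne
  rw [truncDist, ← ENNReal.ofReal_le_iff_le_toReal h2]
  exact le_min h1 (ENNReal.ofReal_le_ofReal hTR)

theorem abs_truncDist_sub_le {e : OpenPartialHomeomorph X.reg (Euc n)}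
    (he : e ∈ atlas (Euc n) X.reg) {a w : Euc n} (hmem : ∀ s ∈ Icc (0 : ℝ) 1, a + s • w ∈ e.target)
    {L : ℝ} (hL : ∀ s ∈ Icc (0 : ℝ) 1, √(X.normSq (e.symm (a + s • w))
      (mfderiv 𝓘(ℝ, Euc n) 𝓘(ℝ, Euc n) e.symm (a + s • w) w)) ≤ L) :
    |X.truncDist W R (e.symm (a + w) : X.reg) - X.truncDist W R (e.symm a : X.reg)| ≤ L := by
  have hL0 : 0 ≤ L := (Real.sqrt_nonneg _).trans (hL 0 (by simp))
  have h1 := dist_chart_symm_le he hmem hL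
  -- the reversed segment gives the opposite inequality
  have hrev : ∀ s : ℝ, a + w + s • -w = a + (1 - s) • w := fun s => by
    rw [sub_smul, one_smul, smul_neg]; abel
  have hs' : ∀ s ∈ Icc (0 : ℝ) 1, 1 - s ∈ Icc (0 : ℝ) 1 := fun s hs =>
    ⟨by linarith [hs.2], by linarith [hs.1]⟩
  have h2 := dist_chart_symm_le he (a := a + w) (w := -w) (L := L)
    (fun s hs => by rw [hrev]; exact hmem _ (hs' s hs)) fun s hs => by
      have h3 : X.normSq (e.symm (a + w + s • -w))
          (mfderiv 𝓘(ℝ, Euc n) 𝓘(ℝ, Euc n) e.symm (a + w + s • -w) (-w)) =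
          X.normSq (e.symm (a + (1 - s) • w))
          (mfderiv 𝓘(ℝ, Euc n) 𝓘(ℝ, Euc n) e.symm (a + (1 - s) • w) w) := by
        rw [hrev]
        have := normSq_chart_symm_smul (X := X) (e := e) (a + (1 - s) • w) (-1) w
        simpa using this
      rw [h3]
      exact hL _ (hs' s hs)
  rw [add_neg_cancel_right] at h2
  rw [abs_le]
  constructor <;> linarith [truncDist_le_add (W := W) (R := R) hL0 h1,
    truncDist_le_add (W := W) (R := R) hL0 h2]

theorem isLocLip_truncDist : X.IsLocLip (X.truncDist W R) := by
  intro e he a ha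
  obtain ⟨C, hC, hC'⟩ := exists_eventually_normSq_le he ha
  obtain ⟨r, hr, hball⟩ := Metric.eventually_nhds_iff_ball.1
    (hC'.and (e.open_target.mem_nhds ha))
  refine ⟨(√C).toNNReal, Metric.ball a r, mem_nhdsWithin_of_mem_nhds (Metric.ball_mem_nhds a hr),
    LipschitzOnWith.of_dist_le_mul fun b hb c hc => ?_⟩
  have hseg : ∀ s ∈ Icc (0 : ℝ) 1, c + s • (b - c) ∈ Metric.ball a r := fun s hs =>
    (convex_ball a r).add_smul_sub_mem hc hb hs
  have h1 := abs_truncDist_sub_le (W := W) (R := R) he (a := c) (w := b - c)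
    (L := √C * ‖b - c‖) (fun s hs => (hball _ (hseg s hs)).2) fun s hs => by
      refine (Real.sqrt_le_sqrt ((hball _ (hseg s hs)).1 (b - c))).trans (le_of_eq ?_)
      rw [Real.sqrt_mul hC.le, Real.sqrt_sq (norm_nonneg _)]
  rw [add_sub_cancel] at h1
  rw [Real.dist_eq, dist_eq_norm, Real.coe_toNNReal _ (Real.sqrt_nonneg C)]
  exact h1

/-- The truncated distance has gradient at most one: it is Lipschitz along short coordinate
segments, with a constant close to their `g`-length. -/
theorem abs_diff_truncDist_le (x : X.reg) (v : TangentSpace 𝓘(ℝ, Euc n) x) :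
    |X.diff (X.truncDist W R) x v| ≤ √(X.normSq x v) := by
  by_cases h : MDifferentiableAt 𝓘(ℝ, Euc n) 𝓘(ℝ, ℝ) (fun y : X.reg => X.truncDist W R y) x
  swap
  · have h3 : X.diff (X.truncDist W R) x v = 0 :=
      congrArg (fun A : Euc n →L[ℝ] ℝ => A v) (mfderiv_zero_of_not_mdifferentiableAt h)
    rw [h3, abs_zero]
    exact Real.sqrt_nonneg _
  set e := chartAt (Euc n) x
  have he : e ∈ atlas (Euc n) X.reg := chart_mem_atlas _ x
  have hx : x ∈ e.source := mem_chart_source _ x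
  set a := e x
  have ha : a ∈ e.target := e.map_source hx
  set w : Euc n := mfderiv 𝓘(ℝ, Euc n) 𝓘(ℝ, Euc n) e x v
  set f : Euc n → ℝ := fun b => X.truncDist W R (e.symm b : X.reg)
  have hdf : DifferentiableAt ℝ f a := by
    have h1 : MDifferentiableAt 𝓘(ℝ, Euc n) 𝓘(ℝ, ℝ) (fun y : X.reg => X.truncDist W R y)
      (e.symm a) := by rwa [e.left_inv hx]
    exact (h1.comp a (mdifferentiableAt_chart_symm he ha)).differentiableAt
  set G : Euc n → ℝ := fun b => √(X.normSq (e.symm b)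
    (mfderiv 𝓘(ℝ, Euc n) 𝓘(ℝ, Euc n) e.symm b w))
  have hG : ContinuousAt G a := by
    have h1 := ContinuousAt.comp (f := fun b : Euc n => (b, w)) (x := a)
      (continuousAt_normSq_chart_symm he ha w) (by fun_prop)
    exact h1.sqrt
  have key : |fderiv ℝ f a w| ≤ G a := by
    refine le_of_forall_pos_le_add fun ε hε => ?_
    have h1 : ∀ᶠ b in 𝓝 a, G b < G a + ε ∧ b ∈ e.target :=
      (hG.eventually (gt_mem_nhds (by linarith))).and (e.open_target.mem_nhds ha)
    have h2 : Tendsto (fun s : ℝ => a + s • w) (𝓝 0) (𝓝 a) := by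
      have : Continuous fun s : ℝ => a + s • w := by fun_prop
      simpa using this.tendsto 0
    obtain ⟨r, hr, hball⟩ := Metric.eventually_nhds_iff_ball.1 (h2.eventually h1)
    have hder : HasDerivAt (fun s : ℝ => f (a + s • w)) (fderiv ℝ f a w) 0 := by
      have h3 : HasDerivAt (fun s : ℝ => a + s • w) w 0 := by
        simpa using ((hasDerivAt_id (0 : ℝ)).smul_const w).const_add a
      have h4 : HasFDerivAt f (fderiv ℝ f a) (a + (0 : ℝ) • w) := by
        simpa using hdf.hasFDerivAt
      exact h4.comp_hasDerivAt 0 h3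
    refine hder.le_of_lip' (add_nonneg (Real.sqrt_nonneg _) hε.le) ?_
    filter_upwards [Metric.ball_mem_nhds (0 : ℝ) hr] with s hs
    have hin : ∀ t ∈ Icc (0 : ℝ) 1, t * s ∈ Metric.ball (0 : ℝ) r := fun t ht => by
      rw [mem_ball_zero_iff, Real.norm_eq_abs] at hs ⊢
      rw [abs_mul, abs_of_nonneg ht.1]
      nlinarith [abs_nonneg s, ht.2]
    have h5 := abs_truncDist_sub_le (W := W) (R := R) he (a := a) (w := s • w)
      (L := (G a + ε) * |s|)
      (fun t ht => by rw [smul_smul]; exact (hball _ (hin t ht)).2) fun t ht => by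
        rw [smul_smul, normSq_chart_symm_smul, Real.sqrt_mul (sq_nonneg s), Real.sqrt_sq_eq_abs,
          mul_comm]
        gcongr
        exact (hball _ (hin t ht)).1.le
    simpa [Real.norm_eq_abs] using h5
  -- transport of the estimate from `e.symm a` to `x`
  have main : ∀ y : X.reg, y = x → |X.diff (X.truncDist W R) y v| ≤ √(X.normSq y v) := by
    intro y hy
    have h4 : y = e.symm a := by rw [hy, e.left_inv hx]
    subst h4
    have h5 := diff_chart_symm he ha hdf w
    have h7 := mfderiv_chart_symm_mfderiv_chart he hx v
    have h8 : X.diff (X.truncDist W R) (e.symm a) v = fderiv ℝ f a w := by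
      rw [← h5]
      exact congrArg (fun u : Euc n => (X.diff (X.truncDist W R) (e.symm a) : Euc n →L[ℝ] ℝ) u)
        h7.symm
    have h9 : X.normSq (e.symm a) v = X.normSq (e.symm a)
        (mfderiv 𝓘(ℝ, Euc n) 𝓘(ℝ, Euc n) e.symm a w) :=
      congrArg (fun u : Euc n => X.normSq (e.symm a) u) h7.symm
    rw [h8, h9]
    exact key
  exact main x rfl

end CMGA

namespace CMGA

variable {n : ℕ} {M : Type*} [TopologicalSpace M] {X : CMGA n M}

/-! ### Cutoff functions -/

variable (X) in
/-- `φ` is a bounded nonnegative function on `M` supported in `W`, continuously differentiable on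
the regular part, with bounded gradient. -/
structure IsBump (W : Set M) (φ : M → ℝ) : Prop where
  contMDiff : ContMDiff 𝓘(ℝ, Euc n) 𝓘(ℝ, ℝ) 1 fun y : X.reg => φ y
  nonneg : ∀ x, 0 ≤ φ x
  exists_le : ∃ B, ∀ x, φ x ≤ B
  exists_abs_diff_le : ∃ C, ∀ x v, |X.diff φ x v| ≤ C * √(X.normSq x v)
  exists_isClosed : ∃ F, IsClosed F ∧ F ⊆ W ∧ ∀ x ∉ F, φ x = 0

theorem mdifferentiableAt_of_contMDiff {φ : M → ℝ}
    (h : ContMDiff 𝓘(ℝ, Euc n) 𝓘(ℝ, ℝ) 1 fun y : X.reg => φ y) (x : X.reg) :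
    MDifferentiableAt 𝓘(ℝ, Euc n) 𝓘(ℝ, ℝ) (fun y : X.reg => φ y) x :=
  h.mdifferentiableAt (by simp)

theorem diff_congr {φ ψ : M → ℝ} {x : X.reg} (h : ∀ᶠ y in 𝓝 x, φ (y : X.reg) = ψ y)
    (v : TangentSpace 𝓘(ℝ, Euc n) x) : X.diff φ x v = X.diff ψ x v := by
  have h1 := Filter.EventuallyEq.mfderiv_eq (I := 𝓘(ℝ, Euc n)) (I' := 𝓘(ℝ, ℝ)) h
  exact congrArg (fun A : Euc n →L[ℝ] ℝ => A v) h1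

theorem diff_add {φ ψ : M → ℝ} {x : X.reg}
    (hφ : MDifferentiableAt 𝓘(ℝ, Euc n) 𝓘(ℝ, ℝ) (fun y : X.reg => φ y) x)
    (hψ : MDifferentiableAt 𝓘(ℝ, Euc n) 𝓘(ℝ, ℝ) (fun y : X.reg => ψ y) x)
    (v : TangentSpace 𝓘(ℝ, Euc n) x) :
    X.diff (fun y => φ y + ψ y) x v = X.diff φ x v + X.diff ψ x v := by
  have h := (hφ.hasMFDerivAt.add hψ.hasMFDerivAt).mfderiv
  exact congrArg (fun A : Euc n →L[ℝ] ℝ => A v) h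

theorem diff_comp {φ : M → ℝ} {x : X.reg} {g : ℝ → ℝ}
    (hφ : MDifferentiableAt 𝓘(ℝ, Euc n) 𝓘(ℝ, ℝ) (fun y : X.reg => φ y) x)
    (hg : DifferentiableAt ℝ g (φ x)) (v : TangentSpace 𝓘(ℝ, Euc n) x) :
    X.diff (fun y => g (φ y)) x v = X.diff φ x v * deriv g (φ x) := by
  have h2 := HasMFDerivAt.comp x (g := g) (f := fun y : X.reg => φ y)
    hg.hasDerivAt.hasFDerivAt.hasMFDerivAt hφ.hasMFDerivAt
  exact congrArg (fun A : Euc n →L[ℝ] ℝ => A v) h2.mfderiv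

theorem IsBump.zero (W : Set M) : X.IsBump W fun _ => 0 where
  contMDiff := contMDiff_const
  nonneg _ := le_rfl
  exists_le := ⟨0, fun _ => le_rfl⟩
  exists_abs_diff_le := ⟨0, fun x v => by
    have h : X.diff (fun _ => 0) x v = 0 :=
      congrArg (fun A : Euc n →L[ℝ] ℝ => A v) mfderiv_const
    rw [h]; simp⟩
  exists_isClosed := ⟨∅, isClosed_empty, empty_subset _, fun _ _ => rfl⟩

theorem IsBump.add {W : Set M} {φ ψ : M → ℝ} (hφ : X.IsBump W φ) (hψ : X.IsBump W ψ) :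
    X.IsBump W fun x => φ x + ψ x where
  contMDiff := hφ.contMDiff.add hψ.contMDiff
  nonneg x := add_nonneg (hφ.nonneg x) (hψ.nonneg x)
  exists_le := by
    obtain ⟨B, hB⟩ := hφ.exists_le
    obtain ⟨B', hB'⟩ := hψ.exists_le
    exact ⟨B + B', fun x => add_le_add (hB x) (hB' x)⟩
  exists_abs_diff_le := by
    obtain ⟨C, hC⟩ := hφ.exists_abs_diff_le
    obtain ⟨C', hC'⟩ := hψ.exists_abs_diff_le
    refine ⟨C + C', fun x v => ?_⟩
    rw [diff_add (mdifferentiableAt_of_contMDiff hφ.contMDiff x)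
      (mdifferentiableAt_of_contMDiff hψ.contMDiff x), add_mul]
    exact (abs_add_le _ _).trans (add_le_add (hC x v) (hC' x v))
  exists_isClosed := by
    obtain ⟨F, hF, hFW, h0⟩ := hφ.exists_isClosed
    obtain ⟨F', hF', hFW', h0'⟩ := hψ.exists_isClosed
    refine ⟨F ∪ F', hF.union hF', union_subset hFW hFW', fun x hx => ?_⟩
    rw [mem_union, not_or] at hx
    rw [h0 x hx.1, h0' x hx.2, add_zero]

variable [T2Space M]

theorem exists_isBump_of_mem_reg {W : Set M} (hW : IsOpen W) {p : M} (hp : p ∈ W)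
    (hreg : p ∈ X.reg) : ∃ φ, X.IsBump W φ ∧ ∀ᶠ x in 𝓝 p, 1 ≤ φ x := by
  have hW' : (Subtype.val ⁻¹' W : Set X.reg) ∈ 𝓝 (⟨p, hreg⟩ : X.reg) :=
    (hW.preimage continuous_subtype_val).mem_nhds hp
  obtain ⟨f, -, hf⟩ := (SmoothBumpFunction.nhds_basis_tsupport (I := 𝓘(ℝ, Euc n))
    (⟨p, hreg⟩ : X.reg)).mem_iff.1 hW'
  set φ : M → ℝ := Function.extend Subtype.val f 0
  have hφ : (fun y : X.reg => φ y) = f := funext fun y => Subtype.val_injective.extend_apply _ _ y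
  have hφ0 : ∀ x ∉ X.reg, φ x = 0 := fun x hx =>
    Function.extend_apply' _ _ _ fun ⟨y, hy⟩ => hx (hy ▸ y.2)
  have hsm : ContMDiff 𝓘(ℝ, Euc n) 𝓘(ℝ, ℝ) 1 fun y : X.reg => φ y := by
    rw [hφ]; exact f.contMDiff.of_le (by simp)
  have hall : ∀ {P : ℝ → Prop}, P 0 → (∀ y, P (f y)) → ∀ x, P (φ x) := by
    intro P h0 hP x
    by_cases hx : x ∈ X.reg
    · have := congrFun hφ ⟨x, hx⟩
      simp only at this
      rw [this]
      exact hP _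
    · rw [hφ0 x hx]; exact h0
  refine ⟨φ, ⟨hsm, hall le_rfl fun y => f.nonneg,
    ⟨1, hall (P := fun t => t ≤ 1) zero_le_one fun y => f.le_one⟩,
    exists_abs_diff_le_of_hasCompactSupport hsm (by rw [hφ]; exact f.hasCompactSupport),
    ⟨Subtype.val '' tsupport f,
      (f.hasCompactSupport.isCompact.image continuous_subtype_val).isClosed,
      image_subset_iff.2 hf, fun x hx => ?_⟩⟩, ?_⟩
  · by_cases hxr : x ∈ X.reg
    · have := congrFun hφ ⟨x, hxr⟩
      simp only at this
      rw [this]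
      exact image_eq_zero_of_notMem_tsupport fun h => hx ⟨_, h, rfl⟩
    · exact hφ0 x hxr
  · have h1 : ∀ᶠ y : X.reg in 𝓝 ⟨p, hreg⟩, 1 ≤ φ y := by
      filter_upwards [f.eventuallyEq_one] with y hy
      rw [congrFun hφ y, hy, Pi.one_apply]
    have h2 := X.reg.isOpen.isOpenEmbedding_subtypeVal.map_nhds_eq ⟨p, hreg⟩
    exact h2 ▸ (eventually_map.2 h1)

/-- Bump functions at singular points: a bump function in the lifted coordinates that depends on
`|y - y₀|² + |z|²` only is invariant under `Γ`. Its gradient is bounded since the lifted metric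
dominates the euclidean one, by `exists_lift_bounds`. -/
theorem exists_isBump_of_notMem_reg {W : Set M} (hW : IsOpen W) {p : M} (hp : p ∈ W)
    (hreg : p ∉ X.reg) : ∃ φ, X.IsBump W φ ∧ ∀ᶠ x in 𝓝 p, 1 ≤ φ x := by
  classical
  obtain ⟨i, ⟨y₀, z₀⟩, hdom, rfl⟩ := X.cover p hreg
  let C : ConicChart n X.reg X.metric := X.chart i
  have hz₀ : z₀ = 0 := by
    by_contra h
    exact hreg (((X.chart i).proj_mem_reg_iff _ hdom).2 h)
  subst hz₀
  obtain ⟨K, hK, δ, hδ, hδR, hδW, hlow⟩ := C.exists_lift_bounds hdom.1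
  obtain ⟨ρ, hρ, hball⟩ : ∃ ρ > 0, ∀ q ∈ Metric.ball ((y₀, 0) : Euc C.k × Euc C.m) ρ,
      C.proj q ∈ W := by
    have h1 := (C.continuousOn_proj.continuousAt (ConicChart.isOpen_dom.mem_nhds hdom)).eventually
      (hW.mem_nhds hp)
    exact Metric.eventually_nhds_iff_ball.1 h1
  set r := min δ ρ / 2 with hr
  have hr0 : 0 < r := by have := lt_min hδ hρ; positivity
  have hrδ : 2 * r ≤ δ := by rw [hr]; linarith [min_le_left δ ρ]
  have hrρ : 2 * r ≤ ρ := by rw [hr]; linarith [min_le_right δ ρ]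
  -- the squared distance from the centre, in the lifted coordinates
  set N : Euc C.k × Euc C.m → ℝ := fun q => ‖q.1 - y₀‖ ^ 2 + ‖q.2‖ ^ 2 with hN
  have hNsm : ContDiff ℝ 1 N :=
    ((contDiff_fst.sub contDiff_const).norm_sq ℝ).add (contDiff_snd.norm_sq ℝ)
  set V : Set (Euc C.k × Euc C.m) := {q | N q ≤ 2 * r ^ 2} with hV
  have hVball : ∀ q ∈ V, ‖q.1 - y₀‖ < 2 * r ∧ ‖q.2‖ < 2 * r := by
    intro q hq
    have hq : ‖q.1 - y₀‖ ^ 2 + ‖q.2‖ ^ 2 ≤ 2 * r ^ 2 := hq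
    constructor <;> refine lt_of_pow_lt_pow_left₀ 2 (by positivity) ?_ <;>
      nlinarith [sq_nonneg ‖q.1 - y₀‖, sq_nonneg ‖q.2‖]
  have hVc : IsCompact V := by
    refine ((isCompact_closedBall y₀ (2 * r)).prod (isCompact_closedBall 0 (2 * r))
      ).of_isClosed_subset (isClosed_le hNsm.continuous continuous_const) fun q hq => ?_
    obtain ⟨h1, h2⟩ := hVball q hq
    exact ⟨mem_closedBall_iff_norm.2 h1.le, by simpa using h2.le⟩
  have hVdom : V ⊆ C.dom := by
    intro q hq
    obtain ⟨h1, h2⟩ := hVball q hq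
    refine ⟨hδW (mem_ball_iff_norm.2 (h1.trans_le hrδ)), ?_⟩
    rw [mem_ball_zero_iff]
    exact h2.trans_le (hrδ.trans hδR)
  set b : Euc C.k × Euc C.m → ℝ := fun q => Real.smoothTransition (2 - N q / r ^ 2) with hb
  have hbsm : ContDiff ℝ 1 b :=
    Real.smoothTransition.contDiff.comp (contDiff_const.sub (hNsm.div_const _))
  have hb0 : ∀ q ∉ V, b q = 0 := by
    intro q hq
    refine Real.smoothTransition.zero_of_nonpos ?_
    have h1 : 2 * r ^ 2 < N q := not_le.1 hq
    rw [sub_nonpos, le_div_iff₀ (by positivity)]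
    exact h1.le
  -- the function `b` descends to `M`, since it is invariant under the group
  set φ : M → ℝ := fun x => if h : ∃ q ∈ C.dom, C.proj q = x then b h.choose else 0 with hφ
  have hφb : ∀ q ∈ C.dom, φ (C.proj q) = b q := by
    intro q hq
    have h : ∃ q' ∈ C.dom, C.proj q' = C.proj q := ⟨q, hq, rfl⟩
    simp only [hφ]
    rw [dif_pos h]
    obtain ⟨γ, -, hγ⟩ := (C.proj_eq_iff q hq _ h.choose_spec.1).1 h.choose_spec.2.symm
    rw [hγ]
    simp [hb, hN]
  have hφcase : ∀ {P : ℝ → Prop}, P 0 → (∀ q, P (b q)) → ∀ x, P (φ x) := by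
    intro P h0 hP x
    simp only [hφ]
    split_ifs
    exacts [hP _, h0]
  have hFcl : IsClosed (C.proj '' V) :=
    (hVc.image_of_continuousOn (C.continuousOn_proj.mono hVdom)).isClosed
  have hφ0 : ∀ x ∉ C.proj '' V, φ x = 0 := by
    intro x hx
    by_cases h : ∃ q ∈ C.dom, C.proj q = x
    · obtain ⟨q, hq, rfl⟩ := h
      rw [hφb q hq, hb0 q fun h => hx ⟨q, h, rfl⟩]
    · simp only [hφ]
      rw [dif_neg h]
  have hφ0' : ∀ x : X.reg, (x : M) ∉ C.proj '' V → ∀ᶠ y : X.reg in 𝓝 x, φ y = 0 := by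
    intro x hx
    filter_upwards [(hFcl.preimage continuous_subtype_val).isOpen_compl.mem_nhds
      (show x ∈ (Subtype.val ⁻¹' (C.proj '' V))ᶜ from hx)] with y hy using hφ0 y hy
  -- regular points of the image of `V` are images of regular points
  have hlift : ∀ x : X.reg, (x : M) ∈ C.proj '' V → ∃ q ∈ V, q ∈ C.regDom ∧ C.regProj q = x := by
    rintro ⟨x, hx⟩ ⟨q, hq, hqx⟩
    have hqx : C.proj q = x := hqx
    have hqr : q ∈ C.regDom := ConicChart.mem_regDom_iff.2
      ⟨hVdom hq, (C.proj_mem_reg_iff q (hVdom hq)).1 (hqx ▸ hx)⟩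
    exact ⟨q, hq, hqr, Subtype.ext ((ConicChart.coe_regProj' hqr).trans hqx)⟩
  have hsm : ContMDiff 𝓘(ℝ, Euc n) 𝓘(ℝ, ℝ) 1 fun y : X.reg => φ y := by
    intro x
    by_cases hx : (x : M) ∈ C.proj '' V
    · obtain ⟨q, hqV, hq, rfl⟩ := hlift x hx
      have hF := C.isLocalDiffeomorphOn_regProj ⟨q, hq⟩
      have h1 : ContMDiffAt 𝓘(ℝ, Euc n) 𝓘(ℝ, ℝ) 1 (fun y => b (hF.localInverse y)) (C.regProj q) :=
        hbsm.contMDiff.contMDiffAt.comp _ (hF.localInverse_contMDiffAt.of_le (by simp))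
      refine h1.congr_of_eventuallyEq ?_
      have h2 : ∀ᶠ y in 𝓝 (C.regProj q), hF.localInverse y ∈ C.regDom := by
        have h3 := hF.localInverse_contMDiffAt.continuousAt
        refine h3.eventually (ConicChart.isOpen_regDom.mem_nhds ?_)
        rw [hF.localInverse_left_inv hF.localInverse_mem_target]
        exact hq
      filter_upwards [h2, hF.localInverse_eventuallyEq_right] with y hy hy'
      have h4 : C.regProj (hF.localInverse y) = y := hy'
      rw [← hφb _ (ConicChart.regDom_subset_dom hy), ← ConicChart.coe_regProj' hy, h4]
    · exact contMDiffAt_const.congr_of_eventuallyEq (hφ0' x hx)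
  obtain ⟨D, hD⟩ := hVc.exists_bound_of_continuousOn
    (hbsm.continuous_fderiv (by simp)).continuousOn
  refine ⟨φ, ⟨hsm, hφcase le_rfl fun q => Real.smoothTransition.nonneg _,
    ⟨1, hφcase (P := fun t => t ≤ 1) zero_le_one fun q => Real.smoothTransition.le_one _⟩,
    ⟨|D| * √K, ?_⟩,
    ⟨C.proj '' V, hFcl, ?_, hφ0⟩⟩, ?_⟩
  · intro x v
    by_cases hx : (x : M) ∈ C.proj '' V
    · obtain ⟨q, hqV, hq, rfl⟩ := hlift x hx
      have hF := C.isLocalDiffeomorphOn_regProj ⟨q, hq⟩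
      obtain ⟨w, rfl⟩ : ∃ w : Euc C.k × Euc C.m,
          mfderiv 𝓘(ℝ, Euc C.k × Euc C.m) 𝓘(ℝ, Euc n) C.regProj q w = v :=
        (hF.mfderivToContinuousLinearEquiv (by simp)).surjective v
      have h1 : X.diff φ (C.regProj q)
          (mfderiv 𝓘(ℝ, Euc C.k × Euc C.m) 𝓘(ℝ, Euc n) C.regProj q w) = fderiv ℝ b q w := by
        have h2 := mfderiv_comp q (mdifferentiableAt_of_contMDiff hsm (C.regProj q))
          (ConicChart.mdifferentiableAt_regProj hq)
        have h3 : (fun y : X.reg => φ y) ∘ C.regProj =ᶠ[𝓝 q] b := by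
          filter_upwards [ConicChart.isOpen_regDom.mem_nhds hq] with q' hq'
          rw [Function.comp_apply, ConicChart.coe_regProj' hq',
            hφb _ (ConicChart.regDom_subset_dom hq')]
        have h4 := h3.mfderiv_eq (I := 𝓘(ℝ, Euc C.k × Euc C.m)) (I' := 𝓘(ℝ, ℝ))
        have h5 : mfderiv 𝓘(ℝ, Euc C.k × Euc C.m) 𝓘(ℝ, ℝ) b q = fderiv ℝ b q := mfderiv_eq_fderiv
        exact congrArg (fun A : (Euc C.k × Euc C.m) →L[ℝ] ℝ => A w) (h2.symm.trans (h4.trans h5))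
      refine (congrArg abs h1).trans_le ?_
      obtain ⟨hq1, hq2⟩ := hVball q hqV
      have h5 := (hlow q.1 (mem_ball_iff_norm.2 (hq1.trans_le hrδ)) q.2
        (ConicChart.mem_regDom_iff.1 hq).2 (hq2.trans_le hrδ) w.1 w.2).1
      have h6 : ‖w‖ ≤ √K * √(C.lift q w w) := by
        rw [← Real.sqrt_mul hK.le]
        refine Real.le_sqrt_of_sq_le (le_trans ?_ h5)
        rcases max_choice ‖w.1‖ ‖w.2‖ with h | h <;>
          rw [Prod.norm_def, h] <;> nlinarith [sq_nonneg ‖w.1‖,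
            sq_nonneg ‖w.2‖]
      rw [ConicChart.lift_self] at h6
      calc |fderiv ℝ b q w| ≤ ‖fderiv ℝ b q‖ * ‖w‖ :=
            (fderiv ℝ b q).le_opNorm w
        _ ≤ |D| * ‖w‖ := by
            gcongr
            exact (hD q hqV).trans (le_abs_self D)
        _ ≤ |D| * (√K * _) := by gcongr
        _ = _ := by rw [mul_assoc]
    · have h1 : X.diff φ x v = 0 := by
        rw [diff_congr (ψ := fun _ => 0) (hφ0' x hx)]
        exact congrArg (fun A : Euc n →L[ℝ] ℝ => A v) mfderiv_const
      rw [h1, abs_zero]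
      positivity
  · rintro _ ⟨q, hq, rfl⟩
    refine hball q ?_
    obtain ⟨h1, h2⟩ := hVball q hq
    rw [mem_ball_iff_norm, Prod.norm_def]
    refine max_lt (h1.trans_le hrρ) ?_
    simpa using h2.trans_le hrρ
  · have hU : IsOpen {q | N q < r ^ 2} := isOpen_lt hNsm.continuous continuous_const
    have hUV : {q | N q < r ^ 2} ⊆ V := fun q hq => by
      have hq : N q < r ^ 2 := hq
      have : 0 < r ^ 2 := by positivity
      show N q ≤ 2 * r ^ 2
      linarith
    have hmem : C.proj '' {q | N q < r ^ 2} ∈ 𝓝 (C.proj (y₀, 0)) :=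
      (C.isOpen_image _ (hUV.trans hVdom) hU).mem_nhds
        ⟨_, by rw [mem_ofPred_eq]; simp [hN]; positivity, rfl⟩
    filter_upwards [hmem]
    rintro _ ⟨q, hq, rfl⟩
    rw [hφb q (hVdom (hUV hq))]
    refine (Real.smoothTransition.one_of_one_le ?_).ge
    have hq : N q < r ^ 2 := hq
    have : N q / r ^ 2 ≤ 1 := (div_le_one (by positivity)).2 hq.le
    linarith

theorem exists_isBump {W K : Set M} (hW : IsOpen W) (hK : IsCompact K) (hKW : K ⊆ W) :
    ∃ φ, X.IsBump W φ ∧ ∀ x ∈ K, 1 ≤ φ x := by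
  refine hK.induction_on (p := fun s => ∃ φ, X.IsBump W φ ∧ ∀ x ∈ s, 1 ≤ φ x)
    ⟨_, IsBump.zero W, by simp⟩ (fun s t hst ⟨φ, hφ, h⟩ => ⟨φ, hφ, fun x hx => h x (hst hx)⟩)
    (fun s t ⟨φ, hφ, h⟩ ⟨ψ, hψ, h'⟩ => ⟨_, hφ.add hψ, fun x hx => hx.elim
      (fun hx => by linarith [h x hx, hψ.nonneg x])
      fun hx => by linarith [h' x hx, hφ.nonneg x]⟩) ?_
  intro x hx
  obtain ⟨φ, hφ, h⟩ : ∃ φ, X.IsBump W φ ∧ ∀ᶠ y in 𝓝 x, 1 ≤ φ y := by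
    by_cases hreg : x ∈ X.reg
    · exact exists_isBump_of_mem_reg hW (hKW hx) hreg
    · exact exists_isBump_of_notMem_reg hW (hKW hx) hreg
  exact ⟨_, mem_nhdsWithin_of_mem_nhds h, φ, hφ, fun y hy => hy⟩

/-- There is a function with gradient at most one which vanishes on the compact set `K` and is equal
to a positive constant outside a closed subset of `W`. -/
theorem exists_cutoff {W K : Set M} (hW : IsOpen W) (hK : IsCompact K) (hKW : K ⊆ W) :
    ∃ (χ : M → ℝ) (δ : ℝ) (F : Set M), 0 < δ ∧ IsClosed F ∧ F ⊆ W ∧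
      (ContMDiff 𝓘(ℝ, Euc n) 𝓘(ℝ, ℝ) 1 fun y : X.reg => χ y) ∧
      (∀ x v, |X.diff χ x v| ≤ √(X.normSq x v)) ∧ (∀ x, |χ x| ≤ δ) ∧ (∀ x ∈ K, χ x = 0) ∧
      ∀ x ∉ F, χ x = δ := by
  obtain ⟨σ, hσ, hσK⟩ := exists_isBump (X := X) hW hK hKW
  obtain ⟨B, hB⟩ := hσ.exists_le
  obtain ⟨C, hC⟩ := hσ.exists_abs_diff_le
  obtain ⟨F, hF, hFW, hF0⟩ := hσ.exists_isClosed
  have hg : ContDiff ℝ 1 fun t : ℝ => Real.smoothTransition (1 - t) :=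
    Real.smoothTransition.contDiff.comp (contDiff_const.sub contDiff_id)
  obtain ⟨D, hD⟩ := (isCompact_Icc (a := (0 : ℝ)) (b := B)).exists_bound_of_continuousOn
    (hg.continuous_deriv le_rfl).continuousOn
  set δ := (|C| * |D| + 1)⁻¹ with hδ
  have hδ0 : 0 < δ := by positivity
  have hgδ : ContDiff ℝ 1 fun t : ℝ => δ * Real.smoothTransition (1 - t) := contDiff_const.mul hg
  refine ⟨fun x => δ * Real.smoothTransition (1 - σ x), δ, F, hδ0, hF, hFW,
    hgδ.contMDiff.comp hσ.contMDiff, fun x v => ?_, fun x => ?_, fun x hx => ?_, fun x hx => ?_⟩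
  · rw [diff_comp (g := fun t => δ * Real.smoothTransition (1 - t))
      (mdifferentiableAt_of_contMDiff hσ.contMDiff x) (hgδ.differentiable (by simp) _),
      deriv_const_mul _ (hg.differentiable (by simp) _), abs_mul, abs_mul, abs_of_pos hδ0]
    have h1 := hD (σ x) ⟨hσ.nonneg x, hB x⟩
    rw [Real.norm_eq_abs] at h1
    set s := √(X.normSq x v)
    have hs : 0 ≤ s := Real.sqrt_nonneg _
    calc |X.diff σ x v| * (δ * |deriv (fun t : ℝ => Real.smoothTransition (1 - t)) (σ x)|)
        ≤ (|C| * s) * (δ * |D|) :=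
          mul_le_mul ((hC x v).trans (mul_le_mul_of_nonneg_right (le_abs_self C) hs))
            (mul_le_mul_of_nonneg_left (h1.trans (le_abs_self D)) hδ0.le) (by positivity)
            (by positivity)
      _ = (|C| * |D|) / (|C| * |D| + 1) * s := by rw [hδ]; ring
      _ ≤ 1 * s := by
          gcongr
          exact (div_le_one (by positivity)).2 (by linarith)
      _ = s := one_mul s
  · rw [abs_of_nonneg (mul_nonneg hδ0.le (Real.smoothTransition.nonneg _))]
    exact mul_le_of_le_one_right hδ0.le (Real.smoothTransition.le_one _)
  · beta_reduce
    rw [Real.smoothTransition.zero_of_nonpos (by linarith [hσK x hx]), mul_zero]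
  · beta_reduce
    rw [hF0 x hx, sub_zero, Real.smoothTransition.one, mul_one]

end CMGA

namespace CMGA

variable {n : ℕ} {M : Type*} [TopologicalSpace M] {X : CMGA n M}

/-! ### Finite speed of propagation -/

theorem IsLocLip.add {φ ψ : M → ℝ} (hφ : X.IsLocLip φ) (hψ : X.IsLocLip ψ) :
    X.IsLocLip fun x => φ x + ψ x := fun e he => (hφ e he).add (hψ e he)

theorem abs_diff_const_add_truncDist_le {W : Set M} {R : ℝ} (c : ℝ) (x : X.reg)
    (v : TangentSpace 𝓘(ℝ, Euc n) x) :
    |X.diff (fun y => c + X.truncDist W R y) x v| ≤ √(X.normSq x v) := by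
  by_cases h : MDifferentiableAt 𝓘(ℝ, Euc n) 𝓘(ℝ, ℝ) (fun y : X.reg => X.truncDist W R y) x
  · have hd : HasDerivAt (fun t : ℝ => c + t) 1 (X.truncDist W R x) :=
      (hasDerivAt_id _).const_add c
    rw [diff_comp (g := fun t => c + t) h hd.differentiableAt, hd.deriv, mul_one]
    exact abs_diff_truncDist_le x v
  · have h1 : ¬ MDifferentiableAt 𝓘(ℝ, Euc n) 𝓘(ℝ, ℝ)
        (fun y : X.reg => c + X.truncDist W R y) x := by
      intro h2
      have h3 := MDifferentiableAt.comp x (g := fun t : ℝ => t - c) (I' := 𝓘(ℝ, ℝ))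
        (I'' := 𝓘(ℝ, ℝ))
        (by exact (differentiableAt_id.sub_const c).mdifferentiableAt) h2
      refine h (h3.congr_of_eventuallyEq (Eventually.of_forall fun y => ?_))
      simp
    have h3 : X.diff (fun y => c + X.truncDist W R y) x v = 0 :=
      congrArg (fun A : Euc n →L[ℝ] ℝ => A v) (mfderiv_zero_of_not_mdifferentiableAt h1)
    rw [h3, abs_zero]
    exact Real.sqrt_nonneg _

/-- The truncated distance from `W` is lower semicontinuous along the regular part, also at singular
points. -/
theorem eventually_le_truncDist {W : Set M} {R T ε : ℝ} (hε : 0 < ε) {x : M}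
    (hx : T ≤ X.truncDist W R x) : ∀ᶠ y in 𝓝 x, y ∈ X.reg → T - ε ≤ X.truncDist W R y := by
  by_cases hreg : x ∈ X.reg
  · have h1 := (isLocLip_truncDist (X := X) (W := W) (R := R)).continuous.continuousAt
      (x := ⟨x, hreg⟩)
    have h2 : ∀ᶠ y : X.reg in 𝓝 ⟨x, hreg⟩, T - ε ≤ X.truncDist W R y :=
      (h1.eventually (lt_mem_nhds (by linarith : T - ε < X.truncDist W R x))).mono
        fun y hy => hy.le
    have h3 := X.reg.isOpen.isOpenEmbedding_subtypeVal.map_nhds_eq ⟨x, hreg⟩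
    have h4 : ∀ᶠ y in 𝓝 x, T - ε ≤ X.truncDist W R y := h3 ▸ (eventually_map.2 h2)
    exact h4.mono fun y hy _ => hy
  · filter_upwards [eventually_dist_le hreg hε] with y hy hyr
    linarith [truncDist_le_add (W := W) (R := R) hε.le (hy hyr)]

variable [MeasurableSpace M]

theorem isClosed_supp (u : X.L2) : IsClosed (X.supp u) := by
  rw [← isOpen_compl_iff, isOpen_iff_mem_nhds]
  intro x hx
  simp only [supp, mem_compl_iff, mem_ofPred_eq, not_forall, not_not] at hx
  obtain ⟨U, hU, hxU, h⟩ := hx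
  filter_upwards [hU.mem_nhds hxU] with y hy hys using hys U hU hy h

/-- A function vanishes almost everywhere outside its support, by the Lindelöf property. -/
theorem ae_eq_zero_of_notMem_supp [SecondCountableTopology M] (u : X.L2) :
    ∀ᵐ x ∂X.vol, x ∉ X.supp u → u x = 0 := by
  refine measure_null_of_locally_null _ fun x hx => ?_
  have hx : ¬ (x ∉ X.supp u → u x = 0) := hx
  have hx' : x ∉ X.supp u := fun h => hx fun h' => (h' h).elim
  simp only [supp, mem_ofPred_eq, not_forall, not_not] at hx'
  obtain ⟨U, hU, hxU, h⟩ := hx'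
  have hnull : X.vol {y | ¬ (y ∈ U → u y = 0)} = 0 := h
  refine ⟨_ ∩ U, inter_mem self_mem_nhdsWithin (mem_nhdsWithin_of_mem_nhds (hU.mem_nhds hxU)),
    measure_mono_null (fun y hy => ?_) hnull⟩
  exact fun h' => hy.1 fun _ => h' hy.2

variable [T2Space M] [SecondCountableTopology M] [BorelSpace M]

/-- Finite speed of propagation. A point `x` with `d_M(x, W) ≥ T` has a neighbourhood in which
`ρ = χ + d_M(·, W) ≥ T + δ / 2`, where `χ` is the cutoff that vanishes on the supports of the data
and is `δ` near the complement of `W`. -/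
theorem IsWaveSolution.supp_subset {W : Set M} (hWo : IsOpen W) (hWc : IsCompact (closure W))
    {v₀ v₁ : X.L2} (hv : X.supp v₀ ∪ X.supp v₁ ⊆ W) {u : ℝ → X.L2}
    (hu : X.IsWaveSolution v₀ v₁ u) {T : ℝ} (hT : 0 < T) :
    X.supp (u T) ⊆ X.domainOfInfluence W T := by
  have hK : IsCompact (X.supp v₀ ∪ X.supp v₁) :=
    hWc.of_isClosed_subset ((isClosed_supp v₀).union (isClosed_supp v₁)) (hv.trans subset_closure)
  obtain ⟨χ, δ, F, hδ, hF, hFW, hχ, hχd, hχδ, hχK, hχF⟩ := exists_cutoff (X := X) hWo hK hv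
  -- the truncation level `R > T` does not affect the distance up to `T`
  set R := T + 1 with hR
  have hR0 : 0 ≤ R := by linarith
  set ρ : M → ℝ := fun x => χ x + X.truncDist W R x with hρ
  have hρL : X.IsLocLip ρ := (isLocLip_of_contMDiff hχ).add isLocLip_truncDist
  have hρd : ∀ x v, |X.diff ρ x v| ≤ √(X.normSq x v) := by
    intro x v
    have hc : ContinuousAt (Subtype.val : X.reg → M) x := continuous_subtype_val.continuousAt
    by_cases hx : (x : M) ∈ W
    · have h1 : ∀ᶠ y : X.reg in 𝓝 x, ρ y = χ y := by
        filter_upwards [hc.eventually (hWo.mem_nhds hx)] with y hy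
        simp only [hρ, truncDist_eq_zero hy, add_zero]
      rw [diff_congr (ψ := χ) h1]
      exact hχd x v
    · have h1 : ∀ᶠ y : X.reg in 𝓝 x, ρ y = δ + X.truncDist W R y := by
        filter_upwards [hc.eventually (hF.isOpen_compl.mem_nhds fun h => hx (hFW h))] with y hy
        simp only [hρ, hχF _ hy]
      rw [diff_congr (ψ := fun y => δ + X.truncDist W R y) h1]
      exact abs_diff_const_add_truncDist_le δ x v
  have hρB : ∀ x, |ρ x| ≤ δ + R := fun x => by
    refine (abs_add_le _ _).trans (add_le_add (hχδ x) ?_)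
    rw [abs_of_nonneg (truncDist_nonneg x)]
    exact truncDist_le hR0 x
  have hρK : ∀ x ∈ X.supp v₀ ∪ X.supp v₁, ρ x = 0 := fun x hx => by
    simp only [hρ, hχK x hx, truncDist_eq_zero (hv hx), add_zero]
  have h₀ : ∀ᵐ x ∂X.vol, ρ x ≠ 0 → v₀ x = 0 :=
    (ae_eq_zero_of_notMem_supp v₀).mono fun x hx h => hx fun h' => h (hρK x (Or.inl h'))
  have h₁ : ∀ᵐ x ∂X.vol, ρ x ≠ 0 → v₁ x = 0 :=
    (ae_eq_zero_of_notMem_supp v₁).mono fun x hx h => hx fun h' => h (hρK x (Or.inr h'))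
  have main := hu.ae_eq_zero hρL hρd hρB h₀ h₁ hT (r := T + δ / 2) (by linarith)
  have hreg : ∀ᵐ x ∂X.vol, x ∈ X.reg := ae_vol_iff.2 (Eventually.of_forall fun x => x.2)
  intro x hx
  by_contra hxT
  have hxW : x ∉ W := fun h => hxT <|
    ((iInf₂_le x h).trans (dist_self x).le).trans_lt (ENNReal.ofReal_pos.2 hT)
  have hev := (eventually_le_truncDist (half_pos hδ)
    (le_truncDist_of_notMem (R := R) (by linarith) hxT)).and
    (hF.isOpen_compl.mem_nhds fun h => hxW (hFW h))
  obtain ⟨U, hUsub, hU, hxU⟩ := mem_nhds_iff.1 hev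
  refine hx U hU hxU ?_
  filter_upwards [main, hreg] with y hy hyr hyU
  obtain ⟨h1, h2⟩ := hUsub hyU
  refine hy ?_
  simp only [hρ, hχF y h2]
  linarith [h1 hyr]

end CMGA

theorem mainTheorem4 {n : ℕ} {M : Type*} [TopologicalSpace M] [T2Space M]
    [SecondCountableTopology M] [MeasurableSpace M] [BorelSpace M] (X : CMGA n M)
    (W : Set M) (hWo : IsOpen W) (hWc : IsCompact (closure W))
    (v₀ v₁ : X.L2) (hv : X.supp v₀ ∪ X.supp v₁ ⊆ W)
    (u : ℝ → X.L2) (hu : X.IsWaveSolution v₀ v₁ u) (T : ℝ) (hT : 0 < T) :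
    X.supp (u T) ⊆ X.domainOfInfluence W T :=
  hu.supp_subset hWo hWc hv hT
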